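/- Fix integers $k\ge 1$ and $L\ge 0$, a probability vector $p=(p_1,\dots,p_k)$ and points $\mu_1,\dots,\mu_k\in\mathbb R^{k-1}$ with $\sum_a p_a\mu_a=0$ and $\sum_a p_a\mu_a\mu_a^T=I$. Let $(X_i,Y_i)$, $i=1,2,\dots$, be i.i.d. pairs, where $X_i=\mu_a$ with probability $p_a$ and $Y_i$ takes values in an arbitrary measurable space, with any conditional laws given $X_i=\mu_a$ ($a=1,\dots,k$). For a positive semidefinite matrix $S$ of size $(k-1)\times(k-1)$ let $\tilde Y_i=S^{1/2}X_i+N_i$, where the $N_i\sim\mathcal N(0,I_{k-1})$ are independent of each other and of all $(X_j,Y_j)$. Write $\mathcal I(S)=I(X_1;Y_1,\tilde Y_1)$ for the mutual information in nats, as a function of $S\succeq 0$ (with the law of $(X_1,Y_1)$ fixed). Let $R_1,\dots,R_L$ be fixed symmetric $(k-1)\times(k-1)$ matrices, each of which is positive definite or negative definite, and for each $\ell$ let $d_\ell=d_\ell(n)$ be a sequence of real numbers such that $d_\ell\to\infty$ and $n-d_\ell\to\infty$ as $n\to\infty$. For each $n$ put $\mathbf X=(X_1,\dots,X_n)$, $\mathbf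 Y=(Y_1,\dots,Y_n)$, $\tilde{\mathbf Y}=(\tilde Y_1,\dots,\tilde Y_n)$. Let $\mathbf G_1,\dots,\mathbf G_L$ be the symmetric $n\times n$ binary adjacency matrices, with zero diagonal, of $L$ random graphs which, given $\mathbf X$, are independent of each other and of $(\mathbf Y,\tilde{\mathbf Y})$, and whose entries $G^\ell_{ij}$, $i<j$, are, given $\mathbf X$, independent Bernoulli variables with $$\Pr(G^\ell_{ij}=1\mid\mathbf X)=\frac{d_\ell}{n}+\frac{\sqrt{d_\ell(1-d_\ell/n)}}{n}\,X_i^TR_\ell X_j .$$ (This number lies in $[0,1]$ for all sufficiently large $n$; for the finitely many other $n$ it is replaced by the nearest point of $[0,1]$.) Let $\mathcal U=\{U \text{ symmetric}: 0\preceq U\preceq I\}$ and, for $U\in\mathcal U$, $$\mathcal F(U)=\mathcal I\Big(S+\sum_{\ell=1}^L R_\ell(I-U)R_\ell\Big)+\frac14\sum_{\ell=1}^L\operatorname{tr}\big((R_\ell U)^2\big).$$ Then $\mathcal F$ is finite on $\mathcal U$ and attains its minimum there, and $$\limsup_{n\to\infty}\frac1n I(\mathbf X;\mathbf Y,\tilde{\mathbf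 Y},\mathbf G_1,\dots,\mathbf G_L)\le\min_{U\in\mathcal U}\mathcal F(U).$$ -/

import Mathlib

open MeasureTheory ProbabilityTheory Filter Topology
open scoped ENNReal MatrixOrder

noncomputable section

namespace CommunityDetection

/-! ### Mutual information -/

/-- The mutual information `I(A; B)` (in nats) of a pair `(A, B)` with joint law `ρ`: the relative
entropy of the joint law with respect to the product of its marginals. -/
def mutualInfo {α β : Type*} [MeasurableSpace α] [MeasurableSpace β] (ρ : Measure (α × β)) :
    ℝ≥0∞ :=
  InformationTheory.klDiv ρ (ρ.fst.prod ρ.snd)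

/-- The law of a pair `(A, B)` where `A` takes the value `x a` with probability `w a`, and `B` has
law `κ a` given that choice. -/
def mixtureLaw {ι α β : Type*} [Fintype ι] [MeasurableSpace α] [MeasurableSpace β]
    (w : ι → ℝ) (x : ι → α) (κ : ι → Measure β) : Measure (α × β) :=
  ∑ a, ENNReal.ofReal (w a) • (Measure.dirac (x a)).prod (κ a)

/-! ### Labels and covariates -/

/-- `p` is a probability vector, and the label points `μ₁, …, μ_k ∈ ℝ^{k-1}` are whitened under
`p`: `∑ p_a μ_a = 0` and `∑ p_a μ_a μ_aᵀ = I`. -/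
structure IsWhitened {k : ℕ} (p : Fin k → ℝ) (μ : Fin k → Fin (k - 1) → ℝ) : Prop where
  nonneg : ∀ a, 0 ≤ p a
  sum_eq_one : ∑ a, p a = 1
  mean : ∑ a, p a • μ a = 0
  cov : ∑ a, p a • Matrix.vecMulVec (μ a) (μ a) = 1

/-- The linear Gaussian channel: the law of `S^{1/2} x + N` with `N ∼ 𝒩(0, I)`. -/
def gaussianChannel {m : ℕ} (S : Matrix (Fin m) (Fin m) ℝ) (x : Fin m → ℝ) :
    Measure (Fin m → ℝ) :=
  (Measure.pi fun _ : Fin m => gaussianReal 0 1).map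
    (fun z => (CFC.sqrt S).mulVec x + z)

/-- The single-node information function `𝓘(S) = I(X₁; Y₁, Ỹ₁)`, where `X₁ = μ_a` with probability
`p_a`, the conditional law of `Y₁` given `X₁ = μ_a` is `Q a`, and `Ỹ₁ = S^{1/2} X₁ + N₁` with `N₁`
standard Gaussian and independent of `(X₁, Y₁)`. -/
def infoFun {k : ℕ} {𝒴 : Type*} [MeasurableSpace 𝒴] (p : Fin k → ℝ)
    (μ : Fin k → Fin (k - 1) → ℝ) (Q : Fin k → Measure 𝒴)
    (S : Matrix (Fin (k - 1)) (Fin (k - 1)) ℝ) : ℝ≥0∞ :=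
  mutualInfo (mixtureLaw p μ fun a => (Q a).prod (gaussianChannel S (μ a)))

/-! ### Degree-balanced stochastic block models -/

/-- The edge probability `d/n + √(d (1 - d/n)) / n · xᵀ R y` between nodes with labels `x`, `y`. -/
def edgeProb {m : ℕ} (n : ℕ) (d : ℝ) (R : Matrix (Fin m) (Fin m) ℝ) (x y : Fin m → ℝ) : ℝ :=
  d / n + √(d * (1 - d / n)) / n * (x ⬝ᵥ R.mulVec y)

/-- The symmetric adjacency matrix, with zero diagonal, of the graph whose edges `i < j` are
indicated by `e`. -/
def adjacency {n : ℕ} (e : {q : Fin n × Fin n // q.1 < q.2} → Bool) : Fin n → Fin n → Bool :=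
  fun i j =>
    if h : i < j then e ⟨(i, j), h⟩
    else if h : j < i then e ⟨(j, i), h⟩
    else false

/-- The law of the adjacency matrix of a degree-balanced stochastic block model given the labels
`x₁, …, x_n`: the entries with `i < j` are independent Bernoulli variables with success probability
`edgeProb n d R (x i) (x j)`. A value outside `[0, 1]` is replaced by the nearest point
of `[0, 1]`; when `d` and `n - d` tend to infinity and the labels are bounded, this happens
for finitely many `n` only. -/
def networkLaw {m : ℕ} (n : ℕ) (d : ℝ) (R : Matrix (Fin m) (Fin m) ℝ)
    (x : Fin n → Fin m → ℝ) : Measure (Fin n → Fin n → Bool) :=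
  (Measure.pi fun q : {q : Fin n × Fin n // q.1 < q.2} =>
    bernoulliMeasure true false
      (Set.projIcc (0 : ℝ) 1 zero_le_one (edgeProb n d R (x q.1.1) (x q.1.2)))).map adjacency

/-- The joint law of the labels `𝐗 = (X₁, …, X_n)` and the observations `(𝐘, 𝐘̃, (𝐆₁, …, 𝐆_L))`.
The labels are i.i.d. (`X_i = μ (a i)`, where the assignment `a` has probability `∏ p (a i)`);
given the labels, all the `Y_i`, `Ỹ_i` and `𝐆_ℓ` are independent, with laws `Q (a i)`,
`gaussianChannel S (X_i)` and `networkLaw n (d ℓ) (R ℓ) 𝐗`. -/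
def modelLaw {k L : ℕ} {𝒴 : Type*} [MeasurableSpace 𝒴] (p : Fin k → ℝ)
    (μ : Fin k → Fin (k - 1) → ℝ) (Q : Fin k → Measure 𝒴)
    (S : Matrix (Fin (k - 1)) (Fin (k - 1)) ℝ)
    (R : Fin L → Matrix (Fin (k - 1)) (Fin (k - 1)) ℝ) (n : ℕ) (d : Fin L → ℝ) :
    Measure ((Fin n → Fin (k - 1) → ℝ) ×
      ((Fin n → 𝒴) × (Fin n → Fin (k - 1) → ℝ)) × (Fin L → Fin n → Fin n → Bool)) :=
  mixtureLaw (ι := Fin n → Fin k)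
    (fun a => ∏ i, p (a i))
    (fun a i => μ (a i))
    (fun a =>
      ((Measure.pi fun i => Q (a i)).prod
          (Measure.pi fun i => gaussianChannel S (μ (a i)))).prod
        (Measure.pi fun ℓ => networkLaw n (d ℓ) (R ℓ) fun i => μ (a i)))

/-! ### The potential -/

/-- The set `𝒰` of symmetric matrices `U` with `0 ⪯ U ⪯ I`. -/
def unitMatrices (m : ℕ) : Set (Matrix (Fin m) (Fin m) ℝ) :=
  {U | U.PosSemidef ∧ (1 - U).PosSemidef}

/-- The potential `𝓕(U) = 𝓘(S + ∑ R_ℓ (I - U) R_ℓ) + ¼ ∑ tr((R_ℓ U)²)`. The second summand is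
nonnegative for symmetric `R_ℓ` and `U ⪰ 0`, so that `ENNReal.ofReal` is harmless there. -/
def potential {k L : ℕ} {𝒴 : Type*} [MeasurableSpace 𝒴] (p : Fin k → ℝ)
    (μ : Fin k → Fin (k - 1) → ℝ) (Q : Fin k → Measure 𝒴)
    (S : Matrix (Fin (k - 1)) (Fin (k - 1)) ℝ)
    (R : Fin L → Matrix (Fin (k - 1)) (Fin (k - 1)) ℝ)
    (U : Matrix (Fin (k - 1)) (Fin (k - 1)) ℝ) : ℝ≥0∞ :=
  infoFun p μ Q (S + ∑ ℓ, R ℓ * (1 - U) * R ℓ) +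
    ENNReal.ofReal (1 / 4 * ∑ ℓ, ((R ℓ * U) ^ 2).trace)

end CommunityDetection

end

-- Entropy on the positive cone, and channels acting on it.

noncomputable section

namespace CommunityDetection

/-! ### A third-order expansion of `v log v` -/

-- Mutual information is the entropy of the labels minus the entropy left by the observations
-- (`mutualInfo_mixtureLaw`), so the claim is a lower bound on the entropy left by the graphs. Fix
-- `U`, put `V = I - U` and `M = ∑ R_ℓ V R_ℓ`, and compare the graphs with an extra Gaussian
-- observation of strength `M` at every node. The comparison problem decouples over nodes and leaves
-- exactly `n` times the entropy of one label at strength `S + M` (`chan_nodewise_gauss`).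
--
-- The two are joined by a path: at time `t` each vertex pair of each graph is disclosed with
-- probability `t`, and the Gaussian observation has strength `(1 - t) M`. Every small piece of
-- either observation is a weak channel, and a weak channel removes, to leading order, half of (mean
-- square of the signal minus its squared posterior mean); see `abs_chan_coneEntropy_sub_le`. For an
-- edge the signal is `X_iᵀ R X_j`, weighted by the variance `1/n` of the edge score.
--
-- Squared posterior means are averages over two independent posterior samples `X, X'`. In terms of
-- their overlap `T = Xᵀ X'`, the posterior terms of the two rates are `tr(R V R Tᵀ) / 2` and, up to
-- diagonal terms, `tr(T R Tᵀ R) / (4n)`, with opposite signs. Since `tr(A R Aᵀ R) ≥ 0` for definite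
-- `R`, taking `A = T - nV` bounds their difference by `n tr(V R V R) / 4`
-- (`overlap_linearization_le`). This holds for every posterior, so no concentration of the overlap
-- is needed. Together with the prior terms `n tr(R²) / 4` and `-n tr(R V R) / 2` it gives `n tr((R
-- U)²) / 4`, the quadratic part of the potential.
--
-- The errors come from the third order of the expansion. The edge scores are bounded by some `ε`
-- that tends to zero because `d` and `n - d` diverge; there are about `n² / 2` pairs per graph,
-- each contributing order `ε / n`, so the error per node is of order `ε`.
--
-- Technically, entropy is extended to unnormalised posteriors as a function homogeneous of degree
-- one (`coneEntropy`), so that a channel acts by `v ↦ ∫ F (v * f y)` and no normalisation is ever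
-- needed. The minimum exists because the potential is lower semicontinuous on a compact set
-- (`exists_isMinOn_potential`).

theorem log_le_half_sub_inv {y : ℝ} (hy : 1 ≤ y) : Real.log y ≤ (y - y⁻¹) / 2 := by
  have h0 : 0 ≤ Real.log y := Real.log_nonneg hy
  -- This is `u ≤ sinh u` at `u = log y`.
  have := Real.self_le_sinh_iff.2 h0
  rwa [Real.sinh_log (by linarith)] at this

/-- For `r ≥ 0` the bounds are `2r / (r + 2) ≤ log (1 + r)` and the sinh bound; for `r = -x < 0`
they are two terms of the series of `-log (1 - x)` and the sinh bound at `(1 - x)⁻¹`. The constant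
`1/2` is attained at `r = -1`. -/
theorem abs_one_add_mul_log_sub_le {r : ℝ} (hr : -1 ≤ r) :
    |(1 + r) * Real.log (1 + r) - r - r ^ 2 / 2| ≤ |r| ^ 3 / 2 := by
  rcases le_or_gt 0 r with h | h
  · rw [abs_of_nonneg h]
    have h1 := log_le_half_sub_inv (y := 1 + r) (by linarith)
    have h2 := Real.le_log_one_add_of_nonneg h
    have hp : 0 < 1 + r := by linarith
    have h3 : (1 + r) * Real.log (1 + r) ≤ r + r ^ 2 / 2 := by
      calc _ ≤ (1 + r) * ((1 + r - (1 + r)⁻¹) / 2) := by gcongr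
        _ = _ := by field_simp; ring
    have h4 : r + r ^ 2 / 2 - r ^ 3 / 2 ≤ (1 + r) * Real.log (1 + r) := by
      calc _ ≤ (1 + r) * (2 * r / (r + 2)) := by
            rw [← sub_nonneg]
            have : (1 + r) * (2 * r / (r + 2)) - (r + r ^ 2 / 2 - r ^ 3 / 2)
              = (r ^ 3 / 2 + r ^ 4 / 2) / (r + 2) := by field_simp; ring
            rw [this]; positivity
        _ ≤ _ := by gcongr
    have : 0 ≤ r ^ 3 := by positivity
    rw [abs_le]; constructor <;> linarith
  · obtain ⟨x, rfl⟩ : ∃ x, r = -x := ⟨-r, by ring⟩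
    rw [abs_neg, abs_of_pos (by linarith : 0 < x)]
    have hx : 0 < x := by linarith
    -- The endpoint `r = -1` is separate: there `log 0 = 0` makes the product vanish, as it should.
    rcases eq_or_lt_of_le hr with h1 | h1
    · have : x = 1 := by linarith
      subst this; norm_num
    have hx1 : x < 1 := by linarith
    have hp : 0 < 1 - x := by linarith
    have h2 := log_le_half_sub_inv (y := (1 - x)⁻¹) ((one_le_inv₀ hp).2 (by linarith))
    rw [Real.log_inv, inv_inv] at h2
    have h3 : x + x ^ 2 / 2 ≤ - Real.log (1 - x) := by
      have := Real.hasSum_pow_div_log_of_abs_lt_one (x := x) (by rw [abs_of_pos hx]; exact hx1)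
      have h := sum_le_hasSum (Finset.range 2) (fun i _ => by positivity) this
      simp [Finset.sum_range_succ] at h
      norm_num at h
      linarith
    have h4 : (1 - x) * Real.log (1 - x) ≤ - x + x ^ 2 / 2 + x ^ 3 / 2 := by
      have : (1 - x) * (x + x ^ 2 / 2) ≤ (1 - x) * (- Real.log (1 - x)) := by gcongr
      nlinarith
    have h5 : -x + x ^ 2 / 2 ≤ (1 - x) * Real.log (1 - x) := by
      have : (1 - x) * (- Real.log (1 - x)) ≤ (1 - x) * (((1 - x)⁻¹ - (1 - x)) / 2) := by gcongr
      have h6 : (1 - x) * (((1 - x)⁻¹ - (1 - x)) / 2) = x - x ^ 2 / 2 := by field_simp; ring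
      linarith
    have : 0 ≤ x ^ 3 := by positivity
    rw [← sub_eq_add_neg, abs_le]; constructor <;> nlinarith

/-! ### Functions of linear growth on the positive cone, and channels acting on them -/

variable {ι Y Y' : Type*} [Fintype ι] [MeasurableSpace Y] [MeasurableSpace Y']

/-- `v̄ log v̄ - ∑ v_a log v_a` with `v̄ = ∑ v_a`: the Shannon entropy, extended to the cone of
unnormalised probability vectors as a function homogeneous of degree one. -/
def coneEntropy (v : ι → ℝ) : ℝ :=
  (∑ a, v a) * Real.log (∑ a, v a) - ∑ a, v a * Real.log (v a)

/-- Measurable functions whose absolute value is bounded on the positive cone by a multiple of the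
total mass. -/
structure LinearGrowth (F : (ι → ℝ) → ℝ) : Prop where
  measurable : Measurable F
  bound : ∃ C, 0 ≤ C ∧ ∀ v, 0 ≤ v → |F v| ≤ C * ∑ a, v a

/-- `f · a` are probability densities with respect to `ν`. -/
structure IsChannel (ν : Measure Y) (f : Y → ι → ℝ) : Prop where
  measurable : Measurable f
  nonneg : ∀ y, 0 ≤ f y
  integrable : ∀ a, Integrable (fun y => f y a) ν
  integral_eq_one : ∀ a, ∫ y, f y a ∂ν = 1

/-- The average of `F` over the unnormalised posterior, when the output of the channel with
densities `f` is observed under the unnormalised prior `v`. -/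
def chan (ν : Measure Y) (f : Y → ι → ℝ) (F : (ι → ℝ) → ℝ) (v : ι → ℝ) : ℝ :=
  ∫ y, F (v * f y) ∂ν

theorem LinearGrowth.add {F G : (ι → ℝ) → ℝ} (hF : LinearGrowth F) (hG : LinearGrowth G) :
    LinearGrowth (F + G) := by
  obtain ⟨hF, C, hC, hFC⟩ := hF
  obtain ⟨hG, D, hD, hGD⟩ := hG
  refine ⟨hF.add hG, C + D, by positivity, fun v hv => ?_⟩
  rw [add_mul]
  exact (abs_add_le _ _).trans (add_le_add (hFC v hv) (hGD v hv))

theorem LinearGrowth.const_smul {F : (ι → ℝ) → ℝ} (hF : LinearGrowth F) (c : ℝ) :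
    LinearGrowth (c • F) := by
  obtain ⟨hF, C, hC, hFC⟩ := hF
  refine ⟨hF.const_smul c, |c| * C, by positivity, fun v hv => ?_⟩
  rw [Pi.smul_apply, smul_eq_mul, abs_mul, mul_assoc]
  exact mul_le_mul_of_nonneg_left (hFC v hv) (abs_nonneg c)

theorem LinearGrowth.sub {F G : (ι → ℝ) → ℝ} (hF : LinearGrowth F) (hG : LinearGrowth G) :
    LinearGrowth (F - G) := by
  have := hF.add (hG.const_smul (-1))
  rwa [neg_one_smul, ← sub_eq_add_neg] at this

theorem LinearGrowth.zero : LinearGrowth (0 : (ι → ℝ) → ℝ) :=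
  ⟨measurable_const, 0, le_rfl, fun v _ => by simp⟩

theorem LinearGrowth.sum {E : Type*} (s : Finset E) {F : E → (ι → ℝ) → ℝ}
    (hF : ∀ e, LinearGrowth (F e)) : LinearGrowth (∑ e ∈ s, F e) := by
  classical
  induction s using Finset.induction_on with
  | empty => simpa using LinearGrowth.zero
  | insert e s he ih => rw [Finset.sum_insert he]; exact (hF e).add ih

/-- The linear functional `v ↦ ∑ v_a x_a`. -/
def linFun (x : ι → ℝ) (v : ι → ℝ) : ℝ := ∑ a, v a * x a

theorem LinearGrowth.linFun (x : ι → ℝ) : LinearGrowth (linFun x) := by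
  refine ⟨by unfold CommunityDetection.linFun; fun_prop, ∑ a, |x a|, by positivity, fun v hv => ?_⟩
  unfold CommunityDetection.linFun
  refine (Finset.abs_sum_le_sum_abs _ _).trans ?_
  rw [Finset.mul_sum]
  refine Finset.sum_le_sum fun a _ => ?_
  rw [abs_mul, abs_of_nonneg (hv a), mul_comm]
  exact mul_le_mul_of_nonneg_right
    (Finset.single_le_sum (f := fun a => |x a|) (fun _ _ => abs_nonneg _) (Finset.mem_univ a)) (hv a)

theorem coneEntropy_nonneg {v : ι → ℝ} (hv : 0 ≤ v) : 0 ≤ coneEntropy v := by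
  unfold coneEntropy
  rw [Finset.sum_mul, ← Finset.sum_sub_distrib]
  refine Finset.sum_nonneg fun a _ => ?_
  rcases eq_or_lt_of_le (hv a) with h | h
  · simp only [Pi.zero_apply] at h; simp [← h]
  · rw [← mul_sub]
    refine mul_nonneg (hv a) (sub_nonneg.2 (Real.log_le_log h ?_))
    exact Finset.single_le_sum (fun b _ => hv b) (Finset.mem_univ a)

/-- The factor is cruder than `log (card ι)`; it follows termwise from `log y ≤ y - 1`, and only
linear growth matters. -/
theorem coneEntropy_le {v : ι → ℝ} (hv : 0 ≤ v) :
    coneEntropy v ≤ Fintype.card ι * ∑ a, v a := by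
  unfold coneEntropy
  rw [Finset.sum_mul, ← Finset.sum_sub_distrib]
  have : (Fintype.card ι * ∑ a, v a) = ∑ _b : ι, ∑ a, v a := by simp
  rw [this]
  refine Finset.sum_le_sum fun b _ => ?_
  have h0 : 0 ≤ ∑ a, v a := Finset.sum_nonneg fun b _ => hv b
  rcases eq_or_lt_of_le (hv b) with h | h
  · simp only [Pi.zero_apply] at h; simpa [← h] using h0
  · have h1 : 0 < ∑ a, v a :=
      h.trans_le (Finset.single_le_sum (fun b _ => hv b) (Finset.mem_univ b))
    simp only [Pi.zero_apply] at h
    rw [← mul_sub, ← Real.log_div h1.ne' h.ne']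
    have := Real.log_le_sub_one_of_pos (div_pos h1 h)
    calc _ ≤ v b * ((∑ a, v a) / v b - 1) := by gcongr
      _ = ∑ a, v a - v b := by field_simp
      _ ≤ _ := by linarith

theorem continuous_coneEntropy : Continuous (coneEntropy : (ι → ℝ) → ℝ) := by
  unfold coneEntropy
  refine Continuous.sub ?_ (continuous_finsetSum _ fun a _ => ?_)
  · exact Real.continuous_mul_log.comp (f := fun v : ι → ℝ => ∑ a, v a) (by fun_prop)
  · exact Real.continuous_mul_log.comp (continuous_apply a)

theorem LinearGrowth.coneEntropy : LinearGrowth (coneEntropy : (ι → ℝ) → ℝ) :=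
  ⟨continuous_coneEntropy.measurable, Fintype.card ι, by positivity, fun v hv => by
    rw [abs_of_nonneg (coneEntropy_nonneg hv)]; exact coneEntropy_le hv⟩

/-- `(∑ v_a θ_a)² / ∑ v_a`. -/
def sqMean (θ : ι → ℝ) (v : ι → ℝ) : ℝ := (∑ a, v a * θ a) ^ 2 / ∑ a, v a

theorem LinearGrowth.sqMean (θ : ι → ℝ) : LinearGrowth (sqMean θ) := by
  refine ⟨by unfold CommunityDetection.sqMean; fun_prop, (∑ a, |θ a|) ^ 2, by positivity,
    fun v hv => ?_⟩
  have h0 : 0 ≤ ∑ a, v a := Finset.sum_nonneg fun b _ => hv b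
  unfold CommunityDetection.sqMean
  rw [abs_of_nonneg (div_nonneg (sq_nonneg _) h0)]
  refine div_le_of_le_mul₀ h0 (by positivity) ?_
  have h1 : |∑ a, v a * θ a| ≤ (∑ a, |θ a|) * ∑ a, v a := by
    refine (Finset.abs_sum_le_sum_abs _ _).trans ?_
    rw [Finset.mul_sum]
    refine Finset.sum_le_sum fun a _ => ?_
    rw [abs_mul, abs_of_nonneg (hv a), mul_comm]
    exact mul_le_mul_of_nonneg_right
      (Finset.single_le_sum (f := fun a => |θ a|) (fun _ _ => abs_nonneg _) (Finset.mem_univ a))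
      (hv a)
  rw [← sq_abs]
  calc _ ≤ ((∑ a, |θ a|) * ∑ a, v a) ^ 2 := by gcongr
    _ = _ := by ring

section Channel

variable {ν : Measure Y} {f : Y → ι → ℝ} {ν' : Measure Y'} {f' : Y' → ι → ℝ}

theorem IsChannel.mul_nonneg (hf : IsChannel ν f) {v : ι → ℝ} (hv : 0 ≤ v) (y : Y) :
    0 ≤ v * f y := fun a => _root_.mul_nonneg (hv a) (hf.nonneg y a)

theorem IsChannel.integrable_comp (hf : IsChannel ν f) {F : (ι → ℝ) → ℝ} (hF : LinearGrowth F)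
    {v : ι → ℝ} (hv : 0 ≤ v) : Integrable (fun y => F (v * f y)) ν := by
  obtain ⟨hF, C, hC, hFC⟩ := hF
  refine Integrable.mono' (g := fun y => C * ∑ a, v a * f y a) ?_ ?_ ?_
  · exact (integrable_finsetSum _ fun a _ => (hf.integrable a).const_mul (v a)).const_mul C
  · have := hf.measurable
    exact (hF.comp (measurable_const.mul this)).aestronglyMeasurable
  · exact Eventually.of_forall fun y => hFC _ (hf.mul_nonneg hv y)

theorem chan_mono (hf : IsChannel ν f) {F G : (ι → ℝ) → ℝ} (hF : LinearGrowth F)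
    (hG : LinearGrowth G) (h : ∀ v, 0 ≤ v → F v ≤ G v) {v : ι → ℝ} (hv : 0 ≤ v) :
    chan ν f F v ≤ chan ν f G v :=
  integral_mono (hf.integrable_comp hF hv) (hf.integrable_comp hG hv)
    fun y => h _ (hf.mul_nonneg hv y)

theorem chan_congr (hf : IsChannel ν f) {F G : (ι → ℝ) → ℝ}
    (h : ∀ v, 0 ≤ v → F v = G v) {v : ι → ℝ} (hv : 0 ≤ v) :
    chan ν f F v = chan ν f G v :=
  integral_congr_ae <| Eventually.of_forall fun y => h _ (hf.mul_nonneg hv y)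

theorem chan_add (hf : IsChannel ν f) {F G : (ι → ℝ) → ℝ} (hF : LinearGrowth F)
    (hG : LinearGrowth G) {v : ι → ℝ} (hv : 0 ≤ v) :
    chan ν f (F + G) v = chan ν f F v + chan ν f G v :=
  integral_add (hf.integrable_comp hF hv) (hf.integrable_comp hG hv)

theorem chan_sub (hf : IsChannel ν f) {F G : (ι → ℝ) → ℝ} (hF : LinearGrowth F)
    (hG : LinearGrowth G) {v : ι → ℝ} (hv : 0 ≤ v) :
    chan ν f (F - G) v = chan ν f F v - chan ν f G v :=
  integral_sub (hf.integrable_comp hF hv) (hf.integrable_comp hG hv)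

theorem chan_smul (c : ℝ) (F : (ι → ℝ) → ℝ) (v : ι → ℝ) :
    chan ν f (c • F) v = c * chan ν f F v :=
  integral_const_mul c _

theorem chan_sum {E : Type*} (s : Finset E) (hf : IsChannel ν f) {F : E → (ι → ℝ) → ℝ}
    (hF : ∀ e, LinearGrowth (F e)) {v : ι → ℝ} (hv : 0 ≤ v) :
    chan ν f (∑ e ∈ s, F e) v = ∑ e ∈ s, chan ν f (F e) v := by
  unfold chan
  simp only [Finset.sum_apply]
  exact integral_finsetSum _ fun e _ => hf.integrable_comp (hF e) hv

/-- The martingale property: the posterior averages back to the prior. -/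
theorem chan_linFun (hf : IsChannel ν f) (x v : ι → ℝ) :
    chan ν f (linFun x) v = linFun x v := by
  unfold chan linFun
  rw [integral_finsetSum]
  · refine Finset.sum_congr rfl fun a _ => ?_
    simp only [Pi.mul_apply]
    rw [integral_mul_const, integral_const_mul, hf.integral_eq_one, mul_one]
  · intro a _
    exact ((hf.integrable a).const_mul (v a)).mul_const (x a)

/-- Channels preserve total mass on average, so the growth constant survives unchanged and channels
can be iterated. -/
theorem LinearGrowth.chan [SFinite ν] (hf : IsChannel ν f) {F : (ι → ℝ) → ℝ}
    (hF : LinearGrowth F) : LinearGrowth (chan ν f F) := by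
  obtain ⟨hFm, C, hC, hFC⟩ := id hF
  refine ⟨?_, C, hC, fun v hv => ?_⟩
  · have hfm := hf.measurable
    have : Measurable fun p : (ι → ℝ) × Y => F (p.1 * f p.2) :=
      hFm.comp (measurable_fst.mul (hfm.comp measurable_snd))
    exact (this.stronglyMeasurable.integral_prod_right').measurable
  · have h1 : CommunityDetection.chan ν f (CommunityDetection.linFun fun _ => C) v = C * ∑ a, v a := by
      rw [chan_linFun hf, CommunityDetection.linFun, ← Finset.sum_mul, mul_comm]
    rw [← h1]
    refine (abs_integral_le_integral_abs).trans ?_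
    refine integral_mono (hf.integrable_comp hF hv).abs
      (hf.integrable_comp (LinearGrowth.linFun _) hv) fun y => ?_
    refine (hFC _ (hf.mul_nonneg hv y)).trans (le_of_eq ?_)
    simp only [CommunityDetection.linFun, ← Finset.sum_mul]
    exact mul_comm _ _

theorem IsChannel.prod [SFinite ν] [SFinite ν'] (hf : IsChannel ν f) (hf' : IsChannel ν' f') :
    IsChannel (ν.prod ν') (fun p => f p.1 * f' p.2) where
  measurable := (hf.measurable.comp measurable_fst).mul (hf'.measurable.comp measurable_snd)
  nonneg p := fun a => _root_.mul_nonneg (hf.nonneg p.1 a) (hf'.nonneg p.2 a)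
  integrable a := (hf.integrable a).mul_prod (hf'.integrable a)
  integral_eq_one a := by
    have := integral_prod_mul (μ := ν) (ν := ν') (fun y => f y a) (fun y => f' y a)
    simp only [Pi.mul_apply]
    rw [this, hf.integral_eq_one, hf'.integral_eq_one, mul_one]

theorem chan_chan [SFinite ν] [SFinite ν'] (hf : IsChannel ν f) (hf' : IsChannel ν' f')
    {F : (ι → ℝ) → ℝ} (hF : LinearGrowth F) {v : ι → ℝ} (hv : 0 ≤ v) :
    chan ν f (chan ν' f' F) v = chan (ν.prod ν') (fun p => f p.1 * f' p.2) F v := by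
  unfold chan
  rw [integral_prod _ ((hf.prod hf').integrable_comp hF hv)]
  simp only [mul_assoc]

theorem chan_comm [SFinite ν] [SFinite ν'] (hf : IsChannel ν f) (hf' : IsChannel ν' f')
    {F : (ι → ℝ) → ℝ} (hF : LinearGrowth F) {v : ι → ℝ} (hv : 0 ≤ v) :
    chan ν f (chan ν' f' F) v = chan ν' f' (chan ν f F) v := by
  unfold chan
  have := (hf.prod hf').integrable_comp hF hv
  simp only [← mul_assoc] at this
  rw [integral_integral_swap this]
  refine integral_congr_ae <| Eventually.of_forall fun y => ?_
  simp only
  congr 1; ext z; congr 1; ring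

theorem chan_map {T : Y → Y'} (hT : Measurable T) (hf' : Measurable f')
    {F : (ι → ℝ) → ℝ} (hF : LinearGrowth F) (v : ι → ℝ) :
    chan (ν.map T) f' F v = chan ν (fun y => f' (T y)) F v := by
  unfold chan
  rw [integral_map hT.aemeasurable]
  exact (hF.measurable.comp (measurable_const.mul hf')).aestronglyMeasurable

/-! ### The entropy lost in a weak channel -/

theorem coneEntropy_zero : coneEntropy (0 : ι → ℝ) = 0 := by simp [coneEntropy]

theorem eq_zero_of_sum_eq_zero {v : ι → ℝ} (hv : 0 ≤ v) (h : ∑ a, v a = 0) : v = 0 := by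
  ext a
  exact (Finset.sum_eq_zero_iff_of_nonneg fun b _ => hv b).1 h a (Finset.mem_univ a)

/-- The multiplicative structure of the entropy: with `R = ∑ v_a e_a / ∑ v_a`. -/
theorem coneEntropy_mul {v e : ι → ℝ} (h0 : ∑ a, v a ≠ 0) :
    coneEntropy (v * e) = (∑ a, v a * e a) * Real.log (∑ a, v a)
      + (∑ a, v a) * ((∑ a, v a * e a) / (∑ a, v a) *
        Real.log ((∑ a, v a * e a) / (∑ a, v a)))
      - ∑ a, v a * e a * Real.log (v a) - ∑ a, v a * (e a * Real.log (e a)) := by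
  unfold coneEntropy
  simp only [Pi.mul_apply]
  have h1 : ∑ a, v a * e a * Real.log (v a * e a) = ∑ a, v a * e a * Real.log (v a)
      + ∑ a, v a * (e a * Real.log (e a)) := by
    rw [← Finset.sum_add_distrib]
    refine Finset.sum_congr rfl fun a _ => ?_
    by_cases h : v a = 0
    · simp [h]
    by_cases h' : e a = 0
    · simp [h']
    rw [Real.log_mul h h']; ring
  rw [h1]
  set s := ∑ a, v a
  set t := ∑ a, v a * e a
  have h2 : t * Real.log t = t * Real.log s + s * (t / s * Real.log (t / s)) := by
    by_cases ht : t = 0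
    · simp [ht]
    rw [Real.log_div ht h0]; field_simp; ring
  rw [h2]; ring

/-- Write `f = 1 + r` and let `ρ` be the `v`-average of `r`. The random part of the entropy is `s (1
+ ρ) log (1 + ρ) - ∑ v_a (1 + r_a) log (1 + r_a)`. Expanding both to second order, the linear terms
have mean zero and the quadratic ones give the moments `M`; the two cubic remainders cost `ξ s / 2`
each. -/
theorem abs_chan_coneEntropy_sub_le (hf : IsChannel ν f) [IsProbabilityMeasure ν]
    {M : ι → ι → ℝ} {ξ : ℝ}
    (hM : ∀ a b, ∫ y, (f y a - 1) * (f y b - 1) ∂ν = M a b)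
    (hMi : ∀ a b, Integrable (fun y => (f y a - 1) * (f y b - 1)) ν)
    (hξ : ∀ a, ∫ y, |f y a - 1| ^ 3 ∂ν ≤ ξ)
    (hξi : ∀ a, Integrable (fun y => |f y a - 1| ^ 3) ν)
    {v : ι → ℝ} (hv : 0 ≤ v) :
    |chan ν f coneEntropy v - (coneEntropy v
      - (∑ a, v a * M a a - (∑ a, ∑ b, v a * v b * M a b) / ∑ a, v a) / 2)| ≤ ξ * ∑ a, v a := by
  set s := ∑ a, v a with hs
  have hs0 : 0 ≤ s := Finset.sum_nonneg fun b _ => hv b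
  by_cases h0 : s = 0
  · have hv0 := eq_zero_of_sum_eq_zero hv h0
    simp [h0, hv0, chan, coneEntropy_zero]
  have hspos : 0 < s := lt_of_le_of_ne hs0 (Ne.symm h0)
  let r : Y → ι → ℝ := fun y a => f y a - 1
  let ρ : Y → ℝ := fun y => (∑ a, v a * r y a) / s
  -- the part of the integrand kept by the expansion
  let A : Y → ℝ := fun y => (∑ a, v a * f y a) * Real.log s - (∑ a, v a * f y a * Real.log (v a))
    + s * (ρ y + ρ y ^ 2 / 2) - ∑ a, v a * (r y a + r y a ^ 2 / 2)
  have hpt : ∀ y, |coneEntropy (v * f y) - A y| ≤ ∑ a, v a * |r y a| ^ 3 := by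
    intro y
    rw [coneEntropy_mul h0]
    have hR : (∑ a, v a * f y a) / s = 1 + ρ y := by
      simp only [ρ, r, mul_sub, Finset.sum_sub_distrib, mul_one]
      rw [← hs]; field_simp; ring
    have hR1 : -1 ≤ ρ y := by
      have : 0 ≤ (∑ a, v a * f y a) / s :=
        div_nonneg (Finset.sum_nonneg fun a _ => hf.mul_nonneg hv y a) hs0
      linarith
    have hr1 : ∀ a, -1 ≤ r y a := fun a => by
      have : 0 ≤ f y a := hf.nonneg y a
      simp only [r]; linarith
    have e1 := abs_one_add_mul_log_sub_le hR1
    have e2 : |∑ a, v a * (f y a * Real.log (f y a)) - ∑ a, v a * (r y a + r y a ^ 2 / 2)|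
        ≤ (∑ a, v a * |r y a| ^ 3) / 2 := by
      rw [← Finset.sum_sub_distrib, Finset.sum_div]
      refine (Finset.abs_sum_le_sum_abs _ _).trans (Finset.sum_le_sum fun a _ => ?_)
      have := abs_one_add_mul_log_sub_le (hr1 a)
      rw [← mul_sub, abs_mul, abs_of_nonneg (hv a), mul_div_assoc]
      refine mul_le_mul_of_nonneg_left ?_ (hv a)
      have e : f y a = 1 + r y a := (add_sub_cancel _ _).symm
      rwa [e, ← sub_sub]
    have e3 : s * |ρ y| ^ 3 ≤ ∑ a, v a * |r y a| ^ 3 := by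
      have h1 : |ρ y| ≤ ∑ a, (v a / s) * |r y a| := by
        simp only [ρ]
        rw [Finset.sum_div]
        refine (Finset.abs_sum_le_sum_abs _ _).trans (Finset.sum_le_sum fun a _ => ?_)
        rw [abs_div, abs_mul, abs_of_nonneg (hv a), abs_of_pos hspos]
        apply le_of_eq; ring
      -- Convexity of the cube transfers the third-moment bound from the `r_a` to their average `ρ`.
      have h2 := Real.pow_arith_mean_le_arith_mean_pow Finset.univ (fun a => v a / s)
        (fun a => |r y a|) (fun a _ => div_nonneg (hv a) hs0)
        (by rw [← Finset.sum_div]; exact div_self h0) (fun a _ => abs_nonneg _) 3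
      have h3 : |ρ y| ^ 3 ≤ ∑ a, (v a / s) * |r y a| ^ 3 := by
        refine le_trans ?_ h2; gcongr
      calc _ ≤ s * ∑ a, (v a / s) * |r y a| ^ 3 := by gcongr
        _ = _ := by
          rw [Finset.mul_sum]; refine Finset.sum_congr rfl fun a _ => ?_
          field_simp
    rw [hR]
    have e1' : |s * ((1 + ρ y) * Real.log (1 + ρ y)) - s * (ρ y + ρ y ^ 2 / 2)|
        ≤ (∑ a, v a * |r y a| ^ 3) / 2 := by
      rw [← mul_sub, abs_mul, abs_of_pos hspos]
      calc _ ≤ s * (|ρ y| ^ 3 / 2) := by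
            refine mul_le_mul_of_nonneg_left ?_ hs0
            rwa [← sub_sub]
        _ ≤ _ := by linarith
    simp only [A]
    rw [abs_le] at e1' e2 ⊢
    constructor <;> linarith
  have hri : ∀ a, Integrable (fun y => r y a) ν := fun a => (hf.integrable a).sub (integrable_const 1)
  have hr0 : ∀ a, ∫ y, r y a ∂ν = 0 := fun a => by
    simp only [r]
    rw [integral_sub (hf.integrable a) (integrable_const 1), hf.integral_eq_one]; simp
  have hri2 : ∀ a, Integrable (fun y => r y a ^ 2) ν := fun a => by
    simpa only [sq] using hMi a a
  have hρ : ∀ y, ρ y ^ 2 = (∑ a, ∑ b, v a * v b * (r y a * r y b)) / s ^ 2 := fun y => by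
    simp only [ρ, div_pow]; congr 1
    rw [sq, Finset.sum_mul_sum]
    refine Finset.sum_congr rfl fun a _ => Finset.sum_congr rfl fun b _ => by ring
  have hρi : Integrable ρ ν :=
    (integrable_finsetSum _ fun a _ => (hri a).const_mul (v a)).div_const s
  have hρi2 : Integrable (fun y => ρ y ^ 2) ν := by
    simp only [hρ]
    exact (integrable_finsetSum _ fun a _ => integrable_finsetSum _ fun b _ =>
      (hMi a b).const_mul (v a * v b)).div_const _
  have hρ0 : ∫ y, ρ y ∂ν = 0 := by
    simp only [ρ]
    rw [integral_div, integral_finsetSum _ fun a _ => (hri a).const_mul (v a)]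
    simp [integral_const_mul, hr0]
  have hρ2 : ∫ y, ρ y ^ 2 ∂ν = (∑ a, ∑ b, v a * v b * M a b) / s ^ 2 := by
    simp only [hρ]
    rw [integral_div, integral_finsetSum _ fun a _ => integrable_finsetSum _ fun b _ =>
      (hMi a b).const_mul (v a * v b)]
    congr 1
    refine Finset.sum_congr rfl fun a _ => ?_
    rw [integral_finsetSum _ fun b _ => (hMi a b).const_mul (v a * v b)]
    refine Finset.sum_congr rfl fun b _ => ?_
    rw [integral_const_mul, hM]
  have hi1 : Integrable (fun y => (∑ a, v a * f y a) * Real.log s) ν :=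
    (integrable_finsetSum _ fun a _ => (hf.integrable a).const_mul (v a)).mul_const _
  have hi2' : ∀ a, Integrable (fun y => v a * f y a * Real.log (v a)) ν :=
    fun a => ((hf.integrable a).const_mul (v a)).mul_const _
  have hi2 : Integrable (fun y => ∑ a, v a * f y a * Real.log (v a)) ν :=
    integrable_finsetSum _ fun a _ => hi2' a
  have hi3 : Integrable (fun y => s * (ρ y + ρ y ^ 2 / 2)) ν :=
    (hρi.add (hρi2.div_const 2)).const_mul s
  have hi4' : ∀ a, Integrable (fun y => v a * (r y a + r y a ^ 2 / 2)) ν :=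
    fun a => ((hri a).add ((hri2 a).div_const 2)).const_mul (v a)
  have hi4 : Integrable (fun y => ∑ a, v a * (r y a + r y a ^ 2 / 2)) ν :=
    integrable_finsetSum _ fun a _ => hi4' a
  have hAi : Integrable A ν := ((hi1.sub hi2).add hi3).sub hi4
  have hA : ∫ y, A y ∂ν = coneEntropy v
      - (∑ a, v a * M a a - (∑ a, ∑ b, v a * v b * M a b) / s) / 2 := by
    have hA' : A = (fun y => (∑ a, v a * f y a) * Real.log s)
      - (fun y => ∑ a, v a * f y a * Real.log (v a)) + (fun y => s * (ρ y + ρ y ^ 2 / 2))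
      - (fun y => ∑ a, v a * (r y a + r y a ^ 2 / 2)) := rfl
    rw [hA', integral_sub' ((hi1.sub hi2).add hi3) hi4, integral_add' (hi1.sub hi2) hi3,
      integral_sub' hi1 hi2, integral_mul_const,
      integral_finsetSum _ fun a _ => (hf.integrable a).const_mul (v a),
      integral_finsetSum _ fun a _ => hi2' a, integral_const_mul,
      integral_add hρi (hρi2.div_const 2), hρ0, integral_div, hρ2,
      integral_finsetSum _ fun a _ => hi4' a]
    have : ∀ a, ∫ y, v a * (r y a + r y a ^ 2 / 2) ∂ν = v a * M a a / 2 := fun a => by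
      rw [integral_const_mul, integral_add (hri a) ((hri2 a).div_const 2), hr0, integral_div]
      have := hM a a
      simp only [r, sq]
      rw [this]; ring
    simp only [this, integral_mul_const, integral_const_mul, hf.integral_eq_one, mul_one]
    rw [← Finset.sum_div]
    unfold coneEntropy
    rw [← hs]
    field_simp
    ring
  have hBi' : ∀ a, Integrable (fun y => v a * |r y a| ^ 3) ν := fun a => (hξi a).const_mul (v a)
  rw [← hA]
  unfold chan
  rw [← integral_sub (hf.integrable_comp LinearGrowth.coneEntropy hv) hAi]
  calc _ ≤ ∫ y, |coneEntropy (v * f y) - A y| ∂ν := abs_integral_le_integral_abs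
    _ ≤ ∫ y, ∑ a, v a * |r y a| ^ 3 ∂ν :=
        integral_mono ((hf.integrable_comp LinearGrowth.coneEntropy hv).sub hAi).abs
          (integrable_finsetSum _ fun a _ => hBi' a) hpt
    _ = ∑ a, v a * ∫ y, |r y a| ^ 3 ∂ν := by
        rw [integral_finsetSum _ fun a _ => hBi' a]
        simp only [integral_const_mul]
    _ ≤ ∑ a, v a * ξ := Finset.sum_le_sum fun a _ => mul_le_mul_of_nonneg_left (hξ a) (hv a)
    _ = ξ * s := by rw [← Finset.sum_mul, mul_comm]

/-- Observing the output of a channel does not increase the entropy. -/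
theorem chan_coneEntropy_le (hf : IsChannel ν f) {v : ι → ℝ} (hv : 0 ≤ v) :
    chan ν f coneEntropy v ≤ coneEntropy v := by
  set s := ∑ a, v a with hs
  have hs0 : 0 ≤ s := Finset.sum_nonneg fun b _ => hv b
  by_cases h0 : s = 0
  · have hv0 := eq_zero_of_sum_eq_zero hv h0
    simp [hv0, chan, coneEntropy_zero]
  -- With the logarithms frozen at `v` the entropy is linear, hence preserved by the channel; what
  -- remains pointwise is Jensen's inequality for `x log x`.
  have key : coneEntropy v = chan ν f (linFun fun a => Real.log s - Real.log (v a)) v := by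
    rw [chan_linFun hf]
    simp only [linFun, mul_sub, Finset.sum_sub_distrib, ← Finset.sum_mul, coneEntropy]
    rfl
  rw [key]
  refine integral_mono (hf.integrable_comp LinearGrowth.coneEntropy hv)
    (hf.integrable_comp (LinearGrowth.linFun _) hv) fun y => ?_
  simp only
  rw [coneEntropy_mul h0]
  have hJ := Real.convexOn_mul_log.map_sum_le (t := Finset.univ) (w := fun a => v a / s)
    (p := fun a => f y a) (fun a _ => div_nonneg (hv a) hs0)
    (by rw [← Finset.sum_div]; exact div_self h0) (fun a _ => hf.nonneg y a)
  simp only [smul_eq_mul] at hJ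
  have h1 : ∑ a, v a / s * f y a = (∑ a, v a * f y a) / s := by
    rw [Finset.sum_div]; exact Finset.sum_congr rfl fun a _ => by ring
  rw [h1] at hJ
  have h2 : s * ∑ a, v a / s * (f y a * Real.log (f y a))
      = ∑ a, v a * (f y a * Real.log (f y a)) := by
    rw [Finset.mul_sum]; exact Finset.sum_congr rfl fun a _ => by field_simp
  have h3 := mul_le_mul_of_nonneg_left hJ hs0
  rw [h2] at h3
  simp only [linFun, mul_sub, Finset.sum_sub_distrib, Pi.mul_apply, ← Finset.sum_mul, ← hs]
  linarith

end Channel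

end CommunityDetection

end

-- Gaussian channels: composition, explicit moments, weak-signal expansion.

noncomputable section

namespace CommunityDetection

variable {ι κ κ' κ'' : Type*} [Fintype ι] [Fintype κ] [Fintype κ'] [Fintype κ'']

/-! ### Gaussian channels -/

variable (κ) in
/-- The standard Gaussian measure on `κ → ℝ`. -/
def stdGauss : Measure (κ → ℝ) := Measure.pi fun _ => gaussianReal 0 1

instance : IsProbabilityMeasure (stdGauss κ) := by unfold stdGauss; infer_instance

/-- The density of `𝒩(c_a, I)` with respect to `𝒩(0, I)`. -/
def gaussDensity (c : ι → κ → ℝ) (z : κ → ℝ) (a : ι) : ℝ :=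
  Real.exp (c a ⬝ᵥ z - c a ⬝ᵥ c a / 2)

theorem integrable_exp_dotProduct (u : κ → ℝ) :
    Integrable (fun z => Real.exp (u ⬝ᵥ z)) (stdGauss κ) := by
  simp only [dotProduct, Real.exp_sum]
  exact Integrable.fintype_prod_dep (μ := fun _ : κ => gaussianReal 0 1)
    (f := fun j x => Real.exp (u j * x))
    fun j => ProbabilityTheory.integrable_exp_mul_gaussianReal (u j)

theorem integral_exp_dotProduct (u : κ → ℝ) :
    ∫ z, Real.exp (u ⬝ᵥ z) ∂stdGauss κ = Real.exp (u ⬝ᵥ u / 2) := by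
  simp only [dotProduct, Real.exp_sum, Finset.sum_div, stdGauss]
  rw [integral_fintype_prod_eq_prod (μ := fun _ : κ => gaussianReal 0 1)
    (fun j x => Real.exp (u j * x))]
  refine Finset.prod_congr rfl fun j _ => ?_
  have := mgf_gaussianReal (p := gaussianReal 0 1) (X := id) (μ := 0) (v := 1) (by simp) (u j)
  simp only [mgf, id] at this
  rw [this]; simp [sq]

theorem isChannel_gaussDensity (c : ι → κ → ℝ) : IsChannel (stdGauss κ) (gaussDensity c) where
  measurable := by
    unfold gaussDensity dotProduct; fun_prop
  nonneg z := fun a => (Real.exp_pos _).le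
  integrable a := by
    simp only [gaussDensity, Real.exp_sub]
    exact (integrable_exp_dotProduct (c a)).div_const _
  integral_eq_one a := by
    simp only [gaussDensity, Real.exp_sub]
    rw [integral_div, integral_exp_dotProduct]
    exact div_self (Real.exp_pos _).ne'

/-- The law of the centred Gaussian vector `(⟨c_a, z⟩)_a`. -/
def gaussLaw (c : ι → κ → ℝ) : Measure (ι → ℝ) := (stdGauss κ).map fun z a => c a ⬝ᵥ z

theorem measurable_dotProducts (c : ι → κ → ℝ) :
    Measurable fun (z : κ → ℝ) (a : ι) => c a ⬝ᵥ z := by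
  unfold dotProduct; fun_prop

instance (c : ι → κ → ℝ) : IsProbabilityMeasure (gaussLaw c) :=
  Measure.isProbabilityMeasure_map (measurable_dotProducts c).aemeasurable

theorem charFunDual_gaussianReal_std (L : StrongDual ℝ ℝ) :
    charFunDual (gaussianReal 0 1) L = Complex.exp (-((L 1 : ℝ) : ℂ) ^ 2 / 2) := by
  have h := charFun_gaussianReal (μ := 0) (v := 1) (L 1)
  rw [charFun_apply_real] at h
  rw [charFunDual_apply]
  have : ∀ x : ℝ, L x = L 1 * x := fun x => by
    have := L.map_smul x 1
    simp only [smul_eq_mul, mul_one] at this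
    rw [this, mul_comm]
  have e : ∀ x : ℝ, Complex.exp (L x * Complex.I)
      = Complex.exp (((L 1 : ℝ) : ℂ) * x * Complex.I) := fun x => by
    rw [this x, Complex.ofReal_mul]
  rw [integral_congr_ae (Eventually.of_forall e), h]
  congr 1
  push_cast; ring

/-- The vectors `c` enter only through their Gram matrix; this is what makes Gaussian observations
composable. -/
theorem charFunDual_gaussLaw (c : ι → κ → ℝ) (L : StrongDual ℝ (ι → ℝ)) [DecidableEq ι] :
    charFunDual (gaussLaw c) L = Complex.exp
      (-((∑ a, ∑ b, L (Pi.single a 1) * L (Pi.single b 1) * (c a ⬝ᵥ c b) : ℝ) : ℂ) / 2) := by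
  classical
  let A : (κ → ℝ) →L[ℝ] (ι → ℝ) :=
    LinearMap.toContinuousLinearMap (Matrix.mulVecLin (Matrix.of c))
  have hA : ∀ z a, A z a = c a ⬝ᵥ z := fun z a => rfl
  have h1 : gaussLaw c = (stdGauss κ).map A := rfl
  rw [h1, charFunDual_map, stdGauss, charFunDual_pi]
  simp only [charFunDual_gaussianReal_std]
  rw [← Complex.exp_sum]
  congr 1
  have hL : ∀ u : ι → ℝ, L u = ∑ a, u a * L (Pi.single a 1) := fun u => by
    conv_lhs => rw [pi_eq_sum_univ' u]
    rw [map_sum]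
    refine Finset.sum_congr rfl fun a _ => ?_
    rw [map_smul]; rfl
  have h2 : ∀ j, (L.comp A).comp (ContinuousLinearMap.single ℝ (fun _ : κ => ℝ) j) 1
      = ∑ a, c a j * L (Pi.single a 1) := fun j => by
    simp only [ContinuousLinearMap.comp_apply, ContinuousLinearMap.single_apply]
    rw [hL]
    simp [hA, dotProduct_single]
  simp only [h2]
  rw [← Finset.sum_div, Finset.sum_neg_distrib]
  congr 2
  push_cast
  simp only [sq, Finset.sum_mul_sum]
  simp only [dotProduct, Complex.ofReal_sum, Finset.mul_sum]
  rw [Finset.sum_comm]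
  refine Finset.sum_congr rfl fun a _ => ?_
  rw [Finset.sum_comm]
  refine Finset.sum_congr rfl fun b _ => Finset.sum_congr rfl fun j _ => ?_
  push_cast; ring

/-- Characteristic functions multiply when Gram matrices add. The three families may live in spaces
of different dimensions. -/
theorem gaussLaw_conv {c : ι → κ → ℝ} {c' : ι → κ' → ℝ} {c'' : ι → κ'' → ℝ}
    (h : ∀ a b, c'' a ⬝ᵥ c'' b = c a ⬝ᵥ c b + c' a ⬝ᵥ c' b) :
    gaussLaw c'' = (gaussLaw c).conv (gaussLaw c') := by
  classical
  refine Measure.ext_of_charFunDual (funext fun L => ?_)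
  rw [charFunDual_conv, charFunDual_gaussLaw, charFunDual_gaussLaw, charFunDual_gaussLaw,
    ← Complex.exp_add]
  congr 1
  simp only [h, mul_add, Finset.sum_add_distrib]
  push_cast; ring

theorem chan_gaussDensity (c : ι → κ → ℝ) {F : (ι → ℝ) → ℝ} (hF : Measurable F) (v : ι → ℝ) :
    chan (stdGauss κ) (gaussDensity c) F v
      = ∫ u, F (v * fun a => Real.exp (u a - c a ⬝ᵥ c a / 2)) ∂gaussLaw c := by
  unfold gaussLaw chan
  rw [integral_map (measurable_dotProducts c).aemeasurable]
  · rfl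
  · refine (hF.comp ?_).aestronglyMeasurable
    exact measurable_const.mul (by fun_prop)

/-- Observing two independent Gaussian channels is the same as observing one whose Gram matrix is
the sum of theirs. -/
theorem chan_gaussDensity_chan {c : ι → κ → ℝ} {c' : ι → κ' → ℝ} {c'' : ι → κ'' → ℝ}
    (h : ∀ a b, c'' a ⬝ᵥ c'' b = c a ⬝ᵥ c b + c' a ⬝ᵥ c' b)
    {F : (ι → ℝ) → ℝ} (hF : LinearGrowth F) {v : ι → ℝ} (hv : 0 ≤ v) :
    chan (stdGauss κ) (gaussDensity c) (chan (stdGauss κ') (gaussDensity c') F) v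
      = chan (stdGauss κ'') (gaussDensity c'') F v := by
  rw [chan_chan (isChannel_gaussDensity c) (isChannel_gaussDensity c') hF hv,
    chan_gaussDensity c'' hF.measurable, gaussLaw_conv h, Measure.conv]
  have hm : Measurable fun u : ι → ℝ => v * fun a => Real.exp (u a - c'' a ⬝ᵥ c'' a / 2) :=
    measurable_const.mul (by fun_prop)
  rw [integral_map (f := fun u : ι → ℝ => F (v * fun a => Real.exp (u a - c'' a ⬝ᵥ c'' a / 2)))
    (by fun_prop) (hF.measurable.comp hm).aestronglyMeasurable]
  unfold gaussLaw chan
  rw [Measure.map_prod_map _ _ (measurable_dotProducts c) (measurable_dotProducts c'),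
    integral_map ((measurable_dotProducts c).prodMap (measurable_dotProducts c')).aemeasurable]
  · refine integral_congr_ae <| Eventually.of_forall fun p => ?_
    simp only
    congr 2
    ext a
    simp only [gaussDensity, Pi.mul_apply, ← Real.exp_add, Prod.map, Pi.add_apply, h]
    congr 1; ring
  · exact (hF.measurable.comp (hm.comp (by fun_prop))).aestronglyMeasurable

/-! ### The entropy lost in a weak Gaussian channel -/

/-- Monomials in the densities are again exponentials of linear forms, so all their moments are
explicit. -/
theorem gaussDensity_pow_mul (c : ι → κ → ℝ) (z : κ → ℝ) (a b : ι) (k l : ℕ) :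
    gaussDensity c z a ^ k * gaussDensity c z b ^ l
      = Real.exp (((k : ℝ) • c a + (l : ℝ) • c b) ⬝ᵥ z) *
        Real.exp (-(k * (c a ⬝ᵥ c a) + l * (c b ⬝ᵥ c b)) / 2) := by
  simp only [gaussDensity, ← Real.exp_nat_mul, ← Real.exp_add]
  congr 1
  simp only [add_dotProduct, smul_dotProduct, smul_eq_mul]
  ring

theorem integrable_gaussDensity_pow_mul (c : ι → κ → ℝ) (a b : ι) (k l : ℕ) :
    Integrable (fun z => gaussDensity c z a ^ k * gaussDensity c z b ^ l) (stdGauss κ) := by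
  simp only [gaussDensity_pow_mul]
  exact (integrable_exp_dotProduct _).mul_const _

theorem integral_gaussDensity_pow_mul (c : ι → κ → ℝ) (a b : ι) (k l : ℕ) :
    ∫ z, gaussDensity c z a ^ k * gaussDensity c z b ^ l ∂stdGauss κ
      = Real.exp ((k * (k - 1) * (c a ⬝ᵥ c a) + l * (l - 1) * (c b ⬝ᵥ c b)) / 2
        + k * l * (c a ⬝ᵥ c b)) := by
  simp only [gaussDensity_pow_mul]
  rw [integral_mul_const, integral_exp_dotProduct, ← Real.exp_add]
  congr 1
  simp only [add_dotProduct, smul_dotProduct, dotProduct_add, dotProduct_smul, smul_eq_mul,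
    dotProduct_comm (c b) (c a)]
  ring

theorem integrable_gaussDensity_pow (c : ι → κ → ℝ) (a : ι) (k : ℕ) :
    Integrable (fun z => gaussDensity c z a ^ k) (stdGauss κ) := by
  simpa using integrable_gaussDensity_pow_mul c a a k 0

theorem integral_gaussDensity_pow (c : ι → κ → ℝ) (a : ι) (k : ℕ) :
    ∫ z, gaussDensity c z a ^ k ∂stdGauss κ = Real.exp (k * (k - 1) * (c a ⬝ᵥ c a) / 2) := by
  simpa using integral_gaussDensity_pow_mul c a a k 0

theorem integrable_gaussDensity_sub_one_mul (c : ι → κ → ℝ) (a b : ι) :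
    Integrable (fun z => (gaussDensity c z a - 1) * (gaussDensity c z b - 1)) (stdGauss κ) := by
  have e : ∀ z, (gaussDensity c z a - 1) * (gaussDensity c z b - 1)
      = gaussDensity c z a ^ 1 * gaussDensity c z b ^ 1 - gaussDensity c z a ^ 1
        - gaussDensity c z b ^ 1 + 1 := fun z => by ring
  simp only [e]
  exact (((integrable_gaussDensity_pow_mul c a b 1 1).sub (integrable_gaussDensity_pow c a 1)).sub
    (integrable_gaussDensity_pow c b 1)).add (integrable_const 1)

theorem integral_gaussDensity_sub_one_mul (c : ι → κ → ℝ) (a b : ι) :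
    ∫ z, (gaussDensity c z a - 1) * (gaussDensity c z b - 1) ∂stdGauss κ
      = Real.exp (c a ⬝ᵥ c b) - 1 := by
  have e : (fun z => (gaussDensity c z a - 1) * (gaussDensity c z b - 1))
      = (fun z => gaussDensity c z a ^ 1 * gaussDensity c z b ^ 1)
        - (fun z => gaussDensity c z a ^ 1)
        - (fun z => gaussDensity c z b ^ 1) + fun _ => (1 : ℝ) := by
    ext z; simp only [Pi.add_apply, Pi.sub_apply]; ring
  rw [e, integral_add' (((integrable_gaussDensity_pow_mul c a b 1 1).sub
    (integrable_gaussDensity_pow c a 1)).sub (integrable_gaussDensity_pow c b 1))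
    (integrable_const 1), integral_sub' ((integrable_gaussDensity_pow_mul c a b 1 1).sub
    (integrable_gaussDensity_pow c a 1)) (integrable_gaussDensity_pow c b 1),
    integral_sub' (integrable_gaussDensity_pow_mul c a b 1 1) (integrable_gaussDensity_pow c a 1),
    integral_gaussDensity_pow_mul, integral_gaussDensity_pow, integral_gaussDensity_pow]
  simp

theorem integrable_gaussDensity_sub_one_pow_four (c : ι → κ → ℝ) (a : ι) :
    Integrable (fun z => (gaussDensity c z a - 1) ^ 4) (stdGauss κ) := by
  have e : ∀ z, (gaussDensity c z a - 1) ^ 4 = gaussDensity c z a ^ 4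
      - 4 * gaussDensity c z a ^ 3 + 6 * gaussDensity c z a ^ 2 - 4 * gaussDensity c z a ^ 1 + 1 :=
    fun z => by ring
  have h := integrable_gaussDensity_pow c a
  simp only [e]
  exact ((((h 4).sub ((h 3).const_mul 4)).add ((h 2).const_mul 6)).sub
    ((h 1).const_mul 4)).add (integrable_const 1)

theorem integral_gaussDensity_sub_one_pow_four (c : ι → κ → ℝ) (a : ι) :
    ∫ z, (gaussDensity c z a - 1) ^ 4 ∂stdGauss κ = Real.exp (6 * (c a ⬝ᵥ c a))
      - 4 * Real.exp (3 * (c a ⬝ᵥ c a)) + 6 * Real.exp (c a ⬝ᵥ c a) - 3 := by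
  have e : (fun z => (gaussDensity c z a - 1) ^ 4) = (fun z => gaussDensity c z a ^ 4)
      - (fun z => 4 * gaussDensity c z a ^ 3) + (fun z => 6 * gaussDensity c z a ^ 2)
      - (fun z => 4 * gaussDensity c z a ^ 1) + fun _ => (1 : ℝ) := by
    ext z; simp only [Pi.add_apply, Pi.sub_apply]; ring
  have h := integrable_gaussDensity_pow c a
  rw [e, integral_add' ((((h 4).sub ((h 3).const_mul 4)).add ((h 2).const_mul 6)).sub
    ((h 1).const_mul 4)) (integrable_const 1),
    integral_sub' (((h 4).sub ((h 3).const_mul 4)).add ((h 2).const_mul 6)) ((h 1).const_mul 4),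
    integral_add' ((h 4).sub ((h 3).const_mul 4)) ((h 2).const_mul 6),
    integral_sub' (h 4) ((h 3).const_mul 4), integral_const_mul, integral_const_mul,
    integral_const_mul]
  simp only [integral_gaussDensity_pow]
  have e1 : ((4 : ℕ) : ℝ) * ((4 : ℕ) - 1) * (c a ⬝ᵥ c a) / 2 = 6 * (c a ⬝ᵥ c a) := by
    push_cast; ring
  have e2 : ((3 : ℕ) : ℝ) * ((3 : ℕ) - 1) * (c a ⬝ᵥ c a) / 2 = 3 * (c a ⬝ᵥ c a) := by
    push_cast; ring
  have e3 : ((2 : ℕ) : ℝ) * ((2 : ℕ) - 1) * (c a ⬝ᵥ c a) / 2 = c a ⬝ᵥ c a := by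
    push_cast; ring
  rw [e1, e2, e3]
  simp
  ring

/-- Weighted AM-GM: it bounds the third absolute moment by the second and fourth moments, which are
computable. The weight `l` is later the standard size of `r`. -/
theorem abs_cube_le (r : ℝ) {l : ℝ} (hl : 0 < l) : |r| ^ 3 ≤ (l * r ^ 2 + r ^ 4 / l) / 2 := by
  have h1 : 0 ≤ (l * |r| - |r| ^ 2) ^ 2 / l := by positivity
  have h2 : (l * |r| - |r| ^ 2) ^ 2 / l = l * |r| ^ 2 - 2 * |r| ^ 3 + (|r| ^ 2) ^ 2 / l := by
    field_simp; ring
  rw [h2, sq_abs] at h1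
  have : (r ^ 2) ^ 2 = r ^ 4 := by ring
  rw [this] at h1
  linarith

theorem integrable_abs_gaussDensity_sub_one_cube (c : ι → κ → ℝ) (a : ι) :
    Integrable (fun z => |gaussDensity c z a - 1| ^ 3) (stdGauss κ) := by
  have h1 := integrable_gaussDensity_sub_one_mul c a a
  have h2 := integrable_gaussDensity_sub_one_pow_four c a
  refine (h1.add h2).mono' ?_ (Eventually.of_forall fun z => ?_)
  · have := (isChannel_gaussDensity c).measurable
    have := (measurable_pi_apply a).comp this
    have h3 : Measurable fun z => gaussDensity c z a := this
    exact (by fun_prop : Measurable fun z => |gaussDensity c z a - 1| ^ 3).aestronglyMeasurable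
  · rw [Real.norm_of_nonneg (by positivity)]
    have := abs_cube_le (gaussDensity c z a - 1) one_pos
    simp only [Pi.add_apply]
    nlinarith [sq_nonneg (gaussDensity c z a - 1), sq_nonneg ((gaussDensity c z a - 1) ^ 2)]

theorem integral_abs_gaussDensity_sub_one_cube_le (c : ι → κ → ℝ) (a : ι) {x : ℝ}
    (hx0 : 0 < x) (hx : c a ⬝ᵥ c a ≤ x) (hx1 : 6 * x ≤ 1) :
    ∫ z, |gaussDensity c z a - 1| ^ 3 ∂stdGauss κ ≤ 22 * (x * √x) := by
  have h1 := integrable_gaussDensity_sub_one_mul c a a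
  have h2 := integrable_gaussDensity_sub_one_pow_four c a
  set l := √x with hl
  have hl0 : 0 < l := Real.sqrt_pos.2 hx0
  have hll : l * l = x := Real.mul_self_sqrt hx0.le
  have hy0 : 0 ≤ c a ⬝ᵥ c a := by
    rw [dotProduct]; exact Finset.sum_nonneg fun j _ => mul_self_nonneg _
  set y := c a ⬝ᵥ c a with hy
  have b6 := Real.abs_exp_sub_one_sub_id_le (x := 6 * y) (by rw [abs_of_nonneg] <;> linarith)
  have b3 := Real.add_one_le_exp (3 * y)
  have b1 := Real.abs_exp_sub_one_sub_id_le (x := y) (by rw [abs_of_nonneg] <;> linarith)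
  rw [abs_le] at b6 b1
  calc ∫ z, |gaussDensity c z a - 1| ^ 3 ∂stdGauss κ
      ≤ ∫ z, (l * ((gaussDensity c z a - 1) * (gaussDensity c z a - 1))
        + (gaussDensity c z a - 1) ^ 4 / l) / 2 ∂stdGauss κ := by
        refine integral_mono (integrable_abs_gaussDensity_sub_one_cube c a)
          (((h1.const_mul l).add (h2.div_const l)).div_const 2) fun z => ?_
        have := abs_cube_le (gaussDensity c z a - 1) hl0
        simpa only [sq] using this
    _ = (l * (Real.exp y - 1) + (Real.exp (6 * y) - 4 * Real.exp (3 * y) + 6 * Real.exp y - 3) / l)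
        / 2 := by
        rw [integral_div, integral_add (h1.const_mul l) (h2.div_const l), integral_const_mul,
          integral_div, integral_gaussDensity_sub_one_mul, integral_gaussDensity_sub_one_pow_four]
    _ ≤ (l * (2 * x) + (42 * x ^ 2) / l) / 2 := by
        have e1 : Real.exp y - 1 ≤ 2 * x := by nlinarith
        -- Terms of order zero and one cancel; the quadratic remainders of `exp (6y)` and `6 exp y`
        -- add up to `36 + 6 = 42`.
        have e2 : Real.exp (6 * y) - 4 * Real.exp (3 * y) + 6 * Real.exp y - 3 ≤ 42 * x ^ 2 := by
          nlinarith
        gcongr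
    _ = 22 * (x * l) := by
        rw [← hll]; field_simp; ring

/-- The two-replica identity: the inner product of two independent posterior samples averages to the
sum of the squared posterior means of the coordinates. -/
theorem sum_sum_dotProduct_div (c : ι → κ → ℝ) (v : ι → ℝ) :
    (∑ a, ∑ b, v a * v b * (c a ⬝ᵥ c b)) / ∑ a, v a = ∑ j, sqMean (fun a => c a j) v := by
  simp only [sqMean]
  rw [← Finset.sum_div]
  congr 1
  simp only [sq, Finset.sum_mul_sum]
  simp only [dotProduct, Finset.mul_sum]
  symm
  rw [Finset.sum_comm]
  refine Finset.sum_congr rfl fun a _ => ?_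
  rw [Finset.sum_comm]
  exact Finset.sum_congr rfl fun b _ => Finset.sum_congr rfl fun j _ => by ring

theorem abs_dotProduct_le {K : ℝ} {c : ι → κ → ℝ} (hK : ∀ a, c a ⬝ᵥ c a ≤ K) (a b : ι) :
    |c a ⬝ᵥ c b| ≤ K := by
  have h1 : 0 ≤ (c a - c b) ⬝ᵥ (c a - c b) :=
    Finset.sum_nonneg fun j _ => mul_self_nonneg _
  have h2 : 0 ≤ (c a + c b) ⬝ᵥ (c a + c b) :=
    Finset.sum_nonneg fun j _ => mul_self_nonneg _
  simp only [add_dotProduct, dotProduct_add, sub_dotProduct, dotProduct_sub,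
    dotProduct_comm (c b) (c a)] at h1 h2
  have := hK a
  have := hK b
  rw [abs_le]; constructor <;> linarith

/-- The entropy lost when a Gaussian channel of small strength `h` is observed. -/
theorem chan_gaussDensity_coneEntropy_le (c : ι → κ → ℝ) {K h : ℝ} (hK : ∀ a, c a ⬝ᵥ c a ≤ K)
    (hK0 : 0 < K) (h0 : 0 < h) (h1 : 6 * (h * K) ≤ 1) {v : ι → ℝ} (hv : 0 ≤ v) :
    chan (stdGauss κ) (gaussDensity fun a => √h • c a) coneEntropy v
      ≤ coneEntropy v - h / 2 * (linFun (fun a => c a ⬝ᵥ c a) v - ∑ j, sqMean (fun a => c a j) v)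
        + 23 * (h * K * √(h * K)) * ∑ a, v a := by
  have hx0 : 0 < h * K := by positivity
  have hd : ∀ a b, (√h • c a) ⬝ᵥ (√h • c b) = h * (c a ⬝ᵥ c b) := fun a b => by
    rw [smul_dotProduct, dotProduct_smul, smul_eq_mul, smul_eq_mul, ← mul_assoc,
      Real.mul_self_sqrt h0.le]
  have hs0 : 0 ≤ ∑ a, v a := Finset.sum_nonneg fun b _ => hv b
  have key := abs_chan_coneEntropy_sub_le (isChannel_gaussDensity fun a => √h • c a)
    (M := fun a b => Real.exp ((√h • c a) ⬝ᵥ (√h • c b)) - 1) (ξ := 22 * (h * K * √(h * K)))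
    (fun a b => integral_gaussDensity_sub_one_mul _ a b)
    (fun a b => integrable_gaussDensity_sub_one_mul _ a b)
    (fun a => integral_abs_gaussDensity_sub_one_cube_le _ a hx0
      (by rw [hd]; exact mul_le_mul_of_nonneg_left (hK a) h0.le) h1)
    (fun a => integrable_abs_gaussDensity_sub_one_cube _ a) hv
  simp only [hd] at key
  -- Linearising the exponential costs `(hK)²`, of which half enters; with the cubic term `22` this
  -- stays below `23`.
  have hab : ∀ a b, |Real.exp (h * (c a ⬝ᵥ c b)) - 1 - h * (c a ⬝ᵥ c b)| ≤ (h * K) ^ 2 := by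
    intro a b
    have hle : |h * (c a ⬝ᵥ c b)| ≤ h * K := by
      rw [abs_mul, abs_of_pos h0]
      exact mul_le_mul_of_nonneg_left (abs_dotProduct_le hK a b) h0.le
    refine (Real.abs_exp_sub_one_sub_id_le (by linarith)).trans ?_
    rw [← sq_abs]; gcongr
  have hA : h * linFun (fun a => c a ⬝ᵥ c a) v
      ≤ ∑ a, v a * (Real.exp (h * (c a ⬝ᵥ c a)) - 1) := by
    unfold linFun
    rw [Finset.mul_sum]
    refine Finset.sum_le_sum fun a _ => ?_
    have := Real.add_one_le_exp (h * (c a ⬝ᵥ c a))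
    have := hv a
    rw [mul_left_comm]
    exact mul_le_mul_of_nonneg_left (by linarith) this
  have hB : (∑ a, ∑ b, v a * v b * (Real.exp (h * (c a ⬝ᵥ c b)) - 1)) / ∑ a, v a
      ≤ h * ∑ j, sqMean (fun a => c a j) v + (h * K) ^ 2 * ∑ a, v a := by
    rw [← sum_sum_dotProduct_div, ← mul_div_assoc]
    by_cases hs : ∑ a, v a = 0
    · simp [hs]
    have hspos : 0 < ∑ a, v a := lt_of_le_of_ne hs0 (Ne.symm hs)
    rw [div_le_iff₀ hspos, add_mul, div_mul_cancel₀ _ hs, mul_assoc ((h * K) ^ 2),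
      Finset.sum_mul_sum, Finset.mul_sum, Finset.mul_sum, ← Finset.sum_add_distrib]
    refine Finset.sum_le_sum fun a _ => ?_
    rw [Finset.mul_sum, Finset.mul_sum, ← Finset.sum_add_distrib]
    refine Finset.sum_le_sum fun b _ => ?_
    have := (abs_le.1 (hab a b)).2
    have hvv : 0 ≤ v a * v b := mul_nonneg (hv a) (hv b)
    nlinarith
  have hsq : (h * K) ^ 2 ≤ h * K * √(h * K) := by
    rw [sq]
    refine mul_le_mul_of_nonneg_left ?_ hx0.le
    refine Real.le_sqrt_of_sq_le ?_
    nlinarith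
  have := (abs_le.1 key).2
  have hsq' := mul_le_mul_of_nonneg_right hsq hs0
  nlinarith

/-- A Gaussian channel of small strength loses little entropy. -/
theorem coneEntropy_le_chan_gaussDensity (c : ι → κ → ℝ) {x : ℝ} (hx : ∀ a, c a ⬝ᵥ c a ≤ x)
    (hx0 : 0 < x) (hx1 : 6 * x ≤ 1) {v : ι → ℝ} (hv : 0 ≤ v) :
    coneEntropy v - 24 * x * ∑ a, v a ≤ chan (stdGauss κ) (gaussDensity c) coneEntropy v := by
  have hs0 : 0 ≤ ∑ a, v a := Finset.sum_nonneg fun b _ => hv b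
  have key := abs_chan_coneEntropy_sub_le (isChannel_gaussDensity c)
    (M := fun a b => Real.exp (c a ⬝ᵥ c b) - 1) (ξ := 22 * (x * √x))
    (fun a b => integral_gaussDensity_sub_one_mul _ a b)
    (fun a b => integrable_gaussDensity_sub_one_mul _ a b)
    (fun a => integral_abs_gaussDensity_sub_one_cube_le _ a hx0 (hx a) hx1)
    (fun a => integrable_abs_gaussDensity_sub_one_cube _ a) hv
  have hab : ∀ a b, |Real.exp (c a ⬝ᵥ c b) - 1| ≤ 2 * x := by
    intro a b
    have hle := abs_dotProduct_le hx a b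
    refine (Real.abs_exp_sub_one_le (by linarith)).trans (by linarith)
  have hA : ∑ a, v a * (Real.exp (c a ⬝ᵥ c a) - 1) ≤ 2 * x * ∑ a, v a := by
    rw [Finset.mul_sum]
    refine Finset.sum_le_sum fun a _ => ?_
    have := (abs_le.1 (hab a a)).2
    rw [mul_comm (2 * x)]
    exact mul_le_mul_of_nonneg_left this (hv a)
  have hB : -(2 * x * ∑ a, v a) ≤
      (∑ a, ∑ b, v a * v b * (Real.exp (c a ⬝ᵥ c b) - 1)) / ∑ a, v a := by
    by_cases hs : ∑ a, v a = 0
    · simp [hs]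
    have hspos : 0 < ∑ a, v a := lt_of_le_of_ne hs0 (Ne.symm hs)
    rw [le_div_iff₀ hspos, neg_mul, mul_assoc, Finset.sum_mul_sum, Finset.mul_sum,
      ← Finset.sum_neg_distrib]
    refine Finset.sum_le_sum fun a _ => ?_
    rw [Finset.mul_sum, ← Finset.sum_neg_distrib]
    refine Finset.sum_le_sum fun b _ => ?_
    have := (abs_le.1 (hab a b)).1
    have hvv : 0 ≤ v a * v b := mul_nonneg (hv a) (hv b)
    nlinarith
  -- The constant `24` is `22` from the cubic term plus half of the two second-order terms of size
  -- `2x`.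
  have hsq : x * √x ≤ x := by
    have : √x ≤ 1 := Real.sqrt_le_one.2 (by linarith)
    nlinarith
  have hsq' := mul_le_mul_of_nonneg_right hsq hs0
  have := (abs_le.1 key).1
  linarith

end CommunityDetection

end

-- Binary edges, and their disclosure by independent erasures.

noncomputable section

namespace CommunityDetection

variable {ι E : Type*} [Fintype ι] [Fintype E] [DecidableEq E]

/-! ### Binary edges with affine likelihood ratios -/

/-- The likelihood ratio `1 + θ_a g(b)` of an edge. -/
def edgeDensity (θ : ι → ℝ) (g : Bool → ℝ) (b : Bool) (a : ι) : ℝ := 1 + θ a * g b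

/-- The standing assumptions on the score `g` of an edge, under its reference law `P`: it is centred
with variance `s` and bounded by `ε`, and the coefficients `θ` are bounded by `Θ`. -/
structure IsWeakEdge (P : Measure Bool) (g : Bool → ℝ) (θ : ι → ℝ) (s ε Θ : ℝ) : Prop where
  mean : ∫ b, g b ∂P = 0
  var : ∫ b, g b ^ 2 ∂P = s
  bound : ∀ b, |g b| ≤ ε
  coeff : ∀ a, |θ a| ≤ Θ
  coeff_nonneg : 0 ≤ Θ
  small : Θ * ε ≤ 1 / 2

section Edge

variable {P : Measure Bool} [IsProbabilityMeasure P] {g : Bool → ℝ} {θ : ι → ℝ} {s ε Θ : ℝ}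

theorem IsWeakEdge.eps_nonneg (h : IsWeakEdge P g θ s ε Θ) : 0 ≤ ε :=
  (abs_nonneg _).trans (h.bound true)

theorem IsWeakEdge.abs_mul_le (h : IsWeakEdge P g θ s ε Θ) (a : ι) (b : Bool) :
    |θ a * g b| ≤ 1 / 2 := by
  rw [abs_mul]
  exact (mul_le_mul (h.coeff a) (h.bound b) (abs_nonneg _) h.coeff_nonneg).trans h.small

theorem IsWeakEdge.isChannel (h : IsWeakEdge P g θ s ε Θ) :
    IsChannel P (edgeDensity θ g) where
  measurable := measurable_of_countable _
  nonneg b := fun a => by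
    have := (abs_le.1 (h.abs_mul_le a b)).1
    simp only [Pi.zero_apply, edgeDensity]; linarith
  integrable a := Integrable.of_finite
  integral_eq_one a := by
    simp only [edgeDensity]
    rw [integral_add Integrable.of_finite Integrable.of_finite, integral_const_mul, h.mean,
      integral_const, probReal_univ]
    simp

/-- Here `r_a = θ_a g`, so the second moments are `s θ_a θ_b` and the third ones are at most `Θ³ ε
s`. -/
theorem IsWeakEdge.coneEntropy_le_chan (h : IsWeakEdge P g θ s ε Θ) {v : ι → ℝ} (hv : 0 ≤ v) :
    coneEntropy v - s / 2 * (linFun (fun a => θ a ^ 2) v - sqMean θ v) - Θ ^ 3 * ε * s * ∑ a, v a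
      ≤ chan P (edgeDensity θ g) coneEntropy v := by
  have e : ∀ b a, edgeDensity θ g b a - 1 = θ a * g b := fun b a => by
    simp only [edgeDensity]; ring
  have key := abs_chan_coneEntropy_sub_le h.isChannel (M := fun a b => s * (θ a * θ b))
    (ξ := Θ ^ 3 * ε * s)
    (fun a b => by
      simp only [e]
      rw [← h.var, mul_comm, ← integral_const_mul]
      exact integral_congr_ae <| Eventually.of_forall fun y => by ring)
    (fun a b => Integrable.of_finite)
    (fun a => by
      simp only [e]
      rw [← h.var, ← integral_const_mul]
      refine integral_mono Integrable.of_finite Integrable.of_finite fun b => ?_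
      simp only
      rw [abs_mul, mul_pow, mul_assoc, ← sq_abs (g b)]
      have := h.bound b
      have := h.coeff a
      have := h.coeff_nonneg
      calc _ = |θ a| ^ 3 * (|g b| * |g b| ^ 2) := by ring
        _ ≤ _ := by gcongr)
    (fun a => Integrable.of_finite) hv
  have h1 : ∑ a, v a * (s * (θ a * θ a)) = s * linFun (fun a => θ a ^ 2) v := by
    rw [linFun, Finset.mul_sum]; exact Finset.sum_congr rfl fun a _ => by ring
  have h2 : (∑ a, ∑ b, v a * v b * (s * (θ a * θ b))) / ∑ a, v a = s * sqMean θ v := by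
    rw [sqMean, ← mul_div_assoc, sq, Finset.sum_mul_sum, Finset.mul_sum]
    congr 1
    refine Finset.sum_congr rfl fun a _ => ?_
    rw [Finset.mul_sum]
    exact Finset.sum_congr rfl fun b _ => by ring
  simp only [h1, h2] at key
  have := (abs_le.1 key).1
  linarith

/-- By Jensen a squared posterior mean can only grow under a further observation; here the growth
caused by the edge itself is bounded. It allows states where the edge is hidden to be exchanged for
states where it may be disclosed. The bound is proved for each outcome `b`. -/
theorem IsWeakEdge.chan_sqMean_le (h : IsWeakEdge P g θ s ε Θ) {v : ι → ℝ} (hv : 0 ≤ v) :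
    chan P (edgeDensity θ g) (sqMean θ) v ≤ sqMean θ v + 8 * ε * Θ ^ 3 * ∑ a, v a := by
  set t := ∑ a, v a with ht
  have ht0 : 0 ≤ t := Finset.sum_nonneg fun b _ => hv b
  by_cases h0 : t = 0
  · have hv0 := eq_zero_of_sum_eq_zero hv h0
    simp [h0, hv0, chan, sqMean]
  have hpos : 0 < t := lt_of_le_of_ne ht0 (Ne.symm h0)
  have hε := h.eps_nonneg
  have hΘ := h.coeff_nonneg
  have hpt : ∀ b, sqMean θ (v * edgeDensity θ g b) ≤ sqMean θ v + 8 * ε * Θ ^ 3 * t := by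
    intro b
    set A := ∑ a, v a * θ a with hA
    set B := ∑ a, v a * θ a ^ 2 with hB
    have e1 : ∑ a, (v * edgeDensity θ g b) a * θ a = A + g b * B := by
      rw [hA, hB, Finset.mul_sum, ← Finset.sum_add_distrib]
      exact Finset.sum_congr rfl fun a _ => by simp only [Pi.mul_apply, edgeDensity]; ring
    have e2 : ∑ a, (v * edgeDensity θ g b) a = t + g b * A := by
      rw [hA, ht, Finset.mul_sum, ← Finset.sum_add_distrib]
      exact Finset.sum_congr rfl fun a _ => by simp only [Pi.mul_apply, edgeDensity]; ring
    have bA : |A| ≤ Θ * t := by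
      rw [hA, ht, Finset.mul_sum]
      refine (Finset.abs_sum_le_sum_abs _ _).trans (Finset.sum_le_sum fun a _ => ?_)
      rw [abs_mul, abs_of_nonneg (hv a), mul_comm]
      exact mul_le_mul_of_nonneg_right (h.coeff a) (hv a)
    have bB : |B| ≤ Θ ^ 2 * t := by
      rw [hB, ht, Finset.mul_sum]
      refine (Finset.abs_sum_le_sum_abs _ _).trans (Finset.sum_le_sum fun a _ => ?_)
      rw [abs_mul, abs_of_nonneg (hv a), mul_comm, abs_pow]
      exact mul_le_mul_of_nonneg_right (pow_le_pow_left₀ (abs_nonneg _) (h.coeff a) 2) (hv a)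
    have bg := h.bound b
    have bgA : |g b * A| ≤ t / 2 := by
      rw [abs_mul]
      calc |g b| * |A| ≤ ε * (Θ * t) := by gcongr
        _ = (Θ * ε) * t := by ring
        _ ≤ 1 / 2 * t := by gcongr; exact h.small
        _ = t / 2 := by ring
    have hden : t / 2 ≤ t + g b * A := by
      have := (abs_le.1 bgA).1; linarith
    have hden0 : 0 < t + g b * A := by linarith
    unfold sqMean
    rw [e1, e2, ← hA, ← ht, div_le_iff₀ hden0]
    have c1 : g b * A * B ≤ ε * (Θ * t) * (Θ ^ 2 * t) := by
      refine (le_abs_self _).trans ?_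
      rw [abs_mul, abs_mul]; gcongr
    have c2 : g b ^ 2 * B ^ 2 ≤ 1 / 2 * (ε * Θ ^ 3 * t ^ 2) := by
      calc g b ^ 2 * B ^ 2 = |g b| ^ 2 * |B| ^ 2 := by rw [sq_abs, sq_abs]
        _ ≤ ε ^ 2 * (Θ ^ 2 * t) ^ 2 := by gcongr
        _ = (Θ * ε) * (ε * Θ ^ 3 * t ^ 2) := by ring
        _ ≤ _ := by gcongr; exact h.small
    have c3 : -(g b * A ^ 3) ≤ ε * (Θ * t) ^ 3 := by
      refine (neg_le_abs _).trans ?_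
      rw [abs_mul, abs_pow]; gcongr
    -- The denominator is at least `t / 2`, so the constant `8` supplies `4 ε Θ³ t²`, against `2 +
    -- 1/2 + 1` times `ε Θ³ t²` from the three error terms.
    have c4 : 8 * ε * Θ ^ 3 * t * (t / 2) ≤ 8 * ε * Θ ^ 3 * t * (t + g b * A) := by gcongr
    have c5 : -(g b * A ^ 3) / t ≤ ε * Θ ^ 3 * t ^ 2 := by
      rw [div_le_iff₀ hpos]; calc _ ≤ _ := c3
        _ = _ := by ring
    have c6 : A ^ 2 / t * (t + g b * A) = A ^ 2 - (-(g b * A ^ 3) / t) := by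
      field_simp; ring
    have c7 : 0 ≤ ε * Θ ^ 3 * t ^ 2 := by positivity
    rw [add_mul, c6]
    nlinarith
  calc chan P (edgeDensity θ g) (sqMean θ) v
      ≤ ∫ _b, (sqMean θ v + 8 * ε * Θ ^ 3 * t) ∂P :=
        integral_mono Integrable.of_finite (integrable_const _) hpt
    _ = _ := by rw [integral_const, probReal_univ, one_smul]

end Edge

/-! ### Revealing a subset of the edges -/

/-- Exchanging the coordinate `s e` with the fresh bit `b` is an involution; the displaced bit then
sums to one. The signed weight `K` covers both resampling (`K = P e`) and differentiation in the
erasure probability (`K = ±1`). -/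
theorem sum_prod_resample (P : E → Bool → ℝ) (e : E) (hP : ∑ b, P e b = 1) (K : Bool → ℝ)
    (X : (E → Bool) → ℝ) :
    ∑ s : E → Bool, (∏ j, P j (s j)) * ∑ b, K b * X (Function.update s e b)
      = ∑ s : E → Bool, K (s e) * (∏ j ∈ Finset.univ.erase e, P j (s j)) * X s := by
  let φ : (E → Bool) × Bool → (E → Bool) × Bool := fun q => (Function.update q.1 e q.2, q.1 e)
  have hφ : Function.Involutive φ := fun q => by simp [φ]
  let Z : (E → Bool) × Bool → ℝ := fun q =>
    P e q.2 * (K (q.1 e) * (∏ j ∈ Finset.univ.erase e, P j (q.1 j)) * X q.1)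
  have h1 : ∑ q, Z (φ q) = ∑ q, Z q := Equiv.sum_comp hφ.toPerm Z
  have h2 : ∑ q, Z q = ∑ s : E → Bool, K (s e) * (∏ j ∈ Finset.univ.erase e, P j (s j)) * X s := by
    rw [Fintype.sum_prod_type]
    refine Finset.sum_congr rfl fun s _ => ?_
    simp only [Z]
    rw [← Finset.sum_mul, hP, one_mul]
  rw [← h2, ← h1, Fintype.sum_prod_type]
  refine Finset.sum_congr rfl fun s _ => ?_
  rw [Finset.mul_sum]
  refine Finset.sum_congr rfl fun b _ => ?_
  simp only [Z, φ, Function.update_self]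
  rw [← Finset.mul_prod_erase Finset.univ _ (Finset.mem_univ e)]
  have : ∏ j ∈ Finset.univ.erase e, P j (Function.update s e b j)
      = ∏ j ∈ Finset.univ.erase e, P j (s j) :=
    Finset.prod_congr rfl fun j hj => by rw [Function.update_of_ne (Finset.ne_of_mem_erase hj)]
  rw [this]; ring

theorem integral_pi_resample (P : E → Measure Bool) [∀ e, IsProbabilityMeasure (P e)] (e : E)
    (X : (E → Bool) → ℝ) :
    ∫ G, ∫ b, X (Function.update G e b) ∂P e ∂Measure.pi P = ∫ G, X G ∂Measure.pi P := by
  have hpi : ∀ G : E → Bool, (Measure.pi P).real {G} = ∏ j, (P j).real {G j} := fun G => by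
    simp [measureReal_def, Measure.pi_singleton, ENNReal.toReal_prod]
  have hP : ∑ b, (P e).real {b} = 1 := by
    have := integral_fintype (μ := P e) (f := fun _ => (1 : ℝ)) Integrable.of_finite
    rw [integral_const, probReal_univ] at this
    simpa using this.symm
  rw [integral_fintype Integrable.of_finite, integral_fintype Integrable.of_finite]
  simp only [hpi, smul_eq_mul]
  have h1 : ∀ G : E → Bool, ∫ b, X (Function.update G e b) ∂P e
      = ∑ b, (P e).real {b} * X (Function.update G e b) := fun G => by
    rw [integral_fintype Integrable.of_finite]; rfl
  simp only [h1]
  rw [sum_prod_resample (fun j b => (P j).real {b}) e hP]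
  refine Finset.sum_congr rfl fun s _ => ?_
  rw [Finset.mul_prod_erase Finset.univ (fun j => (P j).real {s j}) (Finset.mem_univ e)]

/-- The likelihood ratio of the edges in the set indicated by `s`. -/
def revealDensity (θ : E → ι → ℝ) (g : E → Bool → ℝ) (s : E → Bool) (G : E → Bool) (a : ι) : ℝ :=
  ∏ e, if s e then edgeDensity (θ e) (g e) (G e) a else 1

section Reveal

variable {P : E → Measure Bool} [∀ e, IsProbabilityMeasure (P e)] {g : E → Bool → ℝ}
  {θ : E → ι → ℝ} {s ε Θ : ℝ}

theorem isChannel_revealDensity (h : ∀ e, IsWeakEdge (P e) (g e) (θ e) s ε Θ) (u : E → Bool) :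
    IsChannel (Measure.pi P) (revealDensity θ g u) where
  measurable := measurable_of_countable _
  nonneg G := fun a => Finset.prod_nonneg fun e _ => by
    split_ifs
    · exact (h e).isChannel.nonneg _ a
    · exact zero_le_one
  integrable a := Integrable.of_finite
  integral_eq_one a := by
    simp only [revealDensity]
    rw [integral_fintype_prod_eq_prod (μ := P)
      (fun e b => if u e then edgeDensity (θ e) (g e) b a else 1)]
    refine Finset.prod_eq_one fun e _ => ?_
    split_ifs
    · exact (h e).isChannel.integral_eq_one a
    · rw [integral_const, probReal_univ, one_smul]

theorem revealDensity_update_true (u : E → Bool) (e : E) (G : E → Bool) (b : Bool) :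
    revealDensity θ g (Function.update u e true) (Function.update G e b)
      = revealDensity θ g (Function.update u e false) G * edgeDensity (θ e) (g e) b := by
  ext a
  simp only [revealDensity, Pi.mul_apply]
  rw [← Finset.mul_prod_erase Finset.univ _ (Finset.mem_univ e),
    ← Finset.mul_prod_erase Finset.univ (fun j => if Function.update u e false j = true then
      edgeDensity (θ j) (g j) (G j) a else 1) (Finset.mem_univ e)]
  simp only [Function.update_self, if_true, Bool.false_eq_true, if_false, one_mul]
  rw [mul_comm]
  congr 1
  refine Finset.prod_congr rfl fun j hj => ?_
  have hj := Finset.ne_of_mem_erase hj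
  rw [Function.update_of_ne hj, Function.update_of_ne hj, Function.update_of_ne hj]

/-- Disclosing an edge means applying its channel once, after all the other disclosed edges. -/
theorem chan_revealDensity_update_true (u : E → Bool) (e : E) (F : (ι → ℝ) → ℝ) (v : ι → ℝ) :
    chan (Measure.pi P) (revealDensity θ g (Function.update u e true)) F v
      = chan (Measure.pi P) (revealDensity θ g (Function.update u e false))
        (chan (P e) (edgeDensity (θ e) (g e)) F) v := by
  unfold chan
  rw [← integral_pi_resample P e]
  simp only [revealDensity_update_true, mul_assoc]

end Reveal

/-! ### Averages over random erasures -/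

/-- The product rule with a quadratic remainder. The point is that `C` does not depend on `x`, `σ`
or `h`. -/
theorem exists_prod_expansion (S : Finset E) : ∃ C : ℝ, 0 ≤ C ∧ ∀ x σ : E → ℝ,
    (∀ e, |x e| ≤ 1) → (∀ e, |σ e| ≤ 1) → ∀ h : ℝ, 0 ≤ h → h ≤ 1 →
    |∏ e ∈ S, (x e + h * σ e) - ∏ e ∈ S, x e - h * ∑ e ∈ S, σ e * ∏ j ∈ S.erase e, x j|
      ≤ C * h ^ 2 := by
  induction S using Finset.induction_on with
  | empty => exact ⟨0, le_rfl, by simp⟩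
  | insert e₀ S he ih =>
    obtain ⟨C, hC, ih⟩ := ih
    -- `S.card` bounds the cross term of order `h²`, and `2` bounds the new factor `x + h σ`.
    refine ⟨S.card + 2 * C, by positivity, fun x σ hx hσ h h0 h1 => ?_⟩
    have hD : ∑ e ∈ insert e₀ S, σ e * ∏ j ∈ (insert e₀ S).erase e, x j
        = σ e₀ * ∏ e ∈ S, x e + x e₀ * ∑ e ∈ S, σ e * ∏ j ∈ S.erase e, x j := by
      rw [Finset.sum_insert he, Finset.erase_insert he, Finset.mul_sum]
      congr 1
      refine Finset.sum_congr rfl fun e heS => ?_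
      have hne : e₀ ≠ e := fun h => he (h ▸ heS)
      rw [Finset.erase_insert_of_ne hne,
        Finset.prod_insert (fun h => he (Finset.mem_of_mem_erase h))]
      ring
    rw [Finset.prod_insert he, Finset.prod_insert he, hD]
    have hR := ih x σ hx hσ h h0 h1
    set D := ∑ e ∈ S, σ e * ∏ j ∈ S.erase e, x j
    have hDle : |D| ≤ S.card := by
      refine (Finset.abs_sum_le_sum_abs _ _).trans ?_
      have : ∀ e ∈ S, |σ e * ∏ j ∈ S.erase e, x j| ≤ 1 := fun e _ => by
        rw [abs_mul, Finset.abs_prod]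
        exact mul_le_one₀ (hσ e) (Finset.prod_nonneg fun _ _ => abs_nonneg _)
          (Finset.prod_le_one (fun _ _ => abs_nonneg _) fun j _ => hx j)
      simpa using Finset.sum_le_card_nsmul _ _ _ this
    set X := ∏ e ∈ S, x e
    set Y := ∏ e ∈ S, (x e + h * σ e)
    have e1 : (x e₀ + h * σ e₀) * Y - x e₀ * X - h * (σ e₀ * X + x e₀ * D)
        = h ^ 2 * (σ e₀ * D) + (x e₀ + h * σ e₀) * (Y - X - h * D) := by ring
    rw [e1]
    have e2 : |h ^ 2 * (σ e₀ * D)| ≤ h ^ 2 * S.card := by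
      rw [abs_mul, abs_of_nonneg (sq_nonneg h), abs_mul]
      refine mul_le_mul_of_nonneg_left ?_ (sq_nonneg h)
      calc |σ e₀| * |D| ≤ 1 * S.card := mul_le_mul (hσ e₀) hDle (abs_nonneg _) zero_le_one
        _ = _ := one_mul _
    have e3 : |(x e₀ + h * σ e₀) * (Y - X - h * D)| ≤ 2 * (C * h ^ 2) := by
      rw [abs_mul]
      refine mul_le_mul ?_ hR (abs_nonneg _) (by norm_num)
      refine (abs_add_le _ _).trans ?_
      rw [abs_mul, abs_of_nonneg h0]
      have := hx e₀
      have := mul_le_one₀ h1 (abs_nonneg _) (hσ e₀)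
      linarith
    refine (abs_add_le _ _).trans ?_
    linarith

/-- The mass that a Bernoulli variable of mean `t` gives to a truth value. -/
def erasureWeight (t : ℝ) (b : Bool) : ℝ := if b then t else 1 - t

/-- The average of `c` over the sets of edges where each edge is revealed with probability `t`. -/
def erasureAvg (t : ℝ) (c : (E → Bool) → ℝ) : ℝ :=
  ∑ s : E → Bool, (∏ e, erasureWeight t (s e)) * c s

theorem erasureWeight_nonneg {t : ℝ} (h0 : 0 ≤ t) (h1 : t ≤ 1) (b : Bool) :
    0 ≤ erasureWeight t b := by
  unfold erasureWeight; split_ifs <;> linarith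

theorem erasureAvg_mono {t : ℝ} (h0 : 0 ≤ t) (h1 : t ≤ 1) {c c' : (E → Bool) → ℝ}
    (h : ∀ s, c s ≤ c' s) : erasureAvg t c ≤ erasureAvg t c' :=
  Finset.sum_le_sum fun s _ => mul_le_mul_of_nonneg_left (h s)
    (Finset.prod_nonneg fun _ _ => erasureWeight_nonneg h0 h1 _)

theorem erasureAvg_const (t x : ℝ) : erasureAvg (E := E) t (fun _ => x) = x := by
  unfold erasureAvg
  rw [← Finset.sum_mul]
  have := Finset.prod_univ_sum (fun _ : E => (Finset.univ : Finset Bool))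
    (fun _ b => erasureWeight t b)
  rw [Fintype.piFinset_univ] at this
  rw [← this]
  simp [erasureWeight]

theorem erasureAvg_add (t : ℝ) (c c' : (E → Bool) → ℝ) :
    erasureAvg t (fun s => c s + c' s) = erasureAvg t c + erasureAvg t c' := by
  simp only [erasureAvg, mul_add, Finset.sum_add_distrib]

theorem erasureAvg_const_mul (t x : ℝ) (c : (E → Bool) → ℝ) :
    erasureAvg t (fun s => x * c s) = x * erasureAvg t c := by
  simp only [erasureAvg, Finset.mul_sum]
  exact Finset.sum_congr rfl fun s _ => by ring

theorem erasureAvg_sum {J : Type*} (S : Finset J) (t : ℝ) (c : J → (E → Bool) → ℝ) :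
    erasureAvg t (fun s => ∑ j ∈ S, c j s) = ∑ j ∈ S, erasureAvg t (c j) := by
  simp only [erasureAvg, Finset.mul_sum]
  exact Finset.sum_comm

theorem erasureAvg_zero (c : (E → Bool) → ℝ) : erasureAvg 0 c = c fun _ => false := by
  unfold erasureAvg
  rw [Finset.sum_eq_single fun _ => false]
  · simp [erasureWeight]
  · intro s _ hs
    obtain ⟨e, he⟩ : ∃ e, s e ≠ false := Function.ne_iff.1 hs
    rw [Finset.prod_eq_zero (Finset.mem_univ e), zero_mul]
    simp only [Bool.not_eq_false] at he
    simp [erasureWeight, he]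
  · simp

theorem erasureAvg_one (c : (E → Bool) → ℝ) : erasureAvg 1 c = c fun _ => true := by
  unfold erasureAvg
  rw [Finset.sum_eq_single fun _ => true]
  · simp [erasureWeight]
  · intro s _ hs
    obtain ⟨e, he⟩ : ∃ e, s e ≠ true := Function.ne_iff.1 hs
    rw [Finset.prod_eq_zero (Finset.mem_univ e), zero_mul]
    simp only [Bool.not_eq_true] at he
    simp [erasureWeight, he]
  · simp

/-- Increasing the probability of being revealed, to second order. -/
theorem exists_erasureAvg_expansion (K : ℝ) (hK : 0 ≤ K) : ∃ C : ℝ, 0 ≤ C ∧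
    ∀ c : (E → Bool) → ℝ, (∀ s, |c s| ≤ K) → ∀ t h : ℝ, 0 ≤ t → 0 ≤ h → t + h ≤ 1 →
    |erasureAvg (t + h) c - erasureAvg t c - h * ∑ e, erasureAvg t
      (fun s => c (Function.update s e true) - c (Function.update s e false))| ≤ C * h ^ 2 := by
  obtain ⟨C, hC, hexp⟩ := exists_prod_expansion (Finset.univ : Finset E)
  refine ⟨Fintype.card (E → Bool) * (C * K), by positivity, fun c hc t h ht hh hth => ?_⟩
  -- `σ` is the derivative of `erasureWeight` in `t`, so the first-order term is Russo's formula: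
  -- the sum over `e` of the effect of disclosing `e`.
  let σ : Bool → ℝ := fun b => if b then 1 else -1
  have hσ : ∀ b, |σ b| ≤ 1 := fun b => by cases b <;> simp [σ]
  have hw : ∀ b, |erasureWeight t b| ≤ 1 := fun b => by
    rw [abs_of_nonneg (erasureWeight_nonneg ht (by linarith) b)]
    unfold erasureWeight; split_ifs <;> linarith
  have hstep : ∀ b, erasureWeight (t + h) b = erasureWeight t b + h * σ b := fun b => by
    cases b <;> simp [erasureWeight, σ]; ring
  have hder : ∀ e : E, erasureAvg t
      (fun s => c (Function.update s e true) - c (Function.update s e false))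
      = ∑ s : E → Bool, (σ (s e) * ∏ j ∈ Finset.univ.erase e, erasureWeight t (s j)) * c s := by
    intro e
    rw [← sum_prod_resample (fun _ b => erasureWeight t b) e (by simp [erasureWeight]) σ c]
    unfold erasureAvg
    refine Finset.sum_congr rfl fun s _ => ?_
    congr 1
    simp [σ, sub_eq_add_neg]
  simp only [hder]
  rw [Finset.sum_comm]
  unfold erasureAvg
  rw [Finset.mul_sum, ← Finset.sum_sub_distrib, ← Finset.sum_sub_distrib]
  refine (Finset.abs_sum_le_sum_abs _ _).trans ?_
  have hs : ∀ s ∈ (Finset.univ : Finset (E → Bool)),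
      |(∏ e, erasureWeight (t + h) (s e)) * c s - (∏ e, erasureWeight t (s e)) * c s
        - h * ∑ e, σ (s e) * (∏ j ∈ Finset.univ.erase e, erasureWeight t (s j)) * c s|
      ≤ C * K * h ^ 2 := by
    intro s _
    rw [← Finset.sum_mul, ← mul_assoc, ← sub_mul, ← sub_mul, abs_mul]
    have := hexp (fun e => erasureWeight t (s e)) (fun e => σ (s e)) (fun e => hw _)
      (fun e => hσ _) h hh (by linarith)
    simp only [hstep]
    calc _ ≤ (C * h ^ 2) * K := mul_le_mul this (hc s) (abs_nonneg _) (by positivity)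
      _ = _ := by ring
  refine (Finset.sum_le_card_nsmul _ _ _ hs).trans (le_of_eq ?_)
  rw [nsmul_eq_mul, Finset.card_univ]; ring

/-- A function on `[0, 1]` whose decrease over an interval of length `h` is at most `h B`, up to an
error of order `h^{3/2}`, decreases by at most `B`. -/
theorem sub_le_of_forall_step {Φ : ℝ → ℝ} {B C h₀ : ℝ} (hh₀ : 0 < h₀)
    (hΦ : ∀ t h, 0 ≤ t → 0 < h → h ≤ h₀ → t + h ≤ 1 → Φ t - Φ (t + h) ≤ h * B + C * (h * √h)) :
    Φ 0 - Φ 1 ≤ B := by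
  -- Cut `[0, 1]` into `N + 1` equal steps and telescope; the errors add up to `C / √(N + 1)`. No
  -- differentiability is needed.
  have key : ∀ᶠ N : ℕ in atTop, Φ 0 - Φ 1 ≤ B + C * √(1 / (N + 1 : ℝ)) := by
    have hlim : Tendsto (fun N : ℕ => 1 / (N + 1 : ℝ)) atTop (𝓝 0) :=
      tendsto_one_div_add_atTop_nhds_zero_nat
    filter_upwards [hlim.eventually_lt_const hh₀] with N hN
    set h := 1 / (N + 1 : ℝ) with hh
    have hpos : 0 < h := by positivity
    have hNh : (N + 1 : ℝ) * h = 1 := by rw [hh]; field_simp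
    have hstep : ∀ i ∈ Finset.range (N + 1), Φ (i * h) - Φ ((i + 1 : ℕ) * h)
        ≤ h * B + C * (h * √h) := by
      intro i hi
      have hi' : (i : ℝ) + 1 ≤ N + 1 := by
        have := Finset.mem_range.1 hi; exact_mod_cast this
      have e : ((i + 1 : ℕ) : ℝ) * h = i * h + h := by push_cast; ring
      rw [e]
      refine hΦ _ _ (by positivity) hpos hN.le ?_
      rw [← hNh]; nlinarith
    have := Finset.sum_le_card_nsmul _ _ _ hstep
    rw [Finset.sum_range_sub' (fun i : ℕ => Φ (i * h))] at this
    simp only [Finset.card_range, nsmul_eq_mul, Nat.cast_zero, zero_mul] at this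
    push_cast at this
    rw [hNh] at this
    calc Φ 0 - Φ 1 ≤ _ := this
      _ = ((N + 1 : ℝ) * h) * (B + C * √h) := by ring
      _ = _ := by rw [hNh, one_mul]
  have hlim : Tendsto (fun N : ℕ => B + C * √(1 / (N + 1 : ℝ))) atTop (𝓝 (B + C * √0)) := by
    refine tendsto_const_nhds.add (Tendsto.const_mul C ?_)
    exact (Real.continuous_sqrt.tendsto 0).comp tendsto_one_div_add_atTop_nhds_zero_nat
  simp only [Real.sqrt_zero, mul_zero, add_zero] at hlim
  exact ge_of_tendsto hlim key

end CommunityDetection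

end

-- The path from the Gaussian channel to the edges.

noncomputable section

namespace CommunityDetection

variable {ι E κ Ω : Type*} [Fintype ι] [Fintype E] [DecidableEq E] [Fintype κ] [MeasurableSpace Ω]

/-! ### The interpolation -/

/-- The average of `F` over the posterior, when the base channel, the edges in the set indicated
by `u`, and a Gaussian channel of strength `τ` are observed. -/
def stateAvg (ν : Measure Ω) (f : Ω → ι → ℝ) (P : E → Measure Bool) (θ : E → ι → ℝ)
    (g : E → Bool → ℝ) (c : ι → κ → ℝ) (τ : ℝ) (u : E → Bool) (F : (ι → ℝ) → ℝ)
    (w : ι → ℝ) : ℝ :=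
  chan ν f (chan (Measure.pi P) (revealDensity θ g u)
    (chan (stdGauss κ) (gaussDensity fun a => √τ • c a) F)) w

section State

variable {ν : Measure Ω} [IsProbabilityMeasure ν] {f : Ω → ι → ℝ} {P : E → Measure Bool}
  [∀ e, IsProbabilityMeasure (P e)] {θ : E → ι → ℝ} {g : E → Bool → ℝ} {c : ι → κ → ℝ}
  {s ε Θ τ : ℝ} {u : E → Bool} {F G : (ι → ℝ) → ℝ} {w : ι → ℝ}

theorem stateAvg_mono (hf : IsChannel ν f) (h : ∀ e, IsWeakEdge (P e) (g e) (θ e) s ε Θ)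
    (hF : LinearGrowth F) (hG : LinearGrowth G) (hFG : ∀ v, 0 ≤ v → F v ≤ G v) (hw : 0 ≤ w) :
    stateAvg ν f P θ g c τ u F w ≤ stateAvg ν f P θ g c τ u G w := by
  have h1 := isChannel_gaussDensity fun a => √τ • c a
  have h2 := isChannel_revealDensity h u
  exact chan_mono hf ((hF.chan h1).chan h2) ((hG.chan h1).chan h2)
    (fun v hv => chan_mono h2 (hF.chan h1) (hG.chan h1)
      (fun v hv => chan_mono h1 hF hG hFG hv) hv) hw

theorem stateAvg_eq_chan (hf : IsChannel ν f) (h : ∀ e, IsWeakEdge (P e) (g e) (θ e) s ε Θ)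
    (hF : LinearGrowth F) (hw : 0 ≤ w) :
    stateAvg ν f P θ g c τ u F w = chan (ν.prod ((Measure.pi P).prod (stdGauss κ)))
      (fun p => f p.1 * (revealDensity θ g u p.2.1 * gaussDensity (fun a => √τ • c a) p.2.2))
      F w := by
  have h1 := isChannel_gaussDensity fun a => √τ • c a
  have h2 := isChannel_revealDensity h u
  rw [← chan_chan hf (h2.prod h1) hF hw]
  exact chan_congr hf (fun v hv => chan_chan h2 h1 hF hv) hw

theorem isChannel_state (hf : IsChannel ν f) (h : ∀ e, IsWeakEdge (P e) (g e) (θ e) s ε Θ) :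
    IsChannel (ν.prod ((Measure.pi P).prod (stdGauss κ)))
      (fun p => f p.1 *
        (revealDensity θ g u p.2.1 * gaussDensity (fun a => √τ • c a) p.2.2)) :=
  hf.prod ((isChannel_revealDensity h u).prod (isChannel_gaussDensity _))

theorem stateAvg_linFun (hf : IsChannel ν f) (h : ∀ e, IsWeakEdge (P e) (g e) (θ e) s ε Θ)
    (hw : 0 ≤ w) (x : ι → ℝ) : stateAvg ν f P θ g c τ u (linFun x) w = linFun x w := by
  rw [stateAvg_eq_chan hf h (LinearGrowth.linFun x) hw, chan_linFun (isChannel_state hf h)]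

theorem stateAvg_add (hf : IsChannel ν f) (h : ∀ e, IsWeakEdge (P e) (g e) (θ e) s ε Θ)
    (hF : LinearGrowth F) (hG : LinearGrowth G) (hw : 0 ≤ w) :
    stateAvg ν f P θ g c τ u (F + G) w
      = stateAvg ν f P θ g c τ u F w + stateAvg ν f P θ g c τ u G w := by
  rw [stateAvg_eq_chan hf h (hF.add hG) hw, stateAvg_eq_chan hf h hF hw,
    stateAvg_eq_chan hf h hG hw, chan_add (isChannel_state hf h) hF hG hw]

theorem stateAvg_sub (hf : IsChannel ν f) (h : ∀ e, IsWeakEdge (P e) (g e) (θ e) s ε Θ)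
    (hF : LinearGrowth F) (hG : LinearGrowth G) (hw : 0 ≤ w) :
    stateAvg ν f P θ g c τ u (F - G) w
      = stateAvg ν f P θ g c τ u F w - stateAvg ν f P θ g c τ u G w := by
  rw [stateAvg_eq_chan hf h (hF.sub hG) hw, stateAvg_eq_chan hf h hF hw,
    stateAvg_eq_chan hf h hG hw, chan_sub (isChannel_state hf h) hF hG hw]

theorem stateAvg_smul (hf : IsChannel ν f) (h : ∀ e, IsWeakEdge (P e) (g e) (θ e) s ε Θ)
    (hF : LinearGrowth F) (hw : 0 ≤ w) (r : ℝ) :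
    stateAvg ν f P θ g c τ u (r • F) w = r * stateAvg ν f P θ g c τ u F w := by
  rw [stateAvg_eq_chan hf h (hF.const_smul r) hw, stateAvg_eq_chan hf h hF hw, chan_smul]

theorem stateAvg_sum {J : Type*} (S : Finset J) (hf : IsChannel ν f)
    (h : ∀ e, IsWeakEdge (P e) (g e) (θ e) s ε Θ)
    {F : J → (ι → ℝ) → ℝ} (hF : ∀ j, LinearGrowth (F j)) (hw : 0 ≤ w) :
    stateAvg ν f P θ g c τ u (∑ j ∈ S, F j) w = ∑ j ∈ S, stateAvg ν f P θ g c τ u (F j) w := by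
  rw [stateAvg_eq_chan hf h (LinearGrowth.sum S hF) hw, chan_sum S (isChannel_state hf h) hF hw]
  exact Finset.sum_congr rfl fun j _ => (stateAvg_eq_chan hf h (hF j) hw).symm

/-- Extra strength `δ` is one more independent Gaussian channel, applied last, since Gram matrices
add. -/
theorem stateAvg_add_strength (hf : IsChannel ν f)
    (h : ∀ e, IsWeakEdge (P e) (g e) (θ e) s ε Θ) (hF : LinearGrowth F) (hw : 0 ≤ w)
    (hτ : 0 ≤ τ) {δ : ℝ} (hδ : 0 ≤ δ) :
    stateAvg ν f P θ g c (τ + δ) u F w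
      = stateAvg ν f P θ g c τ u (chan (stdGauss κ) (gaussDensity fun a => √δ • c a) F) w := by
  refine chan_congr hf (fun v hv => chan_congr (isChannel_revealDensity h u) (fun v hv => ?_) hv) hw
  symm
  refine chan_gaussDensity_chan (fun a b => ?_) hF hv
  simp only [smul_dotProduct, dotProduct_smul, smul_eq_mul, ← mul_assoc]
  rw [Real.mul_self_sqrt hτ, Real.mul_self_sqrt hδ, Real.mul_self_sqrt (by positivity)]
  ring

theorem stateAvg_update_true (hf : IsChannel ν f)
    (h : ∀ e, IsWeakEdge (P e) (g e) (θ e) s ε Θ) (hF : LinearGrowth F) (hw : 0 ≤ w) (e : E) :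
    stateAvg ν f P θ g c τ (Function.update u e true) F w
      = stateAvg ν f P θ g c τ (Function.update u e false)
        (chan (P e) (edgeDensity (θ e) (g e)) F) w := by
  refine chan_congr hf (fun v hv => ?_) hw
  rw [chan_revealDensity_update_true]
  exact chan_congr (isChannel_revealDensity h _) (fun v hv =>
    chan_comm (h e).isChannel (isChannel_gaussDensity _) hF hv) hv

theorem stateAvg_coneEntropy_abs_le (hf : IsChannel ν f)
    (h : ∀ e, IsWeakEdge (P e) (g e) (θ e) s ε Θ) (hw : 0 ≤ w) (hw1 : ∑ a, w a = 1) :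
    |stateAvg ν f P θ g c τ u coneEntropy w| ≤ Fintype.card ι := by
  have h1 := stateAvg_mono (c := c) (τ := τ) (u := u) hf h (LinearGrowth.linFun fun _ => 0)
    LinearGrowth.coneEntropy (fun v hv => by simpa [linFun] using coneEntropy_nonneg hv) hw
  have h2 := stateAvg_mono (c := c) (τ := τ) (u := u) hf h LinearGrowth.coneEntropy
    (LinearGrowth.linFun fun _ => (Fintype.card ι : ℝ)) (fun v hv => by
      rw [linFun, ← Finset.sum_mul, mul_comm]; exact coneEntropy_le hv) hw
  rw [stateAvg_linFun hf h hw, linFun, ← Finset.sum_mul, hw1] at h1 h2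
  rw [abs_le]; constructor <;> simp at h1 h2 <;> linarith

/-- The weak-signal expansion averaged over the posterior; the prior term is exact because linear
functionals are preserved. -/
theorem stateAvg_gaussian_step (hf : IsChannel ν f)
    (h : ∀ e, IsWeakEdge (P e) (g e) (θ e) s ε Θ) (hw : 0 ≤ w) (hw1 : ∑ a, w a = 1)
    {K δ : ℝ} (hK : ∀ a, c a ⬝ᵥ c a ≤ K) (hK0 : 0 < K) (hδ0 : 0 < δ) (hδ1 : 6 * (δ * K) ≤ 1)
    (hτ : 0 ≤ τ) :
    stateAvg ν f P θ g c (τ + δ) u coneEntropy w ≤ stateAvg ν f P θ g c τ u coneEntropy w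
      - δ / 2 * (linFun (fun a => c a ⬝ᵥ c a) w
        - ∑ j, stateAvg ν f P θ g c τ u (sqMean fun a => c a j) w)
      + 23 * (δ * K * √(δ * K)) := by
  rw [stateAvg_add_strength hf h LinearGrowth.coneEntropy hw hτ hδ0.le]
  set x := 23 * (δ * K * √(δ * K))
  have hS := LinearGrowth.sum (Finset.univ : Finset κ)
    fun j => LinearGrowth.sqMean (fun a : ι => c a j)
  have hL := LinearGrowth.linFun (fun a : ι => c a ⬝ᵥ c a)
  have hX := LinearGrowth.linFun (fun _ : ι => x)
  have hLS := (hL.sub hS).const_smul (δ / 2)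
  have hη := LinearGrowth.coneEntropy (ι := ι)
  refine (stateAvg_mono hf h (hη.chan (isChannel_gaussDensity _)) ((hη.sub hLS).add hX)
    (fun v hv => ?_) hw).trans (le_of_eq ?_)
  · refine (chan_gaussDensity_coneEntropy_le c hK hK0 hδ0 hδ1 hv).trans (le_of_eq ?_)
    have : linFun (fun _ : ι => x) v = x * ∑ a, v a := by
      rw [linFun, ← Finset.sum_mul, mul_comm]
    simp only [Pi.add_apply, Pi.sub_apply, Pi.smul_apply, Finset.sum_apply, smul_eq_mul, this]
    rfl
  · rw [stateAvg_add hf h (hη.sub hLS) hX hw, stateAvg_sub hf h hη hLS hw,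
      stateAvg_smul hf h (hL.sub hS) hw, stateAvg_sub hf h hL hS hw, stateAvg_linFun hf h hw,
      stateAvg_linFun hf h hw,
      stateAvg_sum _ hf h (fun j => LinearGrowth.sqMean (fun a : ι => c a j)) hw]
    congr 1
    rw [linFun, ← Finset.sum_mul, hw1, one_mul]

/-- Only the case where `e` is disclosed in `u` has content; there the edge's own channel is moved
last and bounded by `IsWeakEdge.chan_sqMean_le`. -/
theorem stateAvg_sqMean_le (hf : IsChannel ν f)
    (h : ∀ e, IsWeakEdge (P e) (g e) (θ e) s ε Θ) (hw : 0 ≤ w) (hw1 : ∑ a, w a = 1) (e : E) :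
    stateAvg ν f P θ g c τ u (sqMean (θ e)) w
      ≤ stateAvg ν f P θ g c τ (Function.update u e false) (sqMean (θ e)) w
        + 8 * ε * Θ ^ 3 := by
  have hnn : 0 ≤ 8 * ε * Θ ^ 3 := by
    have := (h e).eps_nonneg; have := (h e).coeff_nonneg; positivity
  cases hu : u e
  · have : Function.update u e false = u := by rw [← hu, Function.update_eq_self]
    rw [this]; linarith
  · have hu' : Function.update u e true = u := by rw [← hu, Function.update_eq_self]
    conv_lhs => rw [← hu']
    have hS := LinearGrowth.sqMean (θ e)
    have hX := LinearGrowth.linFun (fun _ : ι => 8 * ε * Θ ^ 3)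
    rw [stateAvg_update_true hf h hS hw]
    refine (stateAvg_mono hf h (hS.chan (h e).isChannel) (hS.add hX) (fun v hv => ?_) hw).trans
      (le_of_eq ?_)
    · refine ((h e).chan_sqMean_le hv).trans (le_of_eq ?_)
      rw [Pi.add_apply, linFun, ← Finset.sum_mul, mul_comm (8 * ε * Θ ^ 3)]
    · rw [stateAvg_add hf h hS hX hw, stateAvg_linFun hf h hw, linFun, ← Finset.sum_mul, hw1,
        one_mul]

/-- The posterior term is stated at `u` itself, not at `u` with `e` hidden, so that it matches the
Gaussian step. The error `5` is `1` from the expansion plus `8 / 2` from this exchange. -/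
theorem stateAvg_edge_step (hf : IsChannel ν f)
    (h : ∀ e, IsWeakEdge (P e) (g e) (θ e) s ε Θ) (hs : 0 ≤ s) (hw : 0 ≤ w)
    (hw1 : ∑ a, w a = 1) (e : E) :
    stateAvg ν f P θ g c τ (Function.update u e false) coneEntropy w
      - stateAvg ν f P θ g c τ (Function.update u e true) coneEntropy w
      ≤ s / 2 * (linFun (fun a => θ e a ^ 2) w - stateAvg ν f P θ g c τ u (sqMean (θ e)) w)
        + 5 * Θ ^ 3 * ε * s := by
  set u' := Function.update u e false with hu'
  have hη := LinearGrowth.coneEntropy (ι := ι)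
  have hS := LinearGrowth.sqMean (θ e)
  have hL := LinearGrowth.linFun (fun a : ι => θ e a ^ 2)
  have hX := LinearGrowth.linFun (fun _ : ι => Θ ^ 3 * ε * s)
  have hLS := (hL.sub hS).const_smul (s / 2)
  have h1 : stateAvg ν f P θ g c τ u' coneEntropy w
      - (s / 2 * (linFun (fun a => θ e a ^ 2) w - stateAvg ν f P θ g c τ u' (sqMean (θ e)) w))
      - Θ ^ 3 * ε * s
      ≤ stateAvg ν f P θ g c τ (Function.update u e true) coneEntropy w := by
    rw [stateAvg_update_true hf h hη hw]
    refine (le_of_eq ?_).trans (stateAvg_mono hf h ((hη.sub hLS).sub hX)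
      (hη.chan (h e).isChannel) (fun v hv => ?_) hw)
    · rw [stateAvg_sub hf h (hη.sub hLS) hX hw, stateAvg_sub hf h hη hLS hw,
        stateAvg_smul hf h (hL.sub hS) hw, stateAvg_sub hf h hL hS hw, stateAvg_linFun hf h hw,
        stateAvg_linFun hf h hw]
      congr 1
      rw [linFun, ← Finset.sum_mul, hw1, one_mul]
    · refine (le_of_eq ?_).trans ((h e).coneEntropy_le_chan hv)
      have : linFun (fun _ : ι => Θ ^ 3 * ε * s) v = Θ ^ 3 * ε * s * ∑ a, v a := by
        rw [linFun, ← Finset.sum_mul, mul_comm]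
      simp only [Pi.sub_apply, Pi.smul_apply, smul_eq_mul, this]
  have h2 := mul_le_mul_of_nonneg_left
    (stateAvg_sqMean_le (c := c) (τ := τ) (u := u) hf h hw hw1 e) (half_pos one_pos).le
  have h3 := mul_le_mul_of_nonneg_left h2 hs
  have : s * (1 / 2 * (8 * ε * Θ ^ 3)) = 4 * (Θ ^ 3 * ε * s) := by ring
  nlinarith

/-- **Interpolation.** The entropy left after observing the edges is at least the entropy left
after observing the Gaussian channel, up to explicit terms. -/
theorem interpolation (hf : IsChannel ν f) (h : ∀ e, IsWeakEdge (P e) (g e) (θ e) s ε Θ)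
    (hs : 0 ≤ s) (hw : 0 ≤ w) (hw1 : ∑ a, w a = 1) {B : ℝ}
    (hB : ∀ v : ι → ℝ, 0 ≤ v →
      (∑ j, sqMean (fun a => c a j) v) / 2 - s / 2 * ∑ e, sqMean (θ e) v ≤ B * ∑ a, v a) :
    chan ν f (chan (stdGauss κ) (gaussDensity c) coneEntropy) w
      - chan ν f (chan (Measure.pi P) (revealDensity θ g fun _ => true) coneEntropy) w
      ≤ B + s / 2 * ∑ e, linFun (fun a => θ e a ^ 2) w - linFun (fun a => c a ⬝ᵥ c a) w / 2
        + Fintype.card E * (5 * Θ ^ 3 * ε * s) := by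
  have hdd : ∀ a, 0 ≤ c a ⬝ᵥ c a := fun a => Finset.sum_nonneg fun j _ => mul_self_nonneg _
  obtain ⟨K, hK0, hK⟩ : ∃ K : ℝ, 0 < K ∧ ∀ a, c a ⬝ᵥ c a ≤ K :=
    ⟨∑ a, c a ⬝ᵥ c a + 1, add_pos_of_nonneg_of_pos (Finset.sum_nonneg fun a _ => hdd a) one_pos,
      fun a => (Finset.single_le_sum (fun a _ => hdd a) (Finset.mem_univ a)).trans (by linarith)⟩
  set D : ℝ → (E → Bool) → ℝ := fun τ u => stateAvg ν f P θ g c τ u coneEntropy w with hD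
  set total := B + s / 2 * ∑ e, linFun (fun a => θ e a ^ 2) w
    - linFun (fun a => c a ⬝ᵥ c a) w / 2 + Fintype.card E * (5 * Θ ^ 3 * ε * s) with htotal
  obtain ⟨C, hC, hexp⟩ := exists_erasureAvg_expansion (E := E) (Fintype.card ι) (by positivity)
  have hDabs : ∀ τ u, |D τ u| ≤ Fintype.card ι := fun τ u =>
    stateAvg_coneEntropy_abs_le hf h hw hw1
  have hfin := sub_le_of_forall_step (Φ := fun t => erasureAvg t (D (1 - t))) (B := total)
    (C := 23 * (K * √K) + C) (h₀ := min 1 (1 / (6 * K))) (by positivity) ?_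
  · have e0 : erasureAvg 0 (D (1 - 0))
        = chan ν f (chan (stdGauss κ) (gaussDensity c) coneEntropy) w := by
      rw [erasureAvg_zero, hD]
      refine chan_congr hf (fun v hv => ?_) hw
      have : ∀ G, revealDensity θ g (fun _ => false) G = 1 := fun G => by
        ext a; simp [revealDensity]
      simp only [chan, this, mul_one]
      simp [integral_const, probReal_univ]
    have e1 : erasureAvg 1 (D (1 - 1)) = chan ν f (chan (Measure.pi P)
        (revealDensity θ g fun _ => true) coneEntropy) w := by
      rw [erasureAvg_one, hD]
      refine chan_congr hf (fun v hv => chan_congr (isChannel_revealDensity h _)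
        (fun v hv => ?_) hv) hw
      have : ∀ z, gaussDensity (fun a => √(1 - 1 : ℝ) • c a) z = 1 := fun z => by
        ext a; simp [gaussDensity]
      simp only [chan, this, mul_one]
      simp [integral_const, probReal_univ]
    rw [← e0, ← e1]; exact hfin
  · intro t δ ht hδ hδ₀ htδ
    have hδ1 : δ ≤ 1 := hδ₀.trans (min_le_left _ _)
    have hδK : 6 * (δ * K) ≤ 1 := by
      have := hδ₀.trans (min_le_right _ _)
      rw [le_div_iff₀ (by positivity)] at this
      linarith
    set τ := 1 - (t + δ) with hτdef
    have hτ : 0 ≤ τ := by linarith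
    -- The step from `(t, τ + δ)` to `(t + δ, τ)` passes through `(t, τ)`, so the posterior terms of
    -- both halves are averages over the same states and can be combined before averaging.
    have e1 : 1 - t = τ + δ := by rw [hτdef]; ring
    rw [e1]
    -- the Gaussian part of the step
    have hG : erasureAvg t (D (τ + δ)) ≤ erasureAvg t (fun u => D τ u
        + (-(δ / 2 * linFun (fun a => c a ⬝ᵥ c a) w) + 23 * (δ * K * √(δ * K)))
        + δ * ((∑ j, stateAvg ν f P θ g c τ u (sqMean fun a => c a j) w) / 2)) := by
      refine erasureAvg_mono ht (by linarith) fun u => ?_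
      refine (stateAvg_gaussian_step hf h hw hw1 hK hK0 hδ hδK hτ).trans (le_of_eq ?_)
      simp only [hD]; ring
    rw [erasureAvg_add, erasureAvg_add, erasureAvg_const, erasureAvg_const_mul] at hG
    -- the graph part of the step
    have hE := (abs_le.1 (hexp (D τ) (hDabs τ) t δ ht hδ.le htδ)).1
    have hE' : ∀ e, -erasureAvg t
        (fun u => D τ (Function.update u e true) - D τ (Function.update u e false))
        ≤ (s / 2 * linFun (fun a => θ e a ^ 2) w + 5 * Θ ^ 3 * ε * s)
        + (-(s / 2)) * erasureAvg t (fun u => stateAvg ν f P θ g c τ u (sqMean (θ e)) w) := by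
      intro e
      rw [← erasureAvg_const_mul]
      rw [← erasureAvg_const (E := E) t (s / 2 * linFun (fun a => θ e a ^ 2) w
        + 5 * Θ ^ 3 * ε * s), ← erasureAvg_add, neg_eq_neg_one_mul, ← erasureAvg_const_mul]
      refine erasureAvg_mono ht (by linarith) fun u => ?_
      have := stateAvg_edge_step (c := c) (τ := τ) (u := u) hf h hs hw hw1 e
      simp only [hD]
      linarith
    have hE'' : -∑ e, erasureAvg t
        (fun u => D τ (Function.update u e true) - D τ (Function.update u e false))
        ≤ s / 2 * ∑ e, linFun (fun a => θ e a ^ 2) w + Fintype.card E * (5 * Θ ^ 3 * ε * s)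
        - s / 2 * erasureAvg t
          (fun u => ∑ e, stateAvg ν f P θ g c τ u (sqMean (θ e)) w) := by
      rw [← Finset.sum_neg_distrib, erasureAvg_sum]
      refine (Finset.sum_le_sum fun e _ => hE' e).trans (le_of_eq ?_)
      rw [Finset.sum_add_distrib, Finset.sum_add_distrib]
      simp only [← Finset.mul_sum, Finset.sum_const, nsmul_eq_mul, Finset.card_univ]
      ring
    -- the two posterior terms together
    have hBs : ∀ u, (∑ j, stateAvg ν f P θ g c τ u (sqMean fun a => c a j) w) / 2
        + (-(s / 2)) * ∑ e, stateAvg ν f P θ g c τ u (sqMean (θ e)) w ≤ B := by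
      intro u
      have hS1 := LinearGrowth.sum (Finset.univ : Finset κ)
        fun j => LinearGrowth.sqMean (fun a : ι => c a j)
      have hS2 := LinearGrowth.sum (Finset.univ : Finset E)
        fun e => LinearGrowth.sqMean (θ e)
      have := stateAvg_mono (c := c) (τ := τ) (u := u) hf h
        ((hS1.const_smul (1 / 2)).add (hS2.const_smul (-(s / 2))))
        (LinearGrowth.linFun fun _ => B) (fun v hv => by
          have := hB v hv
          simp only [Pi.add_apply, Pi.smul_apply, Finset.sum_apply, smul_eq_mul]
          rw [linFun, ← Finset.sum_mul, mul_comm _ B]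
          linarith) hw
      rw [stateAvg_add hf h (hS1.const_smul _) (hS2.const_smul _) hw,
        stateAvg_smul hf h hS1 hw, stateAvg_smul hf h hS2 hw,
        stateAvg_sum _ hf h (fun j => LinearGrowth.sqMean (fun a : ι => c a j)) hw,
        stateAvg_sum _ hf h (fun e => LinearGrowth.sqMean (θ e)) hw, stateAvg_linFun hf h hw,
        linFun, ← Finset.sum_mul, hw1, one_mul] at this
      linarith
    have hB' := erasureAvg_mono ht (by linarith : t ≤ 1) hBs
    rw [erasureAvg_const, erasureAvg_add, erasureAvg_const_mul] at hB'
    have hm1 := mul_le_mul_of_nonneg_left hE'' hδ.le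
    have hm2 := mul_le_mul_of_nonneg_left hB' hδ.le
    have hsq : √(δ * K) = √δ * √K := Real.sqrt_mul hδ.le K
    have hdd : δ ^ 2 ≤ δ * √δ := by
      rw [sq]
      refine mul_le_mul_of_nonneg_left (Real.le_sqrt_of_sq_le ?_) hδ.le
      nlinarith
    have hm3 := mul_le_mul_of_nonneg_left hdd hC
    rw [hsq] at hG
    rw [htotal]
    linarith

end State

end CommunityDetection

end

-- Algebra of overlaps, and moments of i.i.d. labels.

noncomputable section

namespace CommunityDetection

/-! ### Completing the square in the overlap -/

section Overlap

variable {m n : ℕ}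

theorem sqrt_mul_sqrt {A : Matrix (Fin m) (Fin m) ℝ} (hA : A.PosSemidef) :
    CFC.sqrt A * CFC.sqrt A = A :=
  CFC.sqrt_mul_sqrt_self A (Matrix.nonneg_iff_posSemidef.2 hA)

theorem transpose_sqrt (A : Matrix (Fin m) (Fin m) ℝ) : (CFC.sqrt A).transpose = CFC.sqrt A := by
  have := (Matrix.nonneg_iff_posSemidef.1 (CFC.sqrt_nonneg A)).isHermitian
  rwa [Matrix.IsHermitian, Matrix.conjTranspose_eq_transpose_of_trivial] at this

theorem sqrt_mulVec_dotProduct {A : Matrix (Fin m) (Fin m) ℝ} (hA : A.PosSemidef)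
    (x y : Fin m → ℝ) : (CFC.sqrt A).mulVec x ⬝ᵥ (CFC.sqrt A).mulVec y = x ⬝ᵥ A.mulVec y := by
  conv_rhs => rw [← sqrt_mul_sqrt hA, ← Matrix.mulVec_mulVec, Matrix.dotProduct_mulVec,
    ← Matrix.mulVec_transpose, transpose_sqrt]

/-- With `R = BᵀB` the trace is the squared Frobenius norm of `B A Bᵀ`. For `-R = BᵀB` the two signs
cancel, which is why either sign of definiteness is allowed. -/
theorem trace_mul_mul_transpose_mul_nonneg {R : Matrix (Fin m) (Fin m) ℝ}
    (hR : R.PosDef ∨ (-R).PosDef) (A : Matrix (Fin m) (Fin m) ℝ) :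
    0 ≤ (A * R * A.transpose * R).trace := by
  have key : ∀ B : Matrix (Fin m) (Fin m) ℝ,
      0 ≤ (A * (B.transpose * B) * A.transpose * (B.transpose * B)).trace := fun B => by
    have e : (A * (B.transpose * B) * A.transpose * (B.transpose * B)).trace
        = ((B * A * B.transpose) * (B * A * B.transpose).transpose).trace := by
      rw [← Matrix.mul_assoc _ B.transpose B, Matrix.trace_mul_comm]
      simp only [Matrix.transpose_mul, Matrix.transpose_transpose, Matrix.mul_assoc]
    rw [e, Matrix.trace]
    refine Finset.sum_nonneg fun i _ => ?_
    simp only [Matrix.diag_apply, Matrix.mul_apply (M := B * A * B.transpose),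
      Matrix.transpose_apply]
    exact Finset.sum_nonneg fun j _ => mul_self_nonneg _
  rcases hR with h | h
  · have hB := sqrt_mul_sqrt h.posSemidef
    have := key (CFC.sqrt R)
    rwa [transpose_sqrt, hB] at this
  · have hB := sqrt_mul_sqrt h.posSemidef
    have := key (CFC.sqrt (-R))
    rw [transpose_sqrt, hB] at this
    simpa only [Matrix.mul_neg, Matrix.neg_mul, neg_neg] using this

theorem isSymm_of_definite {R : Matrix (Fin m) (Fin m) ℝ} (hR : R.PosDef ∨ (-R).PosDef) :
    R.transpose = R := by
  rcases hR with h | h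
  · simpa [Matrix.IsHermitian] using h.isHermitian
  · have := h.isHermitian
    rw [Matrix.IsHermitian, Matrix.conjTranspose_eq_transpose_of_trivial,
      Matrix.transpose_neg, neg_inj] at this
    exact this

theorem sum_dotProduct_mulVec_eq_trace (X X' : Matrix (Fin n) (Fin m) ℝ)
    (A : Matrix (Fin m) (Fin m) ℝ) :
    ∑ i, X i ⬝ᵥ A.mulVec (X' i) = (A * (X.transpose * X').transpose).trace := by
  have : (A * (X.transpose * X').transpose).trace = (X * A * X'.transpose).trace := by
    rw [Matrix.transpose_mul, Matrix.transpose_transpose, ← Matrix.mul_assoc,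
      Matrix.trace_mul_comm, ← Matrix.mul_assoc]
  rw [this, Matrix.trace]
  refine Finset.sum_congr rfl fun i _ => ?_
  rw [Matrix.diag_apply, Matrix.mul_assoc]
  rfl

/-- The edge signals of two samples correlate through the overlap `Xᵀ X'` alone, quadratically; the
node-wise Gaussian signals do so linearly. -/
theorem sum_sum_dotProduct_mulVec_eq_trace (X X' : Matrix (Fin n) (Fin m) ℝ)
    {R : Matrix (Fin m) (Fin m) ℝ} (hR : R.transpose = R) :
    ∑ i, ∑ j, (X i ⬝ᵥ R.mulVec (X j)) * (X' i ⬝ᵥ R.mulVec (X' j))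
      = ((X.transpose * X') * R * (X.transpose * X').transpose * R).trace := by
  have : ((X.transpose * X') * R * (X.transpose * X').transpose * R).trace
      = ((X * R * X.transpose) * (X' * R * X'.transpose).transpose).trace := by
    simp only [Matrix.transpose_mul, Matrix.transpose_transpose, hR]
    rw [Matrix.trace_mul_comm (X * R * X.transpose)]
    simp only [← Matrix.mul_assoc]
    rw [Matrix.trace_mul_comm _ X.transpose]
    rw [Matrix.trace_mul_comm _ R]
    simp only [← Matrix.mul_assoc]
    rw [← Matrix.trace_transpose]
    simp only [Matrix.transpose_mul, Matrix.transpose_transpose, hR, Matrix.mul_assoc]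
  rw [this, Matrix.trace]
  refine Finset.sum_congr rfl fun i _ => ?_
  rw [Matrix.diag_apply, Matrix.mul_apply]
  refine Finset.sum_congr rfl fun j _ => ?_
  rw [Matrix.transpose_apply, Matrix.mul_assoc, Matrix.mul_assoc]
  rfl

/-- Completing the square: the quadratic overlap of two samples dominates its linearisation
at `V`. -/
theorem overlap_linearization_le (hn : 0 < n) (X X' : Matrix (Fin n) (Fin m) ℝ)
    {R V : Matrix (Fin m) (Fin m) ℝ} (hR : R.PosDef ∨ (-R).PosDef) (hV : V.transpose = V) :
    (∑ i, X i ⬝ᵥ (R * V * R).mulVec (X' i)) / 2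
      - 1 / (4 * n) * ∑ i, ∑ j, (X i ⬝ᵥ R.mulVec (X j)) * (X' i ⬝ᵥ R.mulVec (X' j))
      ≤ n / 4 * (V * R * V * R).trace := by
  have hRs := isSymm_of_definite hR
  rw [sum_dotProduct_mulVec_eq_trace, sum_sum_dotProduct_mulVec_eq_trace X X' hRs]
  set T := X.transpose * X'
  have hn' : (0 : ℝ) < n := by exact_mod_cast hn
  -- The square is completed around `T = nV`; dividing by `4n` gives the claim.
  have h := trace_mul_mul_transpose_mul_nonneg hR (T - (n : ℝ) • V)
  have e1 : (T * R * V * R).trace = (R * V * R * T.transpose).trace := by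
    rw [← Matrix.trace_transpose]
    simp only [Matrix.transpose_mul, hRs, hV, Matrix.mul_assoc]
  have e2 : (V * R * T.transpose * R).trace = (R * V * R * T.transpose).trace := by
    rw [Matrix.trace_mul_comm]; simp only [Matrix.mul_assoc]
  have e3 : ((T - (n : ℝ) • V) * R * (T - (n : ℝ) • V).transpose * R).trace
      = (T * R * T.transpose * R).trace - 2 * n * (R * V * R * T.transpose).trace
        + n ^ 2 * (V * R * V * R).trace := by
    simp only [Matrix.transpose_sub, Matrix.transpose_smul, hV, Matrix.sub_mul, Matrix.mul_sub,
      Matrix.smul_mul, Matrix.mul_smul, Matrix.trace_sub, Matrix.trace_smul, smul_eq_mul, e1, e2]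
    ring
  rw [e3] at h
  have h4 : 0 ≤ ((T * R * T.transpose * R).trace - 2 * n * (R * V * R * T.transpose).trace
        + n ^ 2 * (V * R * V * R).trace) / (4 * n) := by positivity
  have h5 : ((T * R * T.transpose * R).trace - 2 * n * (R * V * R * T.transpose).trace
        + n ^ 2 * (V * R * V * R).trace) / (4 * n)
      = 1 / (4 * n) * (T * R * T.transpose * R).trace - (R * V * R * T.transpose).trace / 2
        + n / 4 * (V * R * V * R).trace := by
    field_simp; ring
  linarith

end Overlap

/-! ### Sums over pairs -/

/-- The pairs `i < j` of elements of `Fin n`. -/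
abbrev OrderedPair (n : ℕ) := {q : Fin n × Fin n // q.1 < q.2}

theorem sum_sum_eq_two_mul_sum_orderedPair {n : ℕ} (f : Fin n → Fin n → ℝ)
    (hf : ∀ i j, f i j = f j i) :
    ∑ i, ∑ j, f i j = 2 * (∑ q : OrderedPair n, f q.1.1 q.1.2) + ∑ i, f i i := by
  have h1 : ∑ q : OrderedPair n, f q.1.1 q.1.2 = ∑ i, ∑ j, if i < j then f i j else 0 := by
    rw [← Fintype.sum_prod_type' (f := fun i j => if i < j then f i j else 0),
      ← Finset.sum_filter]
    exact (Finset.sum_subtype (Finset.univ.filter fun p : Fin n × Fin n => p.1 < p.2)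
      (by simp) fun p => f p.1 p.2).symm
  have h2 : ∑ i, ∑ j, (if i < j then f i j else 0) = ∑ i, ∑ j, if j < i then f i j else 0 := by
    rw [Finset.sum_comm]
    exact Finset.sum_congr rfl fun i _ => Finset.sum_congr rfl fun j _ => by rw [hf]
  have h3 : ∑ i, f i i = ∑ i, ∑ j, if i = j then f i j else 0 := by simp
  rw [two_mul]
  nth_rewrite 2 [h1]
  rw [h2, h1, h3, ← Finset.sum_add_distrib, ← Finset.sum_add_distrib]
  refine Finset.sum_congr rfl fun i _ => ?_
  rw [← Finset.sum_add_distrib, ← Finset.sum_add_distrib]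
  refine Finset.sum_congr rfl fun j _ => ?_
  rcases lt_trichotomy i j with h | h | h
  · simp [h, h.ne, not_lt.2 h.le]
  · simp [h]
  · simp [h, h.ne', not_lt.2 h.le]

theorem two_mul_card_orderedPair (n : ℕ) :
    2 * (Fintype.card (OrderedPair n) : ℝ) + n = n ^ 2 := by
  have := sum_sum_eq_two_mul_sum_orderedPair (n := n) (fun _ _ => 1) (fun _ _ => rfl)
  simp only [Finset.sum_const, Finset.card_univ, Fintype.card_fin, nsmul_eq_mul, mul_one] at this
  rw [sq]; linarith

/-! ### Moments of the labels -/

section Prior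

variable {k n : ℕ}

theorem sum_prod_apply (p : Fin k → ℝ) (F : Fin n → Fin k → ℝ) :
    ∑ a : Fin n → Fin k, (∏ l, p (a l)) * ∏ l, F l (a l) = ∏ l, ∑ b, p b * F l b := by
  have := Finset.prod_univ_sum (fun _ : Fin n => (Finset.univ : Finset (Fin k)))
    (fun l b => p b * F l b)
  rw [Fintype.piFinset_univ] at this
  rw [this]
  exact Finset.sum_congr rfl fun a _ => Finset.prod_mul_distrib.symm

theorem sum_prod_eq_one {p : Fin k → ℝ} (hp : ∑ b, p b = 1) :
    ∑ a : Fin n → Fin k, ∏ l, p (a l) = 1 := by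
  have := sum_prod_apply (n := n) p (fun _ _ => 1)
  simpa [hp] using this

theorem sum_prod_mul_apply {p : Fin k → ℝ} (hp : ∑ b, p b = 1) (i : Fin n) (φ : Fin k → ℝ) :
    ∑ a : Fin n → Fin k, (∏ l, p (a l)) * φ (a i) = ∑ b, p b * φ b := by
  have := sum_prod_apply (n := n) p (fun l b => if l = i then φ b else 1)
  simp only [Finset.prod_ite_eq', Finset.mem_univ, if_true] at this
  rw [this, Finset.prod_eq_single i]
  · simp
  · intro j _ hj; simp [hj, hp]
  · simp

theorem sum_prod_mul_apply_mul_apply {p : Fin k → ℝ} (hp : ∑ b, p b = 1) {i j : Fin n}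
    (hij : i ≠ j) (φ ψ : Fin k → ℝ) :
    ∑ a : Fin n → Fin k, (∏ l, p (a l)) * (φ (a i) * ψ (a j))
      = (∑ b, p b * φ b) * ∑ b, p b * ψ b := by
  have := sum_prod_apply (n := n) p
    (fun l b => (if l = i then φ b else 1) * (if l = j then ψ b else 1))
  simp only [Finset.prod_mul_distrib, Finset.prod_ite_eq', Finset.mem_univ, if_true] at this
  rw [this, ← Finset.mul_prod_erase Finset.univ _ (Finset.mem_univ i),
    ← Finset.mul_prod_erase (Finset.univ.erase i) _ (Finset.mem_erase.2 ⟨hij.symm, Finset.mem_univ j⟩),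
    Finset.prod_eq_one, mul_one]
  · simp [hij, hij.symm]
  · intro l hl
    simp only [Finset.mem_erase] at hl
    simp [hl.1, hl.2.1, hp]

/-- Expansion of `H` in indicators reduces to products of functions of one label each. -/
theorem sum_prod_mul_apply₂ {p : Fin k → ℝ} (hp : ∑ b, p b = 1) {i j : Fin n}
    (hij : i ≠ j) (H : Fin k → Fin k → ℝ) :
    ∑ a : Fin n → Fin k, (∏ l, p (a l)) * H (a i) (a j)
      = ∑ b, ∑ b', p b * p b' * H b b' := by
  have h1 : ∀ x y, H x y = ∑ b, ∑ b', H b b' *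
      ((if x = b then 1 else 0) * (if y = b' then 1 else 0)) := fun x y => by
    simp
  calc _ = ∑ a : Fin n → Fin k, ∑ b, ∑ b', H b b' * ((∏ l, p (a l)) *
        ((if a i = b then 1 else 0) * (if a j = b' then 1 else 0))) := by
        refine Finset.sum_congr rfl fun a _ => ?_
        rw [h1 (a i) (a j), Finset.mul_sum]
        refine Finset.sum_congr rfl fun b _ => ?_
        rw [Finset.mul_sum]
        exact Finset.sum_congr rfl fun b' _ => by ring
    _ = ∑ b, ∑ b', H b b' * ∑ a : Fin n → Fin k, (∏ l, p (a l)) *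
        ((if a i = b then 1 else 0) * (if a j = b' then 1 else 0)) := by
        rw [Finset.sum_comm]
        refine Finset.sum_congr rfl fun b _ => ?_
        rw [Finset.sum_comm]
        exact Finset.sum_congr rfl fun b' _ => by rw [Finset.mul_sum]
    _ = _ := by
        refine Finset.sum_congr rfl fun b _ => Finset.sum_congr rfl fun b' _ => ?_
        rw [sum_prod_mul_apply_mul_apply hp hij (fun x => if x = b then 1 else 0)
          (fun x => if x = b' then 1 else 0)]
        simp; ring

variable {p : Fin k → ℝ} {μ : Fin k → Fin (k - 1) → ℝ}

/-- The quadratic form is linear in `μ μᵀ`, whose mean is the identity. -/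
theorem IsWhitened.sum_mul_dotProduct_mulVec (hμ : IsWhitened p μ)
    (A : Matrix (Fin (k - 1)) (Fin (k - 1)) ℝ) :
    ∑ b, p b * (μ b ⬝ᵥ A.mulVec (μ b)) = A.trace := by
  have h : ∀ b, p b * (μ b ⬝ᵥ A.mulVec (μ b))
      = (A * (p b • Matrix.vecMulVec (μ b) (μ b))).trace := fun b => by
    rw [Matrix.mul_smul, Matrix.trace_smul, smul_eq_mul, Matrix.mul_vecMulVec,
      Matrix.trace_vecMulVec, dotProduct_comm]
  simp only [h]
  rw [← Matrix.trace_sum, ← Finset.mul_sum, hμ.cov, Matrix.mul_one]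

/-- Whitening is used twice, once in each of the two independent labels. -/
theorem IsWhitened.sum_sum_mul_sq (hμ : IsWhitened p μ)
    {R : Matrix (Fin (k - 1)) (Fin (k - 1)) ℝ} (hR : R.transpose = R) :
    ∑ b, ∑ b', p b * p b' * (μ b ⬝ᵥ R.mulVec (μ b')) ^ 2 = (R * R).trace := by
  have h : ∀ b, ∑ b', p b * p b' * (μ b ⬝ᵥ R.mulVec (μ b')) ^ 2
      = p b * (μ b ⬝ᵥ (R * R).mulVec (μ b)) := fun b => by
    have e : ∀ b', p b * p b' * (μ b ⬝ᵥ R.mulVec (μ b')) ^ 2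
        = p b * (p b' * (μ b' ⬝ᵥ (Matrix.vecMulVec (R.mulVec (μ b)) (R.mulVec (μ b))).mulVec
          (μ b'))) := fun b' => by
      have : μ b ⬝ᵥ R.mulVec (μ b') = R.mulVec (μ b) ⬝ᵥ μ b' := by
        rw [Matrix.dotProduct_mulVec, ← Matrix.mulVec_transpose, hR]
      rw [this, Matrix.vecMulVec_mulVec, mul_assoc]
      congr 2
      simp [dotProduct_comm (μ b'), sq]
    simp only [e]
    rw [← Finset.mul_sum, hμ.sum_mul_dotProduct_mulVec, Matrix.trace_vecMulVec,
      ← Matrix.mulVec_mulVec, Matrix.dotProduct_mulVec (μ b), ← Matrix.mulVec_transpose, hR]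
  simp only [h]
  exact hμ.sum_mul_dotProduct_mulVec (R * R)

end Prior

end CommunityDetection

end

-- Mutual information as prior entropy minus posterior entropy.

noncomputable section

namespace CommunityDetection

variable {ι α Y Y' : Type*} [Fintype ι] [MeasurableSpace α] [MeasurableSpace Y] [MeasurableSpace Y']

/-! ### Conditional laws with densities -/

/-- The measures `κ a` have the densities `f · a` with respect to `ν`. -/
structure HasDensities (κ : ι → Measure Y) (ν : Measure Y) (f : Y → ι → ℝ) : Prop where
  measurable : Measurable f
  nonneg : ∀ y, 0 ≤ f y
  eq : ∀ a, κ a = ν.withDensity fun y => ENNReal.ofReal (f y a)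

section Densities

variable {κ : ι → Measure Y} {ν : Measure Y} {f : Y → ι → ℝ} {κ' : ι → Measure Y'}
  {ν' : Measure Y'} {f' : Y' → ι → ℝ}

theorem HasDensities.measurable_apply (h : HasDensities κ ν f) (a : ι) :
    Measurable fun y => f y a := (measurable_pi_apply a).comp h.measurable

theorem HasDensities.lintegral_eq_one (h : HasDensities κ ν f) [∀ a, IsProbabilityMeasure (κ a)]
    (a : ι) : ∫⁻ y, ENNReal.ofReal (f y a) ∂ν = 1 := by
  have := measure_univ (μ := κ a)
  rwa [h.eq, withDensity_apply _ MeasurableSet.univ, Measure.restrict_univ] at this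

theorem HasDensities.isChannel (h : HasDensities κ ν f) [∀ a, IsProbabilityMeasure (κ a)] :
    IsChannel ν f where
  measurable := h.measurable
  nonneg := h.nonneg
  integrable a := by
    refine ⟨(h.measurable_apply a).aestronglyMeasurable, ?_⟩
    rw [hasFiniteIntegral_iff_ofReal (Eventually.of_forall fun y => h.nonneg y a),
      h.lintegral_eq_one]
    exact ENNReal.one_lt_top
  integral_eq_one a := by
    rw [integral_eq_lintegral_of_nonneg_ae (Eventually.of_forall fun y => h.nonneg y a)
      (h.measurable_apply a).aestronglyMeasurable, h.lintegral_eq_one, ENNReal.toReal_one]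

theorem HasDensities.prod [SFinite ν] [SFinite ν'] (h : HasDensities κ ν f)
    (h' : HasDensities κ' ν' f') :
    HasDensities (fun a => (κ a).prod (κ' a)) (ν.prod ν') (fun p => f p.1 * f' p.2) where
  measurable := (h.measurable.comp measurable_fst).mul (h'.measurable.comp measurable_snd)
  nonneg p := fun a => mul_nonneg (h.nonneg p.1 a) (h'.nonneg p.2 a)
  eq a := by
    rw [h.eq, h'.eq, prod_withDensity (h.measurable_apply a).ennreal_ofReal
      (h'.measurable_apply a).ennreal_ofReal]
    congr 1; ext p
    rw [Pi.mul_apply, ENNReal.ofReal_mul (h.nonneg p.1 a)]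

/-- Transport along a map with a measurable left inverse. -/
theorem HasDensities.map (h : HasDensities κ ν f) {T : Y → Y'} {T' : Y' → Y}
    (hT : Measurable T) (hT' : Measurable T') (hTT' : ∀ y, T' (T y) = y) :
    HasDensities (fun a => (κ a).map T) (ν.map T) (fun y => f (T' y)) where
  measurable := h.measurable.comp hT'
  nonneg y := h.nonneg _
  eq a := by
    ext s hs
    have hm : Measurable fun y => ENNReal.ofReal (f (T' y) a) :=
      ((h.measurable_apply a).comp hT').ennreal_ofReal
    rw [Measure.map_apply hT hs, h.eq, withDensity_apply _ (hT hs), withDensity_apply _ hs,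
      setLIntegral_map hs hm hT]
    simp only [hTT']

/-- Products of probability measures with densities. -/
theorem pi_withDensity {I : Type*} [Fintype I] {Z : I → Type*} [∀ i, MeasurableSpace (Z i)]
    (ν : ∀ i, Measure (Z i)) [∀ i, IsProbabilityMeasure (ν i)]
    (κ : ∀ i, Measure (Z i)) [∀ i, IsProbabilityMeasure (κ i)] (f : ∀ i, Z i → ℝ)
    (hf : ∀ i, Measurable (f i)) (hf0 : ∀ i z, 0 ≤ f i z)
    (h : ∀ i, κ i = (ν i).withDensity fun z => ENNReal.ofReal (f i z)) :
    Measure.pi κ = (Measure.pi ν).withDensity fun z => ENNReal.ofReal (∏ i, f i (z i)) := by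
  have hint : ∀ i, Integrable (f i) (ν i) := fun i => by
    refine ⟨(hf i).aestronglyMeasurable, ?_⟩
    rw [hasFiniteIntegral_iff_ofReal (Eventually.of_forall fun y => hf0 i y)]
    have := measure_univ (μ := κ i)
    rw [h, withDensity_apply _ MeasurableSet.univ, Measure.restrict_univ] at this
    rw [this]; exact ENNReal.one_lt_top
  symm
  refine (Measure.pi_eq fun s hs => ?_).symm
  have hbox : MeasurableSet (Set.univ.pi s) := MeasurableSet.univ_pi hs
  rw [withDensity_apply _ hbox, ← lintegral_indicator hbox]
  have e : (fun z => (Set.univ.pi s).indicator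
      (fun z => ENNReal.ofReal (∏ i, f i (z i))) z)
      = fun z => ENNReal.ofReal (∏ i, (s i).indicator (f i) (z i)) := by
    ext z
    by_cases hz : z ∈ Set.univ.pi s
    · rw [Set.indicator_of_mem hz]
      congr 1
      refine Finset.prod_congr rfl fun i _ => ?_
      rw [Set.indicator_of_mem (hz i (Set.mem_univ i))]
    · rw [Set.indicator_of_notMem hz]
      obtain ⟨i, hi⟩ : ∃ i, z i ∉ s i := by simpa [Set.mem_pi] using hz
      rw [Finset.prod_eq_zero (Finset.mem_univ i) (Set.indicator_of_notMem hi _),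
        ENNReal.ofReal_zero]
  have hi0 : ∀ i z, 0 ≤ (s i).indicator (f i) z := fun i z =>
    Set.indicator_nonneg (fun z _ => hf0 i z) z
  have hii : ∀ i, Integrable ((s i).indicator (f i)) (ν i) := fun i => (hint i).indicator (hs i)
  rw [e, ← ofReal_integral_eq_lintegral_ofReal (Integrable.fintype_prod_dep hii)
    (Eventually.of_forall fun z => Finset.prod_nonneg fun i _ => hi0 i _),
    integral_fintype_prod_eq_prod (μ := ν) (fun i => (s i).indicator (f i)),
    ENNReal.ofReal_prod_of_nonneg fun i _ => integral_nonneg (hi0 i)]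
  refine Finset.prod_congr rfl fun i _ => ?_
  rw [h, withDensity_apply _ (hs i), ofReal_integral_eq_lintegral_ofReal (hii i)
    (Eventually.of_forall (hi0 i)), ← lintegral_indicator (hs i)]
  congr 1; ext z
  by_cases hz : z ∈ s i <;> simp [hz]

end Densities

/-! ### Mutual information in terms of the entropy of the posterior -/

/-- Pointwise in the output, with `u` the likelihoods. The affine part of `klFun` cancels in the
`w`-average, leaving a linear term, whose mean will be the prior entropy, minus the entropy of the
unnormalised posterior. -/
theorem sum_mul_klFun {w u : ι → ℝ} (hw : ∀ a, 0 < w a) (hw1 : ∑ a, w a = 1) (hu : 0 ≤ u) :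
    ∑ a, w a * (InformationTheory.klFun (u a / ∑ b, w b * u b) * ∑ b, w b * u b)
      = linFun (fun a => -Real.log (w a)) (w * u) - coneEntropy (w * u) := by
  set s := ∑ b, w b * u b with hs
  have hs' : ∑ b, (w * u) b = s := rfl
  have hwu : 0 ≤ w * u := fun a => mul_nonneg (hw a).le (hu a)
  by_cases h0 : s = 0
  · have := eq_zero_of_sum_eq_zero hwu h0
    rw [this, h0]; simp [linFun, coneEntropy_zero]
  have hspos : 0 < s := lt_of_le_of_ne (Finset.sum_nonneg fun a _ => hwu a) (Ne.symm h0)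
  have e : ∀ a, w a * (InformationTheory.klFun (u a / s) * s)
      = (w * u) a * Real.log ((w * u) a) - (w * u) a * Real.log (w a) - (w * u) a * Real.log s
        + (w a * s - (w * u) a) := fun a => by
    rw [InformationTheory.klFun_apply, Pi.mul_apply]
    by_cases hua : u a = 0
    · simp [hua]
    rw [Real.log_div hua h0, Real.log_mul (hw a).ne' hua]
    field_simp; ring
  simp only [e]
  rw [Finset.sum_add_distrib, Finset.sum_sub_distrib, Finset.sum_sub_distrib,
    Finset.sum_sub_distrib, ← Finset.sum_mul, ← Finset.sum_mul, hw1, hs']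
  simp only [linFun, coneEntropy, hs', mul_neg, Finset.sum_neg_distrib]
  ring

theorem lintegral_sum_smul_dirac_prod (w : ι → ℝ≥0∞) (x : ι → α) (ν : Measure Y) [SFinite ν]
    {F : α × Y → ℝ≥0∞} (hF : Measurable F) :
    ∫⁻ q, F q ∂((∑ a, w a • Measure.dirac (x a)).prod ν) = ∑ a, w a * ∫⁻ y, F (x a, y) ∂ν := by
  rw [lintegral_prod _ hF.aemeasurable, lintegral_finsetSum_measure]
  refine Finset.sum_congr rfl fun a _ => ?_
  rw [lintegral_smul_measure, lintegral_dirac' _ hF.lintegral_prod_right', smul_eq_mul]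

/-- The joint law has density `f y a / m y` against the product of its marginals, `m` being the
output density; `x` is injective so that the value `x a` identifies `a`. Integrating `klFun` of this
density with `sum_mul_klFun` gives the formula. -/
theorem mutualInfo_mixtureLaw [MeasurableSingletonClass α] {w : ι → ℝ} (hw : ∀ a, 0 < w a)
    (hw1 : ∑ a, w a = 1) {x : ι → α} (hx : Function.Injective x) {κ : ι → Measure Y}
    [∀ a, IsProbabilityMeasure (κ a)] {ν : Measure Y} [IsProbabilityMeasure ν] {f : Y → ι → ℝ}
    (h : HasDensities κ ν f) :
    mutualInfo (mixtureLaw w x κ)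
      = ENNReal.ofReal (∑ a, Real.negMulLog (w a) - chan ν f coneEntropy w) := by
  classical
  have hw0 : (0 : ι → ℝ) ≤ w := fun a => (hw a).le
  have hwE : ∑ a, ENNReal.ofReal (w a) = 1 := by
    rw [← ENNReal.ofReal_sum_of_nonneg fun a _ => (hw a).le, hw1, ENNReal.ofReal_one]
  set m : Y → ℝ := fun y => ∑ b, w b * f y b with hm
  have hm0 : ∀ y, 0 ≤ m y := fun y =>
    Finset.sum_nonneg fun b _ => mul_nonneg (hw b).le (h.nonneg y b)
  have hmm : Measurable m := Finset.measurable_sum _ fun b _ => (h.measurable_apply b).const_mul _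
  set ρ := mixtureLaw w x κ with hρ
  have hfst : ρ.fst = ∑ a, ENNReal.ofReal (w a) • Measure.dirac (x a) := by
    rw [hρ, mixtureLaw, Measure.fst, Measure.map_finset_sum measurable_fst.aemeasurable]
    refine Finset.sum_congr rfl fun a _ => ?_
    rw [Measure.map_smul, ← Measure.fst, Measure.fst_prod]
  have hsnd : ρ.snd = ν.withDensity fun y => ENNReal.ofReal (m y) := by
    rw [hρ, mixtureLaw, Measure.snd, Measure.map_finset_sum measurable_snd.aemeasurable]
    have e1 : ∀ a, (ENNReal.ofReal (w a) • (Measure.dirac (x a)).prod (κ a)).map Prod.snd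
        = ENNReal.ofReal (w a) • κ a := fun a => by
      rw [Measure.map_smul, ← Measure.snd, Measure.snd_prod]
    simp only [e1]
    ext s hs
    rw [Measure.finsetSum_apply, withDensity_apply _ hs]
    simp only [hm, Measure.smul_apply, h.eq, withDensity_apply _ hs]
    have e2 : ∀ y, ENNReal.ofReal (∑ b, w b * f y b)
        = ∑ b, ENNReal.ofReal (w b) * ENNReal.ofReal (f y b) := fun y => by
      rw [ENNReal.ofReal_sum_of_nonneg fun b _ => mul_nonneg (hw b).le (h.nonneg y b)]
      exact Finset.sum_congr rfl fun b _ => ENNReal.ofReal_mul (hw b).le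
    simp only [e2]
    rw [lintegral_finsetSum _ fun b _ => (h.measurable_apply b).ennreal_ofReal.const_mul _]
    refine Finset.sum_congr rfl fun b _ => ?_
    rw [lintegral_const_mul _ (h.measurable_apply b).ennreal_ofReal, smul_eq_mul]
  have hρprob : IsProbabilityMeasure ρ := ⟨by
    rw [hρ, mixtureLaw, Measure.finsetSum_apply]
    simp [hwE]⟩
  -- the density of the joint law with respect to the product of the marginals
  let g : α × Y → ℝ := fun q => ∑ a, (if q.1 = x a then 1 else 0) * (f q.2 a / m q.2)
  have hgm : Measurable g := by
    refine Finset.measurable_sum _ fun a _ => Measurable.mul ?_ ?_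
    · exact Measurable.ite (measurable_fst (measurableSet_singleton (x a))) measurable_const
        measurable_const
    · exact ((h.measurable_apply a).comp measurable_snd).div (hmm.comp measurable_snd)
  have hgx : ∀ a y, g (x a, y) = f y a / m y := fun a y => by
    simp only [g]
    rw [Finset.sum_eq_single a]
    · simp
    · intro b _ hb
      rw [if_neg fun hab => hb (hx hab).symm, zero_mul]
    · simp
  -- All weights are positive, so division by zero happens only where the joint density vanishes
  -- too.
  have hfm : ∀ y a, m y = 0 → f y a = 0 := fun y a h0 => by
    have := (Finset.sum_eq_zero_iff_of_nonneg
      fun b _ => mul_nonneg (hw b).le (h.nonneg y b)).1 h0 a (Finset.mem_univ a)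
    exact (mul_eq_zero.1 this).resolve_left (hw a).ne'
  have hsf : SFinite ρ.snd := inferInstance
  have hdens : ρ = (ρ.fst.prod ρ.snd).withDensity fun q => ENNReal.ofReal (g q) := by
    ext s hs
    have hρs : ρ s = ∑ a, ENNReal.ofReal (w a) * κ a (Prod.mk (x a) ⁻¹' s) := by
      rw [hρ, mixtureLaw, Measure.finsetSum_apply]
      refine Finset.sum_congr rfl fun a _ => ?_
      rw [Measure.smul_apply, smul_eq_mul, Measure.dirac_prod,
        Measure.map_apply measurable_prodMk_left hs]
    rw [hρs, withDensity_apply _ hs, ← lintegral_indicator hs]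
    conv_rhs => rw [hfst]
    rw [lintegral_sum_smul_dirac_prod _ _ _ (hgm.ennreal_ofReal.indicator hs)]
    refine Finset.sum_congr rfl fun a _ => ?_
    have hk : Measurable fun y => s.indicator (fun q => ENNReal.ofReal (g q)) (x a, y) :=
      (hgm.ennreal_ofReal.indicator hs).comp measurable_prodMk_left
    rw [hsnd, h.eq, withDensity_apply _ (measurable_prodMk_left hs), ← lintegral_indicator
        (measurable_prodMk_left hs),
        lintegral_withDensity_eq_lintegral_mul _ hmm.ennreal_ofReal hk]
    congr 1
    refine lintegral_congr fun y => ?_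
    simp only [Pi.mul_apply]
    by_cases hy : (x a, y) ∈ s
    · rw [Set.indicator_of_mem (show y ∈ Prod.mk (x a) ⁻¹' s from hy), Set.indicator_of_mem hy, hgx,
        ← ENNReal.ofReal_mul (hm0 y)]
      congr 1
      by_cases h0 : m y = 0
      · rw [h0, hfm y a h0, zero_mul]
      · field_simp
    · rw [Set.indicator_of_notMem (show y ∉ Prod.mk (x a) ⁻¹' s from hy),
        Set.indicator_of_notMem hy, mul_zero]
  have hac : ρ ≪ ρ.fst.prod ρ.snd := by
    rw [hdens]
    conv_rhs => rw [← hdens]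
    exact withDensity_absolutelyContinuous _ _
  have hrn : ρ.rnDeriv (ρ.fst.prod ρ.snd) =ᵐ[ρ.fst.prod ρ.snd] fun q => ENNReal.ofReal (g q) := by
    have := Measure.rnDeriv_withDensity (ρ.fst.prod ρ.snd) hgm.ennreal_ofReal
    rwa [← hdens] at this
  have hg0 : ∀ q, 0 ≤ g q := fun q => Finset.sum_nonneg fun a _ =>
    mul_nonneg (by split_ifs <;> norm_num) (div_nonneg (h.nonneg _ a) (hm0 _))
  have hklm : Measurable fun q => ENNReal.ofReal (InformationTheory.klFun (g q)) := by
    simp only [InformationTheory.klFun_apply]; fun_prop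
  have hch := h.isChannel
  have hL := LinearGrowth.linFun (fun a : ι => -Real.log (w a))
  have hη := LinearGrowth.coneEntropy (ι := ι)
  have hkl0 : ∀ y a, 0 ≤ w a * (InformationTheory.klFun (f y a / m y) * m y) := fun y a =>
    mul_nonneg (hw a).le (mul_nonneg
      (InformationTheory.klFun_nonneg (div_nonneg (h.nonneg y a) (hm0 y))) (hm0 y))
  unfold mutualInfo
  rw [InformationTheory.klDiv_eq_lintegral_klFun_of_ac hac]
  calc ∫⁻ q, ENNReal.ofReal (InformationTheory.klFun
        (ρ.rnDeriv (ρ.fst.prod ρ.snd) q).toReal) ∂(ρ.fst.prod ρ.snd)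
      = ∫⁻ q, ENNReal.ofReal (InformationTheory.klFun (g q)) ∂(ρ.fst.prod ρ.snd) := by
        refine lintegral_congr_ae ?_
        filter_upwards [hrn] with q hq
        rw [hq, ENNReal.toReal_ofReal (hg0 q)]
    _ = ∑ a, ENNReal.ofReal (w a) *
          ∫⁻ y, ENNReal.ofReal (InformationTheory.klFun (f y a / m y) * m y) ∂ν := by
        conv_lhs => rw [hfst]
        rw [lintegral_sum_smul_dirac_prod _ _ _ hklm]
        refine Finset.sum_congr rfl fun a _ => ?_
        have hk : Measurable fun y => ENNReal.ofReal (InformationTheory.klFun (g (x a, y))) :=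
          hklm.comp measurable_prodMk_left
        rw [hsnd, lintegral_withDensity_eq_lintegral_mul _ hmm.ennreal_ofReal hk]
        congr 1
        refine lintegral_congr fun y => ?_
        simp only [Pi.mul_apply, hgx]
        rw [← ENNReal.ofReal_mul (hm0 y), mul_comm]
    _ = ∫⁻ y, ENNReal.ofReal (linFun (fun a => -Real.log (w a)) (w * f y)
          - coneEntropy (w * f y)) ∂ν := by
        have e : ∀ y, ENNReal.ofReal (linFun (fun a => -Real.log (w a)) (w * f y)
            - coneEntropy (w * f y)) = ∑ a, ENNReal.ofReal (w a) *
              ENNReal.ofReal (InformationTheory.klFun (f y a / m y) * m y) := fun y => by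
          rw [← sum_mul_klFun hw hw1 (h.nonneg y),
            ENNReal.ofReal_sum_of_nonneg fun a _ => hkl0 y a]
          exact Finset.sum_congr rfl fun a _ => ENNReal.ofReal_mul (hw a).le
        have hmeas : ∀ a, Measurable fun y =>
            ENNReal.ofReal (InformationTheory.klFun (f y a / m y) * m y) := fun a => by
          have := h.measurable_apply a
          simp only [InformationTheory.klFun_apply]; fun_prop
        simp only [e]
        rw [lintegral_finsetSum _ fun a _ => (hmeas a).const_mul _]
        exact Finset.sum_congr rfl fun a _ => (lintegral_const_mul _ (hmeas a)).symm
    _ = ENNReal.ofReal (∫ y, (linFun (fun a => -Real.log (w a)) (w * f y)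
          - coneEntropy (w * f y)) ∂ν) := by
        have hint : Integrable (fun y => linFun (fun a => -Real.log (w a)) (w * f y)
          - coneEntropy (w * f y)) ν := hch.integrable_comp (hL.sub hη) hw0
        rw [ofReal_integral_eq_lintegral_ofReal hint]
        refine Eventually.of_forall fun y => ?_
        simp only [Pi.zero_apply]
        rw [← sum_mul_klFun hw hw1 (h.nonneg y)]
        exact Finset.sum_nonneg fun a _ => hkl0 y a
    _ = _ := by
        congr 1
        have := chan_sub hch hL hη hw0
        rw [chan_linFun hch] at this
        refine Eq.trans this ?_
        congr 1
        simp [linFun, Real.negMulLog]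

end CommunityDetection

end

-- Densities of the observations, and tensorisation over nodes.

noncomputable section

namespace CommunityDetection

/-! ### Densities of the conditional laws of the model -/

theorem gaussianReal_eq_withDensity (c : ℝ) : gaussianReal c 1
    = (gaussianReal 0 1).withDensity fun z => ENNReal.ofReal (Real.exp (c * z - c * c / 2)) := by
  rw [gaussianReal_of_var_ne_zero _ one_ne_zero, gaussianReal_of_var_ne_zero _ one_ne_zero,
    ← withDensity_mul _ (measurable_gaussianPDF 0 1) (by fun_prop)]
  congr 1
  ext z
  rw [Pi.mul_apply, gaussianPDF, gaussianPDF, ← ENNReal.ofReal_mul (gaussianPDFReal_nonneg _ _ _),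
    gaussianPDFReal, gaussianPDFReal, mul_assoc (_⁻¹), ← Real.exp_add]
  congr 3
  simp only [NNReal.coe_one]
  ring

theorem stdGauss_map_const_add {κ : Type*} [Fintype κ] (u : κ → ℝ) :
    (stdGauss κ).map (fun z => u + z)
      = (stdGauss κ).withDensity fun z => ENNReal.ofReal (Real.exp (u ⬝ᵥ z - u ⬝ᵥ u / 2)) := by
  have h1 : (stdGauss κ).map (fun z => u + z) = Measure.pi fun j => gaussianReal (u j) 1 := by
    have h : ∀ j, (gaussianReal 0 1).map (fun z => u j + z) = gaussianReal (u j) 1 := fun j => by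
      rw [gaussianReal_map_const_add, zero_add]
    have := Measure.pi_map_pi (μ := fun _ : κ => gaussianReal 0 1)
      (f := fun j z => u j + z) (hμ := fun j => by rw [h]; infer_instance)
      (fun j => by fun_prop)
    simp only [h] at this
    exact this
  rw [h1, pi_withDensity (fun _ : κ => gaussianReal 0 1) (fun j => gaussianReal (u j) 1)
    (fun j z => Real.exp (u j * z - u j * u j / 2)) (fun j => by fun_prop)
    (fun j z => (Real.exp_pos _).le) (fun j => gaussianReal_eq_withDensity (u j))]
  congr 1
  ext z
  rw [← Real.exp_sum, Finset.sum_sub_distrib, ← Finset.sum_div]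
  rfl

section GaussianChannel

variable {m : ℕ} {ι : Type*} [Fintype ι]

instance (S : Matrix (Fin m) (Fin m) ℝ) (x : Fin m → ℝ) :
    IsProbabilityMeasure (gaussianChannel S x) :=
  Measure.isProbabilityMeasure_map (by fun_prop)

theorem hasDensities_gaussianChannel (S : Matrix (Fin m) (Fin m) ℝ) (x : ι → Fin m → ℝ) :
    HasDensities (fun a => gaussianChannel S (x a)) (stdGauss (Fin m))
      (gaussDensity fun a => (CFC.sqrt S).mulVec (x a)) where
  measurable := (isChannel_gaussDensity _).measurable
  nonneg := (isChannel_gaussDensity (ι := ι) _).nonneg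
  eq a := stdGauss_map_const_add _

end GaussianChannel

/-- Finitely many probability laws have densities with respect to a mixture of all of them. -/
theorem exists_hasDensities {k : ℕ} {𝒴 : Type*} [MeasurableSpace 𝒴] {p : Fin k → ℝ}
    (hp : ∀ a, 0 < p a) (hp1 : ∑ a, p a = 1) (Q : Fin k → Measure 𝒴)
    [∀ a, IsProbabilityMeasure (Q a)] :
    ∃ (ν : Measure 𝒴) (f : 𝒴 → Fin k → ℝ), IsProbabilityMeasure ν ∧ HasDensities Q ν f := by
  have hwE : ∑ a, ENNReal.ofReal (p a) = 1 := by
    rw [← ENNReal.ofReal_sum_of_nonneg fun _ _ => (hp _).le, hp1, ENNReal.ofReal_one]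
  -- The marginal law of an observation; positivity of every `p a` makes it dominate every `Q a`.
  set ν := ∑ a, ENNReal.ofReal (p a) • Q a with hν
  have hprob : IsProbabilityMeasure ν := ⟨by
    rw [hν, Measure.finsetSum_apply]; simp [hwE]⟩
  have hac : ∀ a, Q a ≪ ν := fun a => by
    refine Measure.AbsolutelyContinuous.mk fun s _ hs => ?_
    rw [hν, Measure.finsetSum_apply, Finset.sum_eq_zero_iff] at hs
    have := hs a (Finset.mem_univ a)
    rw [Measure.smul_apply, smul_eq_mul, mul_eq_zero] at this
    exact this.resolve_left (by simpa using hp a)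
  refine ⟨ν, fun y a => ((Q a).rnDeriv ν y).toReal, hprob, ?_, fun y a => ENNReal.toReal_nonneg,
    fun a => ?_⟩
  · exact measurable_pi_lambda _ fun a => (Measure.measurable_rnDeriv _ _).ennreal_toReal
  · have : (fun y => ENNReal.ofReal ((Q a).rnDeriv ν y).toReal) =ᵐ[ν] (Q a).rnDeriv ν := by
      filter_upwards [Measure.rnDeriv_lt_top (Q a) ν] with y hy
      exact ENNReal.ofReal_toReal hy.ne
    rw [withDensity_congr_ae this, Measure.withDensity_rnDeriv_eq _ _ (hac a)]

theorem HasDensities.pi {I ι' Z : Type*} [Fintype I] [Fintype ι'] [MeasurableSpace Z]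
    {κ : ι' → Measure Z} [∀ b, IsProbabilityMeasure (κ b)] {ν : Measure Z}
    [IsProbabilityMeasure ν] {f : Z → ι' → ℝ} (h : HasDensities κ ν f) :
    HasDensities (fun a : I → ι' => Measure.pi fun i => κ (a i)) (Measure.pi fun _ => ν)
      (fun z a => ∏ i, f (z i) (a i)) where
  measurable := measurable_pi_lambda _ fun a => Finset.measurable_prod _ fun i _ =>
    (h.measurable_apply (a i)).comp (measurable_pi_apply i)
  nonneg _ := fun _ => Finset.prod_nonneg fun _ _ => h.nonneg _ _
  eq a := pi_withDensity (fun _ => ν) (fun i => κ (a i)) (fun i z => f z (a i))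
    (fun _ => h.measurable_apply _) (fun _ _ => h.nonneg _ _) (fun _ => h.eq _)

/-! ### Edges -/

theorem coe_toNNReal_eq_ofReal (p : unitInterval) :
    ((unitInterval.toNNReal p : NNReal) : ℝ≥0∞) = ENNReal.ofReal p := by
  rw [ENNReal.ofReal]
  congr 1
  ext
  rw [Real.coe_toNNReal _ p.2.1]; rfl

theorem bernoulliMeasure_eq_withDensity {δ q : unitInterval} {r : Bool → ℝ}
    (h1 : (q : ℝ) = δ * r true) (h0 : 1 - (q : ℝ) = (1 - δ) * r false) :
    bernoulliMeasure true false q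
      = (bernoulliMeasure true false δ).withDensity fun b => ENNReal.ofReal (r b) := by
  have hδ0 : (0 : ℝ) ≤ δ := δ.2.1
  have hδ1 : (0 : ℝ) ≤ 1 - δ := by linarith [δ.2.2]
  have hs : ∀ p : unitInterval, ((unitInterval.symm p : unitInterval) : ℝ) = 1 - p := fun p => rfl
  refine Measure.ext_of_singleton fun b => ?_
  rw [withDensity_apply _ (measurableSet_singleton b), lintegral_singleton]
  cases b
  · rw [bernoulliMeasure_apply q (measurableSet_singleton _),
      bernoulliMeasure_apply δ (measurableSet_singleton _)]
    simp only [Set.mem_singleton_iff, Bool.true_eq_false, if_false, if_true,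
      coe_toNNReal_eq_ofReal, hs]
    rw [h0, ENNReal.ofReal_mul hδ1, mul_comm]
  · rw [bernoulliMeasure_apply q (measurableSet_singleton _),
      bernoulliMeasure_apply δ (measurableSet_singleton _)]
    simp only [Set.mem_singleton_iff, Bool.false_eq_true, if_false, if_true,
      coe_toNNReal_eq_ofReal]
    rw [h1, ENNReal.ofReal_mul hδ0, mul_comm]

/-- The standardised indicator of an edge, scaled by `1 / √n`, in a graph of reference edge
probability `d / n`. -/
def edgeScore (n : ℕ) (d : ℝ) (b : Bool) : ℝ :=
  if b then √(d * (1 - d / n)) / d else -(√(d * (1 - d / n)) / (n - d))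

section EdgeScore

variable {n : ℕ} {d : ℝ}

theorem edgeScore_true_sq_le (hd : 0 < d) (hdn : d < n) : edgeScore n d true ^ 2 ≤ 1 / d := by
  have hn : (0 : ℝ) < n := hd.trans hdn
  have h1 : 0 ≤ 1 - d / n := by rw [sub_nonneg, div_le_one hn]; exact hdn.le
  have h2 : 0 ≤ d / n := by positivity
  simp only [edgeScore, if_true, div_pow]
  rw [Real.sq_sqrt (by positivity), div_le_div_iff₀ (by positivity) hd]
  nlinarith [mul_nonneg h2 (sq_nonneg d)]

theorem edgeScore_false_sq_le (hd : 0 < d) (hdn : d < n) :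
    edgeScore n d false ^ 2 ≤ 1 / (n - d) := by
  have hn : (0 : ℝ) < n := hd.trans hdn
  have hnd : 0 < n - d := by linarith
  have h1 : 1 - d / n = (n - d) / n := by field_simp
  simp only [edgeScore, Bool.false_eq_true, if_false, neg_sq, div_pow, h1]
  rw [Real.sq_sqrt (by positivity), div_le_div_iff₀ (by positivity) hnd, one_mul]
  have : d / n ≤ 1 := by rw [div_le_one hn]; exact hdn.le
  calc d * ((n - d) / n) * (n - d) = d / n * (n - d) ^ 2 := by ring
    _ ≤ 1 * (n - d) ^ 2 := by gcongr
    _ = _ := one_mul _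

/-- Together with the identity for the absent edge: against the reference probability `d / n`, the
likelihood ratio of both outcomes is affine in `xᵀ R y`, with slope `edgeScore`. -/
theorem edgeProb_eq {m : ℕ} (hd : 0 < d) (hdn : d < n) (R : Matrix (Fin m) (Fin m) ℝ)
    (x y : Fin m → ℝ) :
    edgeProb n d R x y = d / n * (1 + x ⬝ᵥ R.mulVec y * edgeScore n d true) := by
  have hn : (0 : ℝ) < n := hd.trans hdn
  simp only [edgeProb, edgeScore, if_true]
  field_simp

theorem one_sub_edgeProb_eq {m : ℕ} (hd : 0 < d) (hdn : d < n) (R : Matrix (Fin m) (Fin m) ℝ)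
    (x y : Fin m → ℝ) :
    1 - edgeProb n d R x y = (1 - d / n) * (1 + x ⬝ᵥ R.mulVec y * edgeScore n d false) := by
  have hn : (0 : ℝ) < n := hd.trans hdn
  have hnd : (n : ℝ) - d ≠ 0 := by linarith
  have h1 : 1 - d / n = (n - d) / n := by field_simp
  simp only [edgeProb, edgeScore, Bool.false_eq_true, if_false]
  have e : (1 - d / n) * (1 + x ⬝ᵥ R.mulVec y * -(√(d * (1 - d / n)) / (n - d)))
      = (1 - d / n) - √(d * (1 - d / n)) * (x ⬝ᵥ R.mulVec y) * ((1 - d / n) / (n - d)) := by ring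
  have e2 : (1 - d / n) / (n - d) = 1 / n := by rw [h1]; field_simp
  rw [e, e2]; ring

/-- The score is centred because the reference weights times the two values are `±√(d (1 - d/n)) /
n`. Its variance `1/n` is the same for every degree `d`, so all networks share one `s` in the
interpolation. -/
theorem isWeakEdge_edgeScore {ι : Type*} {δ : unitInterval} {θ : ι → ℝ} {ε Θ : ℝ} (hd : 0 < d)
    (hdn : d < n) (hδ : (δ : ℝ) = d / n) (hε : 0 ≤ ε) (hε1 : 1 / d ≤ ε ^ 2)
    (hε2 : 1 / (n - d) ≤ ε ^ 2) (hΘ : 0 ≤ Θ) (hθ : ∀ a, |θ a| ≤ Θ) (hsmall : Θ * ε ≤ 1 / 2) :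
    IsWeakEdge (bernoulliMeasure true false δ) (edgeScore n d) θ (1 / n) ε Θ := by
  have hn : (0 : ℝ) < n := hd.trans hdn
  have hnd : (0 : ℝ) < n - d := by linarith
  have h1 : 1 - d / n = (n - d) / n := by field_simp
  have hq : √(d * ((n - d) / n)) ^ 2 = d * ((n - d) / n) := Real.sq_sqrt (by positivity)
  refine ⟨?_, ?_, fun b => ?_, hθ, hΘ, hsmall⟩
  · rw [integral_bernoulliMeasure, hδ]
    simp only [edgeScore, if_true, Bool.false_eq_true, if_false, smul_eq_mul, h1]
    field_simp
    ring
  · rw [integral_bernoulliMeasure, hδ]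
    simp only [edgeScore, if_true, Bool.false_eq_true, if_false, smul_eq_mul, h1, neg_sq, div_pow,
      hq]
    field_simp
    ring
  · refine abs_le_of_sq_le_sq ?_ hε
    cases b
    · exact (edgeScore_false_sq_le hd hdn).trans hε2
    · exact (edgeScore_true_sq_le hd hdn).trans hε1

end EdgeScore

/-! ### Rearranging product spaces -/

theorem pi_pi_map_uncurry {I J Z : Type*} [Fintype I] [Fintype J] [MeasurableSpace Z]
    (μ : I → J → Measure Z) [∀ i j, IsProbabilityMeasure (μ i j)] :
    (Measure.pi fun i => Measure.pi fun j => μ i j).map (fun z (p : I × J) => z p.1 p.2)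
      = Measure.pi fun p : I × J => μ p.1 p.2 := by
  have hm : Measurable fun (z : I → J → Z) (p : I × J) => z p.1 p.2 :=
    measurable_pi_lambda _ fun p => (measurable_pi_apply p.2).comp (measurable_pi_apply p.1)
  refine (Measure.pi_eq fun s hs => ?_).symm
  rw [Measure.map_apply hm (MeasurableSet.univ_pi hs)]
  have : (fun (z : I → J → Z) (p : I × J) => z p.1 p.2) ⁻¹' Set.univ.pi s
      = Set.univ.pi fun i => Set.univ.pi fun j => s (i, j) := by
    ext z; simp [Set.mem_pi]
  rw [this, Measure.pi_pi]
  simp only [Measure.pi_pi]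
  rw [Fintype.prod_prod_type]

theorem pi_map_curry {I J Z : Type*} [Fintype I] [Fintype J] [MeasurableSpace Z]
    (μ : I → J → Measure Z) [∀ i j, IsProbabilityMeasure (μ i j)] :
    (Measure.pi fun p : I × J => μ p.1 p.2).map (fun z i j => z (i, j))
      = Measure.pi fun i => Measure.pi fun j => μ i j := by
  have hm : Measurable fun (z : I → J → Z) (p : I × J) => z p.1 p.2 :=
    measurable_pi_lambda _ fun p => (measurable_pi_apply p.2).comp (measurable_pi_apply p.1)
  have hm' : Measurable fun (z : I × J → Z) i j => z (i, j) :=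
    measurable_pi_lambda _ fun i => measurable_pi_lambda _ fun j => measurable_pi_apply (i, j)
  rw [← pi_pi_map_uncurry μ, Measure.map_map hm' hm]
  exact Measure.map_id

/-- The node-wise Gaussian channel, as a single Gaussian channel. -/
theorem chan_pi_stdGauss {I κ ι' : Type*} [Fintype I] [Fintype κ] [Fintype ι'] [DecidableEq I]
    (c : ι' → κ → ℝ)
    {F : ((I → ι') → ℝ) → ℝ} (hF : LinearGrowth F) (v : (I → ι') → ℝ) :
    chan (Measure.pi fun _ : I => stdGauss κ) (fun z a => ∏ i, gaussDensity c (z i) (a i)) F v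
      = chan (stdGauss (I × κ)) (gaussDensity fun a q => c (a q.1) q.2) F v := by
  have hm : Measurable fun (z : I → κ → ℝ) (p : I × κ) => z p.1 p.2 :=
    measurable_pi_lambda _ fun p => (measurable_pi_apply p.2).comp (measurable_pi_apply p.1)
  have h1 : stdGauss (I × κ) = (Measure.pi fun _ : I => stdGauss κ).map
      (fun z (p : I × κ) => z p.1 p.2) :=
    (pi_pi_map_uncurry fun (_ : I) (_ : κ) => gaussianReal 0 1).symm
  rw [h1, chan_map hm (isChannel_gaussDensity _).measurable hF]
  unfold chan
  congr 1; ext z; congr 2; ext a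
  simp only [gaussDensity]
  rw [← Real.exp_sum, Finset.sum_sub_distrib, ← Finset.sum_div]
  simp only [dotProduct, Fintype.sum_prod_type]

theorem chan_prod_pi {I ι' Z Z' : Type*} [Fintype I] [DecidableEq I] [Fintype ι'] [MeasurableSpace Z]
    [MeasurableSpace Z'] {ν : Measure Z} [IsProbabilityMeasure ν] {ν' : Measure Z'}
    [IsProbabilityMeasure ν'] {f : Z → ι' → ℝ} {f' : Z' → ι' → ℝ} (hf : Measurable f)
    (hf' : Measurable f') {F : ((I → ι') → ℝ) → ℝ} (hF : LinearGrowth F) (v : (I → ι') → ℝ) :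
    chan ((Measure.pi fun _ : I => ν).prod (Measure.pi fun _ : I => ν'))
      (fun z => (fun a => ∏ i, f (z.1 i) (a i)) * fun a => ∏ i, f' (z.2 i) (a i)) F v
      = chan (Measure.pi fun _ : I => ν.prod ν')
        (fun z a => ∏ i, (f (z i).1 * f' (z i).2) (a i)) F v := by
  have hmp := measurePreserving_arrowProdEquivProdArrow Z Z' I (fun _ => ν) (fun _ => ν')
  rw [← hmp.map_eq, chan_map hmp.measurable ?_ hF]
  · unfold chan
    congr 1; ext z; congr 2; ext a
    simp only [Pi.mul_apply]
    rw [← Finset.prod_mul_distrib]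
    rfl
  · have h1 : ∀ b, Measurable fun y => f y b := fun b => (measurable_pi_apply b).comp hf
    have h2 : ∀ b, Measurable fun y => f' y b := fun b => (measurable_pi_apply b).comp hf'
    refine measurable_pi_lambda _ fun a => Measurable.mul ?_ ?_
    · exact Finset.measurable_prod _ fun i _ =>
        (h1 (a i)).comp ((measurable_pi_apply i).comp measurable_fst)
    · exact Finset.measurable_prod _ fun i _ =>
        (h2 (a i)).comp ((measurable_pi_apply i).comp measurable_snd)

/-! ### Additivity of the entropy over nodes -/

/-- The homogeneous form of additivity of entropy for independent coordinates: every coordinate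
other than `j` contributes its total mass. It comes from the product rule for `y log y`, which
remains valid at zero. -/
theorem coneEntropy_tensor {n k : ℕ} (u : Fin n → Fin k → ℝ) :
    coneEntropy (fun a : Fin n → Fin k => ∏ i, u i (a i))
      = ∑ j, ∏ i, if i = j then coneEntropy (u i) else ∑ b, u i b := by
  have hsum : ∀ G : Fin n → Fin k → ℝ,
      ∑ a : Fin n → Fin k, ∏ i, G i (a i) = ∏ i, ∑ b, G i b := fun G => by
    have := Finset.prod_univ_sum (fun _ : Fin n => (Finset.univ : Finset (Fin k))) G
    rw [Fintype.piFinset_univ] at this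
    exact this.symm
  have hlog : ∀ y : Fin n → ℝ, (∏ i, y i) * Real.log (∏ i, y i)
      = ∑ j, ∏ i, if i = j then y i * Real.log (y i) else y i := fun y => by
    have h1 : ∀ j, (∏ i, if i = j then y i * Real.log (y i) else y i)
        = (∏ i, y i) * Real.log (y j) := fun j => by
      rw [← Finset.mul_prod_erase Finset.univ _ (Finset.mem_univ j),
        ← Finset.mul_prod_erase Finset.univ y (Finset.mem_univ j), if_pos rfl]
      have : ∏ i ∈ Finset.univ.erase j, (if i = j then y i * Real.log (y i) else y i)
          = ∏ i ∈ Finset.univ.erase j, y i :=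
        Finset.prod_congr rfl fun i hi => if_neg (Finset.ne_of_mem_erase hi)
      rw [this]; ring
    simp only [h1]
    rw [← Finset.mul_sum]
    by_cases h0 : ∏ i, y i = 0
    · simp [h0]
    · rw [Real.log_prod fun i hi => fun hy => h0 (Finset.prod_eq_zero hi hy)]
  unfold coneEntropy
  rw [hsum, hlog]
  simp only [hlog]
  rw [Finset.sum_comm, ← Finset.sum_sub_distrib]
  refine Finset.sum_congr rfl fun j _ => ?_
  have h2 : ∑ a : Fin n → Fin k, (∏ i, if i = j then u i (a i) * Real.log (u i (a i))
      else u i (a i)) = ∏ i, ∑ b, if i = j then u i b * Real.log (u i b) else u i b :=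
    hsum fun i b => if i = j then u i b * Real.log (u i b) else u i b
  rw [h2, ← Finset.mul_prod_erase Finset.univ _ (Finset.mem_univ j),
    ← Finset.mul_prod_erase Finset.univ
      (fun i => ∑ b, if i = j then u i b * Real.log (u i b) else u i b) (Finset.mem_univ j),
    ← Finset.mul_prod_erase Finset.univ
      (fun i => if i = j then (∑ b, u i b) * Real.log (∑ b, u i b) - ∑ b, u i b * Real.log (u i b)
        else ∑ b, u i b) (Finset.mem_univ j)]
  have e : ∀ g h : Fin n → ℝ, (∀ i, i ≠ j → g i = h i) →
      ∏ i ∈ Finset.univ.erase j, g i = ∏ i ∈ Finset.univ.erase j, h i := fun g h hgh =>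
    Finset.prod_congr rfl fun i hi => hgh i (Finset.ne_of_mem_erase hi)
  rw [e _ (fun i => ∑ b, u i b) fun i hi => by rw [if_neg hi],
    e (fun i => ∑ b, if i = j then u i b * Real.log (u i b) else u i b) (fun i => ∑ b, u i b)
      fun i hi => by simp [hi],
    e (fun i => if i = j then _ else _) (fun i => ∑ b, u i b) fun i hi => by rw [if_neg hi]]
  simp only [if_true]
  ring

/-- In each term of `coneEntropy_tensor` all factors but one are masses, which integrate to one. -/
theorem chan_pi_coneEntropy {n k : ℕ} {Z : Type*} [MeasurableSpace Z] {ν : Measure Z}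
    [IsProbabilityMeasure ν] {f : Z → Fin k → ℝ} (hf : IsChannel ν f) {p : Fin k → ℝ}
    (hp : 0 ≤ p) (hp1 : ∑ b, p b = 1) :
    chan (Measure.pi fun _ : Fin n => ν) (fun z a => ∏ i, f (z i) (a i)) coneEntropy
      (fun a : Fin n → Fin k => ∏ i, p (a i)) = n * chan ν f coneEntropy p := by
  have hL := LinearGrowth.linFun (fun _ : Fin k => (1 : ℝ))
  have hη := LinearGrowth.coneEntropy (ι := Fin k)
  have e : ∀ z : Fin n → Z, coneEntropy ((fun a : Fin n → Fin k => ∏ i, p (a i))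
      * fun a => ∏ i, f (z i) (a i)) = ∑ j, ∏ i, (fun y => if i = j then coneEntropy (p * f y)
        else linFun (fun _ => 1) (p * f y)) (z i) := fun z => by
    have : ((fun a : Fin n → Fin k => ∏ i, p (a i)) * fun a => ∏ i, f (z i) (a i))
        = fun a : Fin n → Fin k => ∏ i, (p * f (z i)) (a i) := by
      ext a; simp only [Pi.mul_apply]; rw [Finset.prod_mul_distrib]
    rw [this, coneEntropy_tensor]
    simp [linFun]
  have hint : ∀ j i : Fin n, Integrable (fun y => if i = j then coneEntropy (p * f y)
        else linFun (fun _ => 1) (p * f y)) ν := fun j i => by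
    by_cases h : i = j
    · simpa only [h, if_true] using hf.integrable_comp hη hp
    · simpa only [h, if_false] using hf.integrable_comp hL hp
  unfold chan
  simp only [e]
  rw [integral_finsetSum _ fun j _ => Integrable.fintype_prod_dep (hint j)]
  have : ∀ j : Fin n, ∫ z : Fin n → Z, ∏ i, (fun y => if i = j then coneEntropy (p * f y)
        else linFun (fun _ => 1) (p * f y)) (z i) ∂Measure.pi (fun _ => ν)
      = ∫ y, coneEntropy (p * f y) ∂ν := fun j => by
    rw [integral_fintype_prod_eq_prod (μ := fun _ : Fin n => ν) (fun i y => if i = j then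
      coneEntropy (p * f y) else linFun (fun _ => 1) (p * f y)), Finset.prod_eq_single j]
    · simp
    · intro i _ hij
      simp only [hij, if_false]
      have := chan_linFun hf (fun _ => 1) p
      unfold chan at this
      rw [this]; simp [linFun, hp1]
    · simp
  simp [this]

end CommunityDetection

end

-- Whitened labels, networks and node-wise observations.

noncomputable section

namespace CommunityDetection

/-! ### Whitened labels -/

section Whitened

variable {k : ℕ} {p : Fin k → ℝ} {μ : Fin k → Fin (k - 1) → ℝ}

theorem IsWhitened.pos_card (hμ : IsWhitened p μ) : 0 < k := by
  rcases Nat.eq_zero_or_pos k with rfl | h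
  · simpa using hμ.sum_eq_one
  · exact h

/-- Append a constant coordinate to each label: `k` points in dimension `k - 1` become a square
matrix `A`. Whitening says that `Aᵀ diag(p)` is a left inverse of `A`, hence it is also a right
inverse. Positivity of `p` and distinctness of the labels follow. -/
theorem IsWhitened.one_add_dotProduct_mul (hμ : IsWhitened p μ) (a b : Fin k) :
    (1 + μ a ⬝ᵥ μ b) * p b = if a = b then 1 else 0 := by
  set A : Matrix (Fin k) (Unit ⊕ Fin (k - 1)) ℝ :=
    Matrix.of fun a => Sum.elim (fun _ => 1) (μ a) with hA
  have hmean : ∀ j, ∑ a, p a * μ a j = 0 := fun j => by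
    simpa using congrFun hμ.mean j
  have hcov : ∀ i j, ∑ a, p a * (μ a i * μ a j) = (1 : Matrix _ _ ℝ) i j := fun i j => by
    have := congrFun (congrFun hμ.cov i) j
    simpa [Matrix.sum_apply, Matrix.vecMulVec_apply] using this
  have h1 : (A.transpose * Matrix.diagonal p) * A = 1 := by
    ext i j
    rw [Matrix.mul_apply]
    simp only [Matrix.mul_diagonal, Matrix.transpose_apply]
    rcases i with i | i <;> rcases j with j | j
    · simpa [hA] using hμ.sum_eq_one
    · simpa [hA] using hmean j
    · simpa [hA, mul_comm] using hmean i
    · have := hcov i j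
      simp only [hA, Matrix.of_apply, Sum.elim_inr, Matrix.one_apply, Sum.inr.injEq] at this ⊢
      rw [← this]
      exact Finset.sum_congr rfl fun a _ => by ring
  have hcard : Fintype.card (Fin k) = Fintype.card (Unit ⊕ Fin (k - 1)) := by
    have := hμ.pos_card
    simp; omega
  have h2 : A * (A.transpose * Matrix.diagonal p) = 1 :=
    (Matrix.mul_eq_one_comm_of_card_eq _ _ _ hcard).2 h1
  have h3 := congrFun (congrFun h2 a) b
  rw [Matrix.mul_apply] at h3
  simp only [Matrix.mul_diagonal, Matrix.transpose_apply, Matrix.one_apply] at h3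
  rw [← h3, Fintype.sum_sum_type]
  simp only [hA, Matrix.of_apply, Sum.elim_inl, Sum.elim_inr, Finset.univ_unique, Finset.sum_singleton, one_mul,
    dotProduct, add_mul, Finset.sum_mul, mul_assoc]

theorem IsWhitened.pos (hμ : IsWhitened p μ) (a : Fin k) : 0 < p a := by
  refine (hμ.nonneg a).lt_of_ne fun h => ?_
  have := hμ.one_add_dotProduct_mul a a
  simp [← h] at this

theorem IsWhitened.injective (hμ : IsWhitened p μ) : Function.Injective μ := by
  intro a b hab
  by_contra hne
  have := hμ.one_add_dotProduct_mul a b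
  rw [if_neg hne, hab, mul_eq_zero] at this
  have h0 : 0 ≤ μ b ⬝ᵥ μ b := Finset.sum_nonneg fun j _ => mul_self_nonneg _
  rcases this with h | h
  · linarith
  · exact (hμ.pos b).ne' h

end Whitened

/-! ### The networks -/

section Network

variable {k L n m : ℕ}

/-- The adjacency matrices of `L` graphs, from the indicators of their edges. -/
def adjacencies (e : Fin L × OrderedPair n → Bool) : Fin L → Fin n → Fin n → Bool :=
  fun ℓ => adjacency fun q => e (ℓ, q)

/-- The edge indicators of `L` graphs. -/
def edges (G : Fin L → Fin n → Fin n → Bool) : Fin L × OrderedPair n → Bool :=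
  fun e => G e.1 e.2.1.1 e.2.1.2

theorem edges_adjacencies (e : Fin L × OrderedPair n → Bool) : edges (adjacencies e) = e := by
  ext ⟨ℓ, q⟩
  simp [edges, adjacencies, adjacency, q.2]

theorem pi_networkLaw (d : Fin L → ℝ) (R : Fin L → Matrix (Fin m) (Fin m) ℝ)
    (x : Fin n → Fin m → ℝ) :
    (Measure.pi fun ℓ => networkLaw n (d ℓ) (R ℓ) x)
      = (Measure.pi fun e : Fin L × OrderedPair n => bernoulliMeasure true false
          (Set.projIcc (0 : ℝ) 1 zero_le_one
            (edgeProb n (d e.1) (R e.1) (x e.2.1.1) (x e.2.1.2)))).map adjacencies := by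
  have h1 := pi_map_curry (fun (ℓ : Fin L) (q : OrderedPair n) => bernoulliMeasure true false
    (Set.projIcc (0 : ℝ) 1 zero_le_one (edgeProb n (d ℓ) (R ℓ) (x q.1.1) (x q.1.2))))
  have h2 := Measure.pi_map_pi
    (μ := fun ℓ : Fin L => Measure.pi fun q : OrderedPair n => bernoulliMeasure true false
      (Set.projIcc (0 : ℝ) 1 zero_le_one (edgeProb n (d ℓ) (R ℓ) (x q.1.1) (x q.1.2))))
    (f := fun _ => adjacency)
    (hμ := fun ℓ => by
      have := Measure.isProbabilityMeasure_map (μ := Measure.pi fun q : OrderedPair n =>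
        bernoulliMeasure true false (Set.projIcc (0 : ℝ) 1 zero_le_one
          (edgeProb n (d ℓ) (R ℓ) (x q.1.1) (x q.1.2))))
        (f := adjacency) (measurable_of_countable _).aemeasurable
      infer_instance)
    (fun ℓ => (measurable_of_countable _).aemeasurable)
  unfold networkLaw
  rw [← h2, ← h1, Measure.map_map (measurable_of_countable _) (measurable_of_countable _)]
  rfl

instance (d : ℝ) (R : Matrix (Fin m) (Fin m) ℝ) (x : Fin n → Fin m → ℝ) :
    IsProbabilityMeasure (networkLaw n d R x) :=
  Measure.isProbabilityMeasure_map (measurable_of_countable _).aemeasurable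

/-- The reference edge probability `d / n`. -/
def refProb (n : ℕ) (d : ℝ) : unitInterval := Set.projIcc (0 : ℝ) 1 zero_le_one (d / n)

/-- The coefficient of an edge as a function of the labels. -/
def edgeCoeff (μ : Fin k → Fin m → ℝ) (R : Fin L → Matrix (Fin m) (Fin m) ℝ)
    (e : Fin L × OrderedPair n) (a : Fin n → Fin k) : ℝ :=
  μ (a e.2.1.1) ⬝ᵥ (R e.1).mulVec (μ (a e.2.1.2))

variable {μ : Fin k → Fin m → ℝ} {R : Fin L → Matrix (Fin m) (Fin m) ℝ} {d : Fin L → ℝ}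
  {ε Θ : ℝ}

theorem isWeakEdge_edgeCoeff (hd : ∀ ℓ, 0 < d ℓ) (hdn : ∀ ℓ, d ℓ < n) (hε : 0 ≤ ε)
    (hε1 : ∀ ℓ, 1 / d ℓ ≤ ε ^ 2) (hε2 : ∀ ℓ, 1 / (n - d ℓ) ≤ ε ^ 2) (hΘ : 0 ≤ Θ)
    (hθ : ∀ ℓ a b, |μ a ⬝ᵥ (R ℓ).mulVec (μ b)| ≤ Θ) (hsmall : Θ * ε ≤ 1 / 2)
    (e : Fin L × OrderedPair n) :
    IsWeakEdge (bernoulliMeasure true false (refProb n (d e.1))) (edgeScore n (d e.1))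
      (edgeCoeff μ R e) (1 / n) ε Θ := by
  have hn : (0 : ℝ) < n := (hd e.1).trans (hdn e.1)
  refine isWeakEdge_edgeScore (hd _) (hdn _) ?_ hε (hε1 _) (hε2 _) hΘ (fun a => hθ _ _ _) hsmall
  rw [refProb, Set.projIcc_of_mem zero_le_one
    ⟨(div_pos (hd _) hn).le, (div_le_one hn).2 (hdn _).le⟩]

/-- The condition `Θ ε ≤ 1/2` keeps both likelihood ratios positive, so the edge probability lies in
`[0, 1]` and the truncation in `networkLaw` is inactive. -/
theorem hasDensities_networks (hd : ∀ ℓ, 0 < d ℓ) (hdn : ∀ ℓ, d ℓ < n) (hε : 0 ≤ ε)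
    (hε1 : ∀ ℓ, 1 / d ℓ ≤ ε ^ 2) (hε2 : ∀ ℓ, 1 / (n - d ℓ) ≤ ε ^ 2) (hΘ : 0 ≤ Θ)
    (hθ : ∀ ℓ a b, |μ a ⬝ᵥ (R ℓ).mulVec (μ b)| ≤ Θ) (hsmall : Θ * ε ≤ 1 / 2) :
    HasDensities
      (fun a : Fin n → Fin k => Measure.pi fun ℓ => networkLaw n (d ℓ) (R ℓ) fun i => μ (a i))
      ((Measure.pi fun e : Fin L × OrderedPair n =>
        bernoulliMeasure true false (refProb n (d e.1))).map adjacencies)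
      (fun G => revealDensity (edgeCoeff μ R) (fun e => edgeScore n (d e.1)) (fun _ => true)
        (edges G)) := by
  have hw := isWeakEdge_edgeCoeff (n := n) hd hdn hε hε1 hε2 hΘ hθ hsmall
  simp only [pi_networkLaw]
  refine HasDensities.map ?_ (measurable_of_countable _) (measurable_of_countable _)
    edges_adjacencies
  refine ⟨measurable_of_countable _, (isChannel_revealDensity hw _).nonneg, fun a => ?_⟩
  have hnn : ∀ (e : Fin L × OrderedPair n) b, 0 ≤ edgeDensity (edgeCoeff μ R e)
      (edgeScore n (d e.1)) b a := fun e b => (hw e).isChannel.nonneg b a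
  rw [pi_withDensity
    (fun e : Fin L × OrderedPair n => bernoulliMeasure true false (refProb n (d e.1))) _
    (fun e b => edgeDensity (edgeCoeff μ R e) (edgeScore n (d e.1)) b a)
    (fun e => measurable_of_countable _) hnn fun e => ?_]
  · simp [revealDensity]
  · have hn : (0 : ℝ) < n := (hd e.1).trans (hdn e.1)
    have hδ : ((refProb n (d e.1) : unitInterval) : ℝ) = d e.1 / n := by
      rw [refProb, Set.projIcc_of_mem zero_le_one
        ⟨(div_pos (hd _) hn).le, (div_le_one hn).2 (hdn _).le⟩]
    have h1 := edgeProb_eq (hd e.1) (hdn e.1) (R e.1) (μ (a e.2.1.1)) (μ (a e.2.1.2))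
    have h0 := one_sub_edgeProb_eq (hd e.1) (hdn e.1) (R e.1) (μ (a e.2.1.1)) (μ (a e.2.1.2))
    have hq0 : 0 ≤ edgeProb n (d e.1) (R e.1) (μ (a e.2.1.1)) (μ (a e.2.1.2)) := by
      rw [h1]; exact mul_nonneg (div_pos (hd _) hn).le (hnn e true)
    have hq1 : edgeProb n (d e.1) (R e.1) (μ (a e.2.1.1)) (μ (a e.2.1.2)) ≤ 1 := by
      rw [← sub_nonneg, h0]
      exact mul_nonneg (sub_nonneg.2 ((div_le_one hn).2 (hdn _).le)) (hnn e false)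
    refine bernoulliMeasure_eq_withDensity ?_ ?_
    · rw [Set.projIcc_of_mem zero_le_one ⟨hq0, hq1⟩, hδ]; exact h1
    · rw [Set.projIcc_of_mem zero_le_one ⟨hq0, hq1⟩, hδ]; exact h0

end Network

/-! ### The entropy of the labels left by the node-wise observations -/

section NodeWise

variable {k n m : ℕ} {𝒴 : Type*} [MeasurableSpace 𝒴] {ν : Measure 𝒴} [IsProbabilityMeasure ν]
  {f : 𝒴 → Fin k → ℝ}

/-- The conditional entropy of a label of law `p` given an observation through the channel `f` and
one through a Gaussian channel of strength `S`. -/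
def residualEntropy (ν : Measure 𝒴) (f : 𝒴 → Fin k → ℝ) (μ : Fin k → Fin m → ℝ)
    (S : Matrix (Fin m) (Fin m) ℝ) (p : Fin k → ℝ) : ℝ :=
  chan ν f (chan (stdGauss (Fin m)) (gaussDensity fun a => (CFC.sqrt S).mulVec (μ a)) coneEntropy) p

/-- The entropy of the labels given node-wise observations and a further Gaussian observation of all
nodes. -/
theorem chan_nodewise_gauss (hf : IsChannel ν f) {μ : Fin k → Fin m → ℝ}
    {S M : Matrix (Fin m) (Fin m) ℝ} (hS : S.PosSemidef) (hM : M.PosSemidef) {p : Fin k → ℝ}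
    (hp : 0 ≤ p) (hp1 : ∑ b, p b = 1) (hfn : IsChannel (Measure.pi fun _ : Fin n => ν)
      fun z (a : Fin n → Fin k) => ∏ i, f (z i) (a i)) :
    chan ((Measure.pi fun _ : Fin n => ν).prod (Measure.pi fun _ : Fin n => stdGauss (Fin m)))
      (fun z => (fun a : Fin n → Fin k => ∏ i, f (z.1 i) (a i)) * fun a : Fin n → Fin k =>
        ∏ i, gaussDensity (fun b => (CFC.sqrt S).mulVec (μ b)) (z.2 i) (a i))
      (chan (stdGauss (Fin n × Fin m)) (gaussDensity fun (a : Fin n → Fin k) q =>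
        (CFC.sqrt M).mulVec (μ (a q.1)) q.2) coneEntropy) (fun a => ∏ i, p (a i))
      = n * residualEntropy ν f μ (S + M) p := by
  have hw : (0 : (Fin n → Fin k) → ℝ) ≤ fun a => ∏ i, p (a i) :=
    fun a => Finset.prod_nonneg fun i _ => hp (a i)
  have hη := LinearGrowth.coneEntropy (ι := Fin n → Fin k)
  have hpi : ∀ T : Matrix (Fin m) (Fin m) ℝ, IsChannel
      (Measure.pi fun _ : Fin n => stdGauss (Fin m)) fun z (a : Fin n → Fin k) =>
        ∏ i, gaussDensity (fun b => (CFC.sqrt T).mulVec (μ b)) (z i) (a i) := fun T =>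
    (hasDensities_gaussianChannel T μ).pi.isChannel
  rw [← chan_chan hfn (hpi S) (LinearGrowth.chan (isChannel_gaussDensity _) hη) hw]
  -- Each family of node-wise Gaussian observations is flattened to one Gaussian channel; the Gram
  -- matrices of strengths `S` and `M` then add to that of `S + M`.
  have h1 : ∀ v : (Fin n → Fin k) → ℝ, 0 ≤ v →
      chan (Measure.pi fun _ : Fin n => stdGauss (Fin m)) (fun z (a : Fin n → Fin k) =>
        ∏ i, gaussDensity (fun b => (CFC.sqrt S).mulVec (μ b)) (z i) (a i))
        (chan (stdGauss (Fin n × Fin m)) (gaussDensity fun (a : Fin n → Fin k) q =>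
          (CFC.sqrt M).mulVec (μ (a q.1)) q.2) coneEntropy) v
      = chan (Measure.pi fun _ : Fin n => stdGauss (Fin m)) (fun z (a : Fin n → Fin k) =>
        ∏ i, gaussDensity (fun b => (CFC.sqrt (S + M)).mulVec (μ b)) (z i) (a i)) coneEntropy v := by
    intro v hv
    rw [chan_pi_stdGauss _ (LinearGrowth.chan (isChannel_gaussDensity _) hη),
      chan_pi_stdGauss _ hη]
    refine chan_gaussDensity_chan (fun a b => ?_) hη hv
    simp only [dotProduct, Fintype.sum_prod_type]
    rw [← Finset.sum_add_distrib]
    refine Finset.sum_congr rfl fun i _ => ?_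
    have := fun (T : Matrix (Fin m) (Fin m) ℝ) (hT : T.PosSemidef) =>
      sqrt_mulVec_dotProduct hT (μ (a i)) (μ (b i))
    have e := this _ (hS.add hM)
    rw [Matrix.add_mulVec, dotProduct_add, ← this _ hS, ← this _ hM] at e
    exact e
  rw [chan_congr hfn h1 hw, chan_chan hfn (hpi _) hη hw,
    chan_prod_pi hf.measurable (isChannel_gaussDensity _).measurable hη,
    chan_pi_coneEntropy (hf.prod (isChannel_gaussDensity _)) hp hp1, residualEntropy,
    chan_chan hf (isChannel_gaussDensity _) LinearGrowth.coneEntropy hp]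

end NodeWise

end CommunityDetection

end

-- The bound for a fixed number of nodes.

noncomputable section

namespace CommunityDetection

/-! ### The bound for a fixed number of nodes -/

section FixedSize

variable {k L n : ℕ} {𝒴 : Type*} [MeasurableSpace 𝒴] {ν : Measure 𝒴} [IsProbabilityMeasure ν]
  {f : 𝒴 → Fin k → ℝ} {p : Fin k → ℝ} {μ : Fin k → Fin (k - 1) → ℝ}
  {R : Fin L → Matrix (Fin (k - 1)) (Fin (k - 1)) ℝ} {Θ ε : ℝ}

theorem transpose_eq_of_posSemidef {m : ℕ} {V : Matrix (Fin m) (Fin m) ℝ} (hV : V.PosSemidef) :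
    V.transpose = V := by
  have := hV.isHermitian
  rwa [Matrix.IsHermitian, Matrix.conjTranspose_eq_transpose_of_trivial] at this

theorem posSemidef_sum_mul_mul {m : ℕ} {R : Fin L → Matrix (Fin m) (Fin m) ℝ}
    (hR : ∀ ℓ, (R ℓ).PosDef ∨ (-(R ℓ)).PosDef) {V : Matrix (Fin m) (Fin m) ℝ}
    (hV : V.PosSemidef) : (∑ ℓ, R ℓ * V * R ℓ).PosSemidef := by
  refine Matrix.posSemidef_sum _ fun ℓ _ => ?_
  have := hV.mul_mul_conjTranspose_same (R ℓ)
  rwa [Matrix.conjTranspose_eq_transpose_of_trivial, isSymm_of_definite (hR ℓ)] at this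

/-- The overlap defect of the Gaussian channel with respect to the networks. -/
theorem sum_sqMean_sub_le (hn : 0 < n) (hR : ∀ ℓ, (R ℓ).PosDef ∨ (-(R ℓ)).PosDef)
    (hθ : ∀ ℓ a b, |μ a ⬝ᵥ (R ℓ).mulVec (μ b)| ≤ Θ)
    {V : Matrix (Fin (k - 1)) (Fin (k - 1)) ℝ} (hV : V.PosSemidef)
    (v : (Fin n → Fin k) → ℝ) (hv : 0 ≤ v) :
    (∑ j : Fin n × Fin (k - 1), sqMean (fun a : Fin n → Fin k =>
        (CFC.sqrt (∑ ℓ, R ℓ * V * R ℓ)).mulVec (μ (a j.1)) j.2) v) / 2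
      - 1 / n / 2 * ∑ e : Fin L × OrderedPair n, sqMean (edgeCoeff μ R e) v
      ≤ (∑ ℓ, (n / 4 * (V * R ℓ * V * R ℓ).trace + Θ ^ 2 / 4)) * ∑ a, v a := by
  set M := ∑ ℓ, R ℓ * V * R ℓ with hM
  have hMp : M.PosSemidef := posSemidef_sum_mul_mul hR hV
  have hn' : (0 : ℝ) < n := Nat.cast_pos.2 hn
  set B := ∑ ℓ, (n / 4 * (V * R ℓ * V * R ℓ).trace + Θ ^ 2 / 4) with hB
  have h1 := sum_sum_dotProduct_div
    (fun (a : Fin n → Fin k) (j : Fin n × Fin (k - 1)) => (CFC.sqrt M).mulVec (μ (a j.1)) j.2) v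
  have h2 := sum_sum_dotProduct_div
    (fun (a : Fin n → Fin k) (e : Fin L × OrderedPair n) => edgeCoeff μ R e a) v
  -- By the two-replica identity both sums are averages over pairs of label assignments, so an
  -- inequality for each pair is enough.
  have hpair : ∀ a b : Fin n → Fin k,
      ((fun j : Fin n × Fin (k - 1) => (CFC.sqrt M).mulVec (μ (a j.1)) j.2) ⬝ᵥ
        fun j => (CFC.sqrt M).mulVec (μ (b j.1)) j.2) / 2
      - 1 / n / 2 * ((fun e : Fin L × OrderedPair n => edgeCoeff μ R e a) ⬝ᵥ
        fun e => edgeCoeff μ R e b) ≤ B := by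
    intro a b
    have e1 : ((fun j : Fin n × Fin (k - 1) => (CFC.sqrt M).mulVec (μ (a j.1)) j.2) ⬝ᵥ
        fun j => (CFC.sqrt M).mulVec (μ (b j.1)) j.2)
        = ∑ ℓ, ∑ i, μ (a i) ⬝ᵥ (R ℓ * V * R ℓ).mulVec (μ (b i)) := by
      simp only [dotProduct, Fintype.sum_prod_type]
      rw [Finset.sum_comm (s := (Finset.univ : Finset (Fin L)))]
      refine Finset.sum_congr rfl fun i _ => ?_
      refine (sqrt_mulVec_dotProduct hMp (μ (a i)) (μ (b i))).trans ?_
      rw [hM, Matrix.sum_mulVec, dotProduct_sum]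
      rfl
    have e2 : ((fun e : Fin L × OrderedPair n => edgeCoeff μ R e a) ⬝ᵥ
        fun e => edgeCoeff μ R e b)
        = ∑ ℓ, ∑ q : OrderedPair n, (μ (a q.1.1) ⬝ᵥ (R ℓ).mulVec (μ (a q.1.2)))
            * (μ (b q.1.1) ⬝ᵥ (R ℓ).mulVec (μ (b q.1.2))) := by
      simp only [dotProduct, Fintype.sum_prod_type, edgeCoeff]
    rw [e1, e2, Finset.sum_div, Finset.mul_sum, ← Finset.sum_sub_distrib]
    refine Finset.sum_le_sum fun ℓ _ => ?_
    have hsym : ∀ x y : Fin (k - 1) → ℝ, x ⬝ᵥ (R ℓ).mulVec y = y ⬝ᵥ (R ℓ).mulVec x :=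
      fun x y => by
        rw [Matrix.dotProduct_mulVec, ← Matrix.mulVec_transpose, isSymm_of_definite (hR ℓ),
          dotProduct_comm]
    have h3 := overlap_linearization_le hn (fun i => μ (a i)) (fun i => μ (b i)) (hR ℓ)
      (transpose_eq_of_posSemidef hV)
    have h4 := sum_sum_eq_two_mul_sum_orderedPair (fun i j : Fin n =>
      (μ (a i) ⬝ᵥ (R ℓ).mulVec (μ (a j))) * (μ (b i) ⬝ᵥ (R ℓ).mulVec (μ (b j))))
      fun i j => by rw [hsym (μ (a i)), hsym (μ (b i))]
    -- The overlap sums run over all `i, j`, but graphs have no loops; the diagonal costs `Θ² / 4`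
    -- per network, negligible against `n`.
    have h5 : ∑ i : Fin n, (μ (a i) ⬝ᵥ (R ℓ).mulVec (μ (a i)))
        * (μ (b i) ⬝ᵥ (R ℓ).mulVec (μ (b i))) ≤ n * Θ ^ 2 := by
      have : ∀ i ∈ (Finset.univ : Finset (Fin n)), (μ (a i) ⬝ᵥ (R ℓ).mulVec (μ (a i)))
        * (μ (b i) ⬝ᵥ (R ℓ).mulVec (μ (b i))) ≤ Θ ^ 2 := fun i _ => by
        refine (le_abs_self _).trans ?_
        rw [abs_mul, sq]
        exact mul_le_mul (hθ _ _ _) (hθ _ _ _) (abs_nonneg _) ((abs_nonneg _).trans (hθ ℓ (a i) (a i)))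
      simpa using Finset.sum_le_sum this
    rw [h4] at h3
    have h6 : 1 / (4 * n) * ∑ i : Fin n, (μ (a i) ⬝ᵥ (R ℓ).mulVec (μ (a i)))
        * (μ (b i) ⬝ᵥ (R ℓ).mulVec (μ (b i))) ≤ Θ ^ 2 / 4 := by
      calc _ ≤ 1 / (4 * n) * (n * Θ ^ 2) := by gcongr
        _ = _ := by field_simp
    have h7 : ∀ x y : ℝ, 1 / (4 * (n : ℝ)) * (2 * x + y) = 1 / n / 2 * x + 1 / (4 * n) * y := by
      intro x y; field_simp; ring
    rw [h7] at h3
    linarith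
  rw [← h1, ← h2]
  have hs : 0 ≤ ∑ a, v a := Finset.sum_nonneg fun a _ => hv a
  calc _ = (∑ a, ∑ b, v a * v b * (((fun j : Fin n × Fin (k - 1) =>
          (CFC.sqrt M).mulVec (μ (a j.1)) j.2) ⬝ᵥ
        fun j => (CFC.sqrt M).mulVec (μ (b j.1)) j.2) / 2
      - 1 / n / 2 * ((fun e : Fin L × OrderedPair n => edgeCoeff μ R e a) ⬝ᵥ
        fun e => edgeCoeff μ R e b))) / ∑ a, v a := by
        simp only [mul_sub, Finset.sum_sub_distrib, sub_div]
        congr 1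
        · rw [div_right_comm]
          simp only [Finset.sum_div, mul_div_assoc]
        · rw [← mul_div_assoc]
          congr 1
          simp only [Finset.mul_sum]
          exact Finset.sum_congr rfl fun a _ => Finset.sum_congr rfl fun b _ => by ring
    _ ≤ (∑ a, ∑ b, v a * v b * B) / ∑ a, v a := by
        refine div_le_div_of_nonneg_right ?_ hs
        exact Finset.sum_le_sum fun a _ => Finset.sum_le_sum fun b _ =>
          mul_le_mul_of_nonneg_left (hpair a b) (mul_nonneg (hv a) (hv b))
    _ = B * ((∑ a, v a) * (∑ a, v a) / ∑ a, v a) := by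
        simp only [← Finset.sum_mul, ← Finset.mul_sum]
        ring
    _ = _ := by
        rcases hs.eq_or_lt with h | h
        · rw [← h]; simp
        · rw [mul_div_assoc, div_self h.ne', mul_one]

theorem IsWhitened.sum_linFun_edgeCoeff_sq (hμ : IsWhitened p μ)
    (hR : ∀ ℓ, (R ℓ).PosDef ∨ (-(R ℓ)).PosDef) :
    ∑ e : Fin L × OrderedPair n, linFun (fun a => edgeCoeff μ R e a ^ 2)
        (fun a : Fin n → Fin k => ∏ i, p (a i))
      = Fintype.card (OrderedPair n) * ∑ ℓ, (R ℓ * R ℓ).trace := by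
  rw [Fintype.sum_prod_type, Finset.mul_sum]
  refine Finset.sum_congr rfl fun ℓ _ => ?_
  have : ∀ q : OrderedPair n, linFun (fun a => edgeCoeff μ R (ℓ, q) a ^ 2)
      (fun a : Fin n → Fin k => ∏ i, p (a i)) = (R ℓ * R ℓ).trace := fun q => by
    unfold linFun edgeCoeff
    rw [← hμ.sum_sum_mul_sq (isSymm_of_definite (hR ℓ))]
    exact sum_prod_mul_apply₂ hμ.sum_eq_one q.2.ne
      fun b b' => (μ b ⬝ᵥ (R ℓ).mulVec (μ b')) ^ 2
  simp [this]

theorem IsWhitened.linFun_sqrt_mulVec (hμ : IsWhitened p μ)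
    {M : Matrix (Fin (k - 1)) (Fin (k - 1)) ℝ} (hM : M.PosSemidef) :
    linFun (fun a => (fun j : Fin n × Fin (k - 1) => (CFC.sqrt M).mulVec (μ (a j.1)) j.2) ⬝ᵥ
        fun j => (CFC.sqrt M).mulVec (μ (a j.1)) j.2) (fun a : Fin n → Fin k => ∏ i, p (a i))
      = n * M.trace := by
  have e : ∀ a : Fin n → Fin k, ((fun j : Fin n × Fin (k - 1) =>
      (CFC.sqrt M).mulVec (μ (a j.1)) j.2) ⬝ᵥ fun j => (CFC.sqrt M).mulVec (μ (a j.1)) j.2)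
      = ∑ i, μ (a i) ⬝ᵥ M.mulVec (μ (a i)) := fun a => by
    simp only [dotProduct, Fintype.sum_prod_type]
    exact Finset.sum_congr rfl fun i _ => sqrt_mulVec_dotProduct hM (μ (a i)) (μ (a i))
  unfold linFun
  simp only [e, Finset.mul_sum]
  rw [Finset.sum_comm]
  have : ∀ i : Fin n, ∑ a : Fin n → Fin k, (∏ l, p (a l)) * (μ (a i) ⬝ᵥ M.mulVec (μ (a i)))
      = M.trace := fun i => by
    rw [sum_prod_mul_apply hμ.sum_eq_one i fun b => μ b ⬝ᵥ M.mulVec (μ b),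
      hμ.sum_mul_dotProduct_mulVec]
  simp [this]

/-- The three terms are the prior edge term, the prior Gaussian term and the bound from the
completed square; with `V = 1 - U` they recombine to the quadratic part of the potential. -/
theorem trace_potential {m : ℕ} (R V : Matrix (Fin m) (Fin m) ℝ) :
    ((R * (1 - V)) ^ 2).trace = (R * R).trace - 2 * (R * V * R).trace + (V * R * V * R).trace := by
  have h1 : (R * (1 - V)) ^ 2 = R * R - R * (R * V) - R * V * R + R * V * (R * V) := by
    noncomm_ring
  have h2 : (R * (R * V)).trace = (R * V * R).trace := Matrix.trace_mul_comm _ _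
  have h3 : (R * V * (R * V)).trace = (V * R * V * R).trace := by
    rw [Matrix.mul_assoc, Matrix.trace_mul_comm, ← Matrix.mul_assoc]
  rw [h1, Matrix.trace_add, Matrix.trace_sub, Matrix.trace_sub, h2, h3]
  ring

/-- The entropy left by the node-wise observations and the networks. -/
theorem le_chan_networks (hμ : IsWhitened p μ) (hn : 0 < n) {Q : Fin k → Measure 𝒴}
    [∀ a, IsProbabilityMeasure (Q a)] (hQ : HasDensities Q ν f)
    {S : Matrix (Fin (k - 1)) (Fin (k - 1)) ℝ} (hS : S.PosSemidef)
    (hR : ∀ ℓ, (R ℓ).PosDef ∨ (-(R ℓ)).PosDef)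
    {V : Matrix (Fin (k - 1)) (Fin (k - 1)) ℝ} (hV : V.PosSemidef) {d : Fin L → ℝ}
    (hd : ∀ ℓ, 0 < d ℓ) (hdn : ∀ ℓ, d ℓ < n) (hε : 0 ≤ ε)
    (hε1 : ∀ ℓ, 1 / d ℓ ≤ ε ^ 2) (hε2 : ∀ ℓ, 1 / (n - d ℓ) ≤ ε ^ 2) (hΘ : 0 ≤ Θ)
    (hθ : ∀ ℓ a b, |μ a ⬝ᵥ (R ℓ).mulVec (μ b)| ≤ Θ) (hsmall : Θ * ε ≤ 1 / 2) :
    n * residualEntropy ν f μ (S + ∑ ℓ, R ℓ * V * R ℓ) p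
      - n / 4 * ∑ ℓ, ((R ℓ * (1 - V)) ^ 2).trace - L * Θ ^ 2 / 4 - n * (L * (5 / 2 * Θ ^ 3 * ε))
    ≤ chan ((Measure.pi fun _ : Fin n => ν).prod (Measure.pi fun _ : Fin n => stdGauss (Fin (k - 1))))
      (fun z => (fun a : Fin n → Fin k => ∏ i, f (z.1 i) (a i)) * fun a : Fin n → Fin k =>
        ∏ i, gaussDensity (fun b => (CFC.sqrt S).mulVec (μ b)) (z.2 i) (a i))
      (chan (Measure.pi fun e : Fin L × OrderedPair n =>
          bernoulliMeasure true false (refProb n (d e.1)))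
        (revealDensity (edgeCoeff μ R) (fun e => edgeScore n (d e.1)) fun _ => true) coneEntropy)
      (fun a => ∏ i, p (a i)) := by
  set M := ∑ ℓ, R ℓ * V * R ℓ with hM
  have hMp : M.PosSemidef := posSemidef_sum_mul_mul hR hV
  have hn' : (0 : ℝ) < n := Nat.cast_pos.2 hn
  have hfn := (hQ.pi (I := Fin n)).isChannel
  have hgn := ((hasDensities_gaussianChannel S μ).pi (I := Fin n)).isChannel
  -- The base channel carries `Y` and `Ỹ`; the Gaussian channel to be traded for the graphs has
  -- strength `M` at each node.
  have hi := interpolation (hfn.prod hgn)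
    (isWeakEdge_edgeCoeff (n := n) (L := L) hd hdn hε hε1 hε2 hΘ hθ hsmall) (s := 1 / n)
    (c := fun (a : Fin n → Fin k) (q : Fin n × Fin (k - 1)) =>
      (CFC.sqrt M).mulVec (μ (a q.1)) q.2)
    (w := fun a => ∏ i, p (a i)) (by positivity)
    (fun a => Finset.prod_nonneg fun i _ => hμ.nonneg _) (sum_prod_eq_one hμ.sum_eq_one)
    (sum_sqMean_sub_le hn hR hθ hV)
  rw [chan_nodewise_gauss hQ.isChannel hS hMp hμ.nonneg hμ.sum_eq_one hfn,
    hμ.sum_linFun_edgeCoeff_sq hR, hμ.linFun_sqrt_mulVec hMp, Fintype.card_prod, Fintype.card_fin]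
    at hi
  have hcard : (Fintype.card (OrderedPair n) : ℝ) ≤ n ^ 2 / 2 := by
    have := two_mul_card_orderedPair n
    linarith
  have htr : 0 ≤ ∑ ℓ, (R ℓ * R ℓ).trace := Finset.sum_nonneg fun ℓ _ => by
    rw [← hμ.sum_sum_mul_sq (isSymm_of_definite (hR ℓ))]
    exact Finset.sum_nonneg fun b _ => Finset.sum_nonneg fun b' _ =>
      mul_nonneg (mul_nonneg (hμ.nonneg _) (hμ.nonneg _)) (sq_nonneg _)
  have t1 : 1 / (n : ℝ) / 2 * (Fintype.card (OrderedPair n) * ∑ ℓ, (R ℓ * R ℓ).trace)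
      ≤ n / 4 * ∑ ℓ, (R ℓ * R ℓ).trace := by
    calc _ ≤ 1 / (n : ℝ) / 2 * (n ^ 2 / 2 * ∑ ℓ, (R ℓ * R ℓ).trace) := by gcongr
      _ = _ := by field_simp; ring
  have t2 : ((L * Fintype.card (OrderedPair n) : ℕ) : ℝ) * (5 * Θ ^ 3 * ε * (1 / n))
      ≤ n * (L * (5 / 2 * Θ ^ 3 * ε)) := by
    push_cast
    calc _ ≤ (L * (n ^ 2 / 2)) * (5 * Θ ^ 3 * ε * (1 / n)) := by gcongr
      _ = _ := by field_simp
  have t3 : M.trace = ∑ ℓ, (R ℓ * V * R ℓ).trace := by rw [hM, Matrix.trace_sum]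
  have t4 : ∑ ℓ, (n / 4 * (V * R ℓ * V * R ℓ).trace + Θ ^ 2 / 4)
      = n / 4 * ∑ ℓ, (V * R ℓ * V * R ℓ).trace + L * Θ ^ 2 / 4 := by
    rw [Finset.sum_add_distrib, Finset.mul_sum]; simp; ring
  have t5 : ∑ ℓ, ((R ℓ * (1 - V)) ^ 2).trace = ∑ ℓ, (R ℓ * R ℓ).trace
      - 2 * ∑ ℓ, (R ℓ * V * R ℓ).trace + ∑ ℓ, (V * R ℓ * V * R ℓ).trace := by
    simp only [trace_potential, Finset.sum_add_distrib, Finset.sum_sub_distrib, Finset.mul_sum]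
  rw [t3, t4] at hi
  rw [t5]
  linarith

theorem sum_negMulLog_prod (hp1 : ∑ b, p b = 1) :
    ∑ a : Fin n → Fin k, Real.negMulLog (∏ i, p (a i)) = n * ∑ b, Real.negMulLog (p b) := by
  have h := coneEntropy_tensor fun _ : Fin n => p
  have e : ∀ {ι : Type} [Fintype ι] (w : ι → ℝ), ∑ a, w a = 1 →
      coneEntropy w = ∑ a, Real.negMulLog (w a) := fun w hw => by
    simp [coneEntropy, hw, Real.negMulLog, Finset.sum_neg_distrib]
  rw [← e _ (sum_prod_eq_one hp1), h, ← e p hp1]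
  simp [hp1, Finset.prod_ite_eq']

/-- The mutual information of the model with `n` nodes. -/
theorem mutualInfo_modelLaw_le (hμ : IsWhitened p μ) (hn : 0 < n) {Q : Fin k → Measure 𝒴}
    [∀ a, IsProbabilityMeasure (Q a)] (hQ : HasDensities Q ν f)
    {S : Matrix (Fin (k - 1)) (Fin (k - 1)) ℝ} (hS : S.PosSemidef)
    (hR : ∀ ℓ, (R ℓ).PosDef ∨ (-(R ℓ)).PosDef)
    {V : Matrix (Fin (k - 1)) (Fin (k - 1)) ℝ} (hV : V.PosSemidef) {d : Fin L → ℝ}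
    (hd : ∀ ℓ, 0 < d ℓ) (hdn : ∀ ℓ, d ℓ < n) (hε : 0 ≤ ε)
    (hε1 : ∀ ℓ, 1 / d ℓ ≤ ε ^ 2) (hε2 : ∀ ℓ, 1 / (n - d ℓ) ≤ ε ^ 2) (hΘ : 0 ≤ Θ)
    (hθ : ∀ ℓ a b, |μ a ⬝ᵥ (R ℓ).mulVec (μ b)| ≤ Θ) (hsmall : Θ * ε ≤ 1 / 2) :
    mutualInfo (modelLaw p μ Q S R n d) ≤ ENNReal.ofReal (n *
      (∑ b, Real.negMulLog (p b) - residualEntropy ν f μ (S + ∑ ℓ, R ℓ * V * R ℓ) p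
        + 1 / 4 * ∑ ℓ, ((R ℓ * (1 - V)) ^ 2).trace + L * Θ ^ 2 / 4 / n
        + L * (5 / 2 * Θ ^ 3 * ε))) := by
  have hn' : (0 : ℝ) < n := Nat.cast_pos.2 hn
  have hw : ∀ a : Fin n → Fin k, 0 < ∏ i, p (a i) := fun a => Finset.prod_pos fun i _ => hμ.pos _
  have hbase := (hQ.pi (I := Fin n)).prod ((hasDensities_gaussianChannel S μ).pi (I := Fin n))
  have hnet := hasDensities_networks (n := n) (L := L) hd hdn hε hε1 hε2 hΘ hθ hsmall
  have hprob : IsProbabilityMeasure ((Measure.pi fun e : Fin L × OrderedPair n =>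
      bernoulliMeasure true false (refProb n (d e.1))).map adjacencies) :=
    Measure.isProbabilityMeasure_map (measurable_of_countable _).aemeasurable
  have hinj : Function.Injective fun (a : Fin n → Fin k) i => μ (a i) := fun a b h =>
    funext fun i => hμ.injective (congrFun h i)
  rw [modelLaw, mutualInfo_mixtureLaw hw (sum_prod_eq_one hμ.sum_eq_one) hinj (hbase.prod hnet),
    sum_negMulLog_prod hμ.sum_eq_one]
  refine ENNReal.ofReal_le_ofReal ?_
  have hw0 : (0 : (Fin n → Fin k) → ℝ) ≤ fun a => ∏ i, p (a i) := fun a => (hw a).le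
  have hη := LinearGrowth.coneEntropy (ι := Fin n → Fin k)
  have hmap : ∀ v : (Fin n → Fin k) → ℝ, chan ((Measure.pi fun e : Fin L × OrderedPair n =>
      bernoulliMeasure true false (refProb n (d e.1))).map adjacencies)
      (fun G => revealDensity (edgeCoeff μ R) (fun e => edgeScore n (d e.1)) (fun _ => true)
        (edges G)) coneEntropy v
      = chan (Measure.pi fun e : Fin L × OrderedPair n =>
          bernoulliMeasure true false (refProb n (d e.1)))
        (revealDensity (edgeCoeff μ R) (fun e => edgeScore n (d e.1)) fun _ => true)
        coneEntropy v := fun v => by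
    rw [chan_map (measurable_of_countable _) (measurable_of_countable _) hη]
    simp only [edges_adjacencies]
  rw [← chan_chan hbase.isChannel hnet.isChannel hη hw0, funext hmap]
  have key := le_chan_networks hμ hn hQ hS hR hV hd hdn hε hε1 hε2 hΘ hθ hsmall
  have e : (n : ℝ) * (∑ b, Real.negMulLog (p b)
        - residualEntropy ν f μ (S + ∑ ℓ, R ℓ * V * R ℓ) p
        + 1 / 4 * ∑ ℓ, ((R ℓ * (1 - V)) ^ 2).trace + L * Θ ^ 2 / 4 / n
        + L * (5 / 2 * Θ ^ 3 * ε))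
      = n * ∑ b, Real.negMulLog (p b) - (n * residualEntropy ν f μ (S + ∑ ℓ, R ℓ * V * R ℓ) p
      - n / 4 * ∑ ℓ, ((R ℓ * (1 - V)) ^ 2).trace - L * Θ ^ 2 / 4
      - n * (L * (5 / 2 * Θ ^ 3 * ε))) := by
    field_simp; ring
  rw [e]
  exact sub_le_sub_left key _

end FixedSize

end CommunityDetection

end

-- Semicontinuity, existence of the minimum, and the limit.

noncomputable section

namespace CommunityDetection

/-! ### The residual entropy as a function of the strength of the Gaussian channel -/

section ResidualEntropy

variable {k m : ℕ} {𝒴 : Type*} [MeasurableSpace 𝒴] {ν : Measure 𝒴} [IsProbabilityMeasure ν]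
  {f : 𝒴 → Fin k → ℝ} {μ : Fin k → Fin m → ℝ} {S S' M : Matrix (Fin m) (Fin m) ℝ}
  {p : Fin k → ℝ}

theorem residualEntropy_add (hf : IsChannel ν f) (hS : S.PosSemidef) (hM : M.PosSemidef)
    (hp : 0 ≤ p) : residualEntropy ν f μ (S + M) p
      = chan ν f (chan (stdGauss (Fin m)) (gaussDensity fun a => (CFC.sqrt S).mulVec (μ a))
        (chan (stdGauss (Fin m)) (gaussDensity fun a => (CFC.sqrt M).mulVec (μ a))
          coneEntropy)) p := by
  refine chan_congr hf (fun v hv => (chan_gaussDensity_chan (fun a b => ?_)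
    LinearGrowth.coneEntropy hv).symm) hp
  rw [sqrt_mulVec_dotProduct (hS.add hM), sqrt_mulVec_dotProduct hS, sqrt_mulVec_dotProduct hM,
    Matrix.add_mulVec, dotProduct_add]

theorem residualEntropy_add_le (hf : IsChannel ν f) (hS : S.PosSemidef) (hM : M.PosSemidef)
    (hp : 0 ≤ p) : residualEntropy ν f μ (S + M) p ≤ residualEntropy ν f μ S p := by
  have hη := LinearGrowth.coneEntropy (ι := Fin k)
  have hη' := hη.chan (isChannel_gaussDensity fun a => (CFC.sqrt M).mulVec (μ a))
  rw [residualEntropy_add hf hS hM hp]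
  exact chan_mono hf (hη'.chan (isChannel_gaussDensity _)) (hη.chan (isChannel_gaussDensity _))
    (fun v hv => chan_mono (isChannel_gaussDensity _) hη' hη
      (fun v hv => chan_coneEntropy_le (isChannel_gaussDensity _) hv) hv) hp

/-- The converse of monotonicity: a weak additional Gaussian channel removes little entropy,
whatever was observed before. -/
theorem residualEntropy_le_add (hf : IsChannel ν f) (hS : S.PosSemidef) (hM : M.PosSemidef)
    (hp : 0 ≤ p) {x : ℝ} (hx : ∀ a, μ a ⬝ᵥ M.mulVec (μ a) ≤ x) (hx0 : 0 < x) (hx1 : 6 * x ≤ 1) :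
    residualEntropy ν f μ S p ≤ residualEntropy ν f μ (S + M) p + 24 * x * ∑ a, p a := by
  have hη := LinearGrowth.coneEntropy (ι := Fin k)
  have hl := (LinearGrowth.linFun fun _ : Fin k => (1 : ℝ)).const_smul (24 * x)
  have hM' := isChannel_gaussDensity fun a => (CFC.sqrt M).mulVec (μ a)
  have hS' := isChannel_gaussDensity fun a => (CFC.sqrt S).mulVec (μ a)
  have hη' := hη.chan hM'
  have h1 : chan ν f (chan (stdGauss (Fin m)) (gaussDensity fun a => (CFC.sqrt S).mulVec (μ a))
      (coneEntropy - (24 * x) • linFun fun _ => 1)) p ≤ residualEntropy ν f μ (S + M) p := by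
    rw [residualEntropy_add hf hS hM hp]
    refine chan_mono hf ((hη.sub hl).chan hS') (hη'.chan hS')
      (fun v hv => chan_mono hS' (hη.sub hl) hη' (fun v hv => ?_) hv) hp
    have := coneEntropy_le_chan_gaussDensity (fun a => (CFC.sqrt M).mulVec (μ a))
      (fun a => (sqrt_mulVec_dotProduct hM _ _).trans_le (hx a)) hx0 hx1 hv
    simpa [linFun] using this
  have h2 : chan ν f (chan (stdGauss (Fin m)) (gaussDensity fun a => (CFC.sqrt S).mulVec (μ a))
      (coneEntropy - (24 * x) • linFun fun _ => 1)) p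
      = residualEntropy ν f μ S p - 24 * x * ∑ a, p a := by
    have : ∀ v : Fin k → ℝ, 0 ≤ v → chan (stdGauss (Fin m))
        (gaussDensity fun a => (CFC.sqrt S).mulVec (μ a))
        (coneEntropy - (24 * x) • linFun fun _ => 1) v
        = (chan (stdGauss (Fin m)) (gaussDensity fun a => (CFC.sqrt S).mulVec (μ a)) coneEntropy
          - (24 * x) • linFun (fun _ : Fin k => (1 : ℝ)) : (Fin k → ℝ) → ℝ) v := fun v hv => by
      rw [chan_sub hS' hη hl hv, chan_smul, chan_linFun hS']
      rfl
    rw [chan_congr hf this hp, chan_sub hf (hη.chan hS') hl hp, chan_smul, chan_linFun hf]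
    simp [linFun, residualEntropy]
  linarith

/-- Each `|y_i A_ij y_j|` is at most `(x/m) (y_i² + y_j²) / 2`, and these bounds sum to `x |y|²`. It
turns entrywise closeness into comparison in the semidefinite order. -/
theorem posSemidef_add_smul_one {A : Matrix (Fin m) (Fin m) ℝ} (hA : A.transpose = A) {x : ℝ}
    (h : ∀ i j, |A i j| * m ≤ x) : (A + x • (1 : Matrix (Fin m) (Fin m) ℝ)).PosSemidef := by
  refine .of_dotProduct_mulVec_nonneg ?_ fun y => ?_
  · rw [Matrix.IsHermitian, Matrix.conjTranspose_eq_transpose_of_trivial, Matrix.transpose_add,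
      Matrix.transpose_smul, Matrix.transpose_one, hA]
  · rw [star_trivial, Matrix.add_mulVec, Matrix.smul_mulVec, Matrix.one_mulVec, dotProduct_add,
      dotProduct_smul, smul_eq_mul]
    rcases Nat.eq_zero_or_pos m with rfl | hm
    · simp [dotProduct]
    have hm' : (0 : ℝ) < m := Nat.cast_pos.2 hm
    have h1 : ∀ i j, -(x / m * ((y i * y i + y j * y j) / 2)) ≤ y i * (A i j * y j) := fun i j => by
      have h2 : |A i j| ≤ x / m := (le_div_iff₀ hm').2 (h i j)
      have h3 : |y i * (A i j * y j)| ≤ x / m * ((y i * y i + y j * y j) / 2) := by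
        rw [abs_mul, abs_mul]
        have h4 : |y i| * |y j| ≤ (y i * y i + y j * y j) / 2 := by
          rw [← abs_mul_abs_self (y i), ← abs_mul_abs_self (y j)]
          nlinarith [sq_nonneg (|y i| - |y j|)]
        calc |y i| * (|A i j| * |y j|) = |A i j| * (|y i| * |y j|) := by ring
          _ ≤ _ := mul_le_mul h2 h4 (by positivity) ((abs_nonneg _).trans h2)
      exact (abs_le.1 h3).1
    have h5 : ∑ i, ∑ j, -(x / m * ((y i * y i + y j * y j) / 2)) ≤ y ⬝ᵥ A.mulVec y := by
      simp only [dotProduct, Matrix.mulVec, Finset.mul_sum]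
      exact Finset.sum_le_sum fun i _ => Finset.sum_le_sum fun j _ => h1 i j
    have h6 : ∑ i, ∑ j, -(x / m * ((y i * y i + y j * y j) / 2)) = -(x * (y ⬝ᵥ y)) := by
      simp only [Finset.sum_neg_distrib, ← Finset.mul_sum, ← Finset.sum_div,
        Finset.sum_add_distrib, Finset.sum_const, Finset.card_univ, Fintype.card_fin, nsmul_eq_mul,
        dotProduct]
      field_simp
      simp only [← Finset.mul_sum]
      ring
    linarith

theorem isClosed_posSemidef : IsClosed {A : Matrix (Fin m) (Fin m) ℝ | A.PosSemidef} := by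
  simp only [Matrix.posSemidef_iff_dotProduct_mulVec, Set.ofPred_and, Set.ofPred_forall]
  refine IsClosed.inter (isClosed_eq (by fun_prop) continuous_id) (isClosed_iInter fun y => ?_)
  exact isClosed_le continuous_const (by fun_prop)

/-- Upper semicontinuity. For `S'` near `S` one has `S ⪯ S' + x I`, so the entropy at `S' + x I` is
at most that at `S`, while passing from `S'` to `S' + x I` removes only `O(x)`. -/
theorem eventually_residualEntropy_lt (hf : IsChannel ν f) (hp : 0 ≤ p)
    (hS : S.PosSemidef) {y : ℝ} (hy : residualEntropy ν f μ S p < y) :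
    ∀ᶠ S' in 𝓝[{A | A.PosSemidef}] S, residualEntropy ν f μ S' p < y := by
  set K : ℝ := ∑ a, μ a ⬝ᵥ μ a + 1 with hK
  have hdd : ∀ a, 0 ≤ μ a ⬝ᵥ μ a := fun a => Finset.sum_nonneg fun j _ => mul_self_nonneg _
  have hKa : ∀ a, μ a ⬝ᵥ μ a ≤ K := fun a =>
    (Finset.single_le_sum (fun a _ => hdd a) (Finset.mem_univ a)).trans (by simp [hK])
  have hK0 : 0 < K := add_pos_of_nonneg_of_pos (Finset.sum_nonneg fun a _ => hdd a) one_pos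
  have hs : 0 ≤ ∑ a, p a := Finset.sum_nonneg fun a _ => hp a
  obtain ⟨x, hx0, hx1, hx2⟩ : ∃ x : ℝ, 0 < x ∧ 6 * (x * K) ≤ 1 ∧
      residualEntropy ν f μ S p + 24 * (x * K) * ∑ a, p a < y := by
    have h1 : Tendsto (fun x : ℝ => 6 * (x * K)) (𝓝[>] 0) (𝓝 (6 * (0 * K))) :=
      (Continuous.tendsto (by fun_prop) 0).mono_left nhdsWithin_le_nhds
    have h2 : Tendsto (fun x : ℝ => residualEntropy ν f μ S p + 24 * (x * K) * ∑ a, p a)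
        (𝓝[>] 0) (𝓝 (residualEntropy ν f μ S p + 24 * (0 * K) * ∑ a, p a)) :=
      (Continuous.tendsto (by fun_prop) 0).mono_left nhdsWithin_le_nhds
    have e1 := h1.eventually_le_const (u := 1) (by norm_num)
    have e2 := h2.eventually_lt_const (u := y) (by simpa using hy)
    obtain ⟨x, hx⟩ := (e1.and (e2.and self_mem_nhdsWithin)).exists
    exact ⟨x, hx.2.2, hx.1, hx.2.1⟩
  have hnear : ∀ᶠ S' in 𝓝 S, ∀ i j, |(S' - S) i j| * m ≤ x := by
    refine eventually_all.2 fun i => eventually_all.2 fun j => ?_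
    have : Tendsto (fun S' : Matrix (Fin m) (Fin m) ℝ => |(S' - S) i j| * m) (𝓝 S)
        (𝓝 (|(S - S) i j| * m)) := by
      refine Continuous.tendsto ?_ S
      exact ((continuous_apply_apply i j).comp (continuous_id.sub continuous_const)).abs.mul
        continuous_const
    exact this.eventually_le_const (by simpa using hx0)
  filter_upwards [nhdsWithin_le_nhds hnear, self_mem_nhdsWithin] with S' hS' hS'p
  have hx1m : (x • (1 : Matrix (Fin m) (Fin m) ℝ)).PosSemidef := Matrix.PosSemidef.one.smul hx0.le
  have hdiff := posSemidef_add_smul_one (A := S' - S) (by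
    rw [Matrix.transpose_sub, transpose_eq_of_posSemidef hS'p, transpose_eq_of_posSemidef hS]) hS'
  have h1 := residualEntropy_le_add (ν := ν) (f := f) (μ := μ) hf hS'p hx1m hp (x := x * K)
    (fun a => by
      rw [Matrix.smul_mulVec, Matrix.one_mulVec, dotProduct_smul, smul_eq_mul]
      exact mul_le_mul_of_nonneg_left (hKa a) hx0.le) (by positivity) hx1
  have h2 := residualEntropy_add_le (ν := ν) (f := f) (μ := μ) hf hS hdiff hp
  rw [← add_assoc, add_sub_cancel] at h2
  linarith

end ResidualEntropy

/-! ### The potential -/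

section Potential

theorem isClosed_unitMatrices (m : ℕ) : IsClosed (unitMatrices m) :=
  isClosed_posSemidef.inter (isClosed_posSemidef.preimage (continuous_const.sub continuous_id))

/-- Testing with `e_i ± e_j` gives `2 |U_ij| ≤ U_ii + U_jj ≤ 2`, so the entries are bounded by one.
-/
theorem isCompact_unitMatrices (m : ℕ) : IsCompact (unitMatrices m) := by
  have hK : IsCompact (Set.univ.pi fun _ : Fin m => Set.univ.pi fun _ : Fin m =>
      Set.Icc (-1 : ℝ) 1) := isCompact_univ_pi fun _ => isCompact_univ_pi fun _ => isCompact_Icc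
  refine IsCompact.of_isClosed_subset hK (isClosed_unitMatrices m) fun U hU i _ j _ => ?_
  have hq := fun y : Fin m → ℝ => hU.1.dotProduct_mulVec_nonneg y
  have hd : ∀ i, U i i ≤ 1 := fun i => by
    have := hU.2.diag_nonneg (i := i)
    simpa using this
  have hsym : U j i = U i j := congrFun (congrFun (transpose_eq_of_posSemidef hU.1) i) j
  have e : ∀ s : ℝ, (Pi.single i 1 + s • Pi.single j 1 : Fin m → ℝ) ⬝ᵥ
      U.mulVec (Pi.single i 1 + s • Pi.single j 1) = U i i + 2 * s * U i j + s * s * U j j :=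
    fun s => by
      simp only [Matrix.mulVec_add, Matrix.mulVec_smul, Matrix.mulVec_single_one, add_dotProduct,
        dotProduct_add, smul_dotProduct, dotProduct_smul, single_one_dotProduct, Matrix.col_apply,
        smul_eq_mul, hsym]
      ring
  have h1 := hq (Pi.single i 1 + (1 : ℝ) • Pi.single j 1)
  have h2 := hq (Pi.single i 1 + (-1 : ℝ) • Pi.single j 1)
  rw [star_trivial, e] at h1 h2
  exact ⟨by linarith [hd i, hd j], by linarith [hd i, hd j]⟩

variable {k L : ℕ} {𝒴 : Type*} [MeasurableSpace 𝒴] {ν : Measure 𝒴} [IsProbabilityMeasure ν]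
  {f : 𝒴 → Fin k → ℝ} {p : Fin k → ℝ} {μ : Fin k → Fin (k - 1) → ℝ} {Q : Fin k → Measure 𝒴}
  {S : Matrix (Fin (k - 1)) (Fin (k - 1)) ℝ} {R : Fin L → Matrix (Fin (k - 1)) (Fin (k - 1)) ℝ}

theorem infoFun_eq (hμ : IsWhitened p μ) [∀ a, IsProbabilityMeasure (Q a)]
    (hQ : HasDensities Q ν f) (S : Matrix (Fin (k - 1)) (Fin (k - 1)) ℝ) :
    infoFun p μ Q S
      = ENNReal.ofReal (∑ b, Real.negMulLog (p b) - residualEntropy ν f μ S p) := by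
  have hG := hasDensities_gaussianChannel S μ
  rw [infoFun, mutualInfo_mixtureLaw hμ.pos hμ.sum_eq_one hμ.injective (hQ.prod hG),
    residualEntropy, chan_chan hQ.isChannel hG.isChannel LinearGrowth.coneEntropy hμ.nonneg]

theorem residualEntropy_le (hμ : IsWhitened p μ) (hf : IsChannel ν f)
    (S : Matrix (Fin (k - 1)) (Fin (k - 1)) ℝ) :
    residualEntropy ν f μ S p ≤ ∑ b, Real.negMulLog (p b) := by
  have hη := LinearGrowth.coneEntropy (ι := Fin k)
  have hG := isChannel_gaussDensity fun a => (CFC.sqrt S).mulVec (μ a)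
  calc residualEntropy ν f μ S p ≤ chan ν f coneEntropy p :=
        chan_mono hf (hη.chan hG) hη (fun v hv => chan_coneEntropy_le hG hv) hμ.nonneg
    _ ≤ coneEntropy p := chan_coneEntropy_le hf hμ.nonneg
    _ = _ := by
      simp [coneEntropy, hμ.sum_eq_one, Real.negMulLog, Finset.sum_neg_distrib]

theorem trace_sq_nonneg {m : ℕ} {R U : Matrix (Fin m) (Fin m) ℝ}
    (hR : R.PosDef ∨ (-R).PosDef) (hU : U.PosSemidef) : 0 ≤ ((R * U) ^ 2).trace := by
  have := trace_mul_mul_transpose_mul_nonneg hR U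
  rw [transpose_eq_of_posSemidef hU, Matrix.trace_mul_comm, ← Matrix.mul_assoc,
    ← Matrix.mul_assoc] at this
  rwa [sq, ← Matrix.mul_assoc]

theorem potential_eq (hμ : IsWhitened p μ) [∀ a, IsProbabilityMeasure (Q a)]
    (hQ : HasDensities Q ν f) (S : Matrix (Fin (k - 1)) (Fin (k - 1)) ℝ)
    (hR : ∀ ℓ, (R ℓ).PosDef ∨ (-(R ℓ)).PosDef) {U : Matrix (Fin (k - 1)) (Fin (k - 1)) ℝ}
    (hU : U.PosSemidef) :
    potential p μ Q S R U = ENNReal.ofReal (∑ b, Real.negMulLog (p b)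
      - residualEntropy ν f μ (S + ∑ ℓ, R ℓ * (1 - U) * R ℓ) p
      + 1 / 4 * ∑ ℓ, ((R ℓ * U) ^ 2).trace) := by
  rw [potential, infoFun_eq hμ hQ, ENNReal.ofReal_add]
  · exact sub_nonneg.2 (residualEntropy_le hμ hQ.isChannel _)
  · exact mul_nonneg (by norm_num) (Finset.sum_nonneg fun ℓ _ => trace_sq_nonneg (hR ℓ) hU)

/-- The entropy enters the potential with a minus sign, so its upper semicontinuity makes the
potential lower semicontinuous, which is enough on a compact set. -/
theorem exists_isMinOn_potential (hμ : IsWhitened p μ) [∀ a, IsProbabilityMeasure (Q a)]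
    (hQ : HasDensities Q ν f) (hS : S.PosSemidef) (hR : ∀ ℓ, (R ℓ).PosDef ∨ (-(R ℓ)).PosDef) :
    ∃ U₀ ∈ unitMatrices (k - 1), IsMinOn (potential p μ Q S R) (unitMatrices (k - 1)) U₀ := by
  set ψ : Matrix (Fin (k - 1)) (Fin (k - 1)) ℝ → ℝ := fun U =>
    (-residualEntropy ν f μ (S + ∑ ℓ, R ℓ * (1 - U) * R ℓ) p)
      + (∑ b, Real.negMulLog (p b) + 1 / 4 * ∑ ℓ, ((R ℓ * U) ^ 2).trace) with hψ
  have hlsc : LowerSemicontinuousOn ψ (unitMatrices (k - 1)) := by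
    have hcont' : Continuous fun U : Matrix (Fin (k - 1)) (Fin (k - 1)) ℝ =>
        ∑ b, Real.negMulLog (p b) + 1 / 4 * ∑ ℓ, ((R ℓ * U) ^ 2).trace := by fun_prop
    refine LowerSemicontinuousOn.add (fun U hU y hy => ?_)
      (hcont'.lowerSemicontinuous.lowerSemicontinuousOn _)
    have hpsd : ∀ U ∈ unitMatrices (k - 1), (S + ∑ ℓ, R ℓ * (1 - U) * R ℓ).PosSemidef :=
      fun U hU => hS.add (posSemidef_sum_mul_mul hR hU.2)
    have h1 := eventually_residualEntropy_lt (ν := ν) (f := f) (μ := μ) hQ.isChannel hμ.nonneg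
      (hpsd U hU) (y := -y) (by linarith)
    have hcont : Continuous fun U : Matrix (Fin (k - 1)) (Fin (k - 1)) ℝ =>
        S + ∑ ℓ, R ℓ * (1 - U) * R ℓ := by fun_prop
    have h2 : Tendsto (fun U => S + ∑ ℓ, R ℓ * (1 - U) * R ℓ) (𝓝[unitMatrices (k - 1)] U)
        (𝓝[{A | A.PosSemidef}] (S + ∑ ℓ, R ℓ * (1 - U) * R ℓ)) :=
      hcont.continuousWithinAt.tendsto_nhdsWithin hpsd
    filter_upwards [h2.eventually h1] with U' hU'
    linarith
  have hne : (unitMatrices (k - 1)).Nonempty :=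
    ⟨1, Matrix.PosSemidef.one, by rw [sub_self]; exact Matrix.PosSemidef.zero⟩
  obtain ⟨U₀, hU₀, hmin⟩ := hlsc.exists_isMinOn hne (isCompact_unitMatrices _)
  refine ⟨U₀, hU₀, fun U hU => ?_⟩
  have := hmin hU
  simp only [Set.mem_ofPred_eq, hψ] at this ⊢
  rw [potential_eq hμ hQ S hR hU.1, potential_eq hμ hQ S hR hU₀.1]
  exact ENNReal.ofReal_le_ofReal (by linarith)

end Potential

/-! ### The limit of many nodes -/

/-- The bound for `n` nodes is used with `V = 1 - U`, for an arbitrary `U`; after division by `n`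
its error terms vanish. -/
theorem limsup_mutualInfo_modelLaw_le {k L : ℕ} {𝒴 : Type*} [MeasurableSpace 𝒴] {ν : Measure 𝒴}
    [IsProbabilityMeasure ν] {f : 𝒴 → Fin k → ℝ} {p : Fin k → ℝ} {μ : Fin k → Fin (k - 1) → ℝ}
    {Q : Fin k → Measure 𝒴} {S : Matrix (Fin (k - 1)) (Fin (k - 1)) ℝ}
    {R : Fin L → Matrix (Fin (k - 1)) (Fin (k - 1)) ℝ} (hμ : IsWhitened p μ)
    [∀ a, IsProbabilityMeasure (Q a)] (hQ : HasDensities Q ν f) (hS : S.PosSemidef)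
    (hR : ∀ ℓ, (R ℓ).PosDef ∨ (-(R ℓ)).PosDef) {d : Fin L → ℕ → ℝ}
    (hd : ∀ ℓ, Tendsto (fun n => d ℓ n) atTop atTop)
    (hnd : ∀ ℓ, Tendsto (fun n : ℕ => (n : ℝ) - d ℓ n) atTop atTop)
    {U : Matrix (Fin (k - 1)) (Fin (k - 1)) ℝ} (hU : U ∈ unitMatrices (k - 1)) :
    limsup (fun n : ℕ => mutualInfo (modelLaw p μ Q S R n fun ℓ => d ℓ n) / (n : ℝ≥0∞)) atTop
      ≤ potential p μ Q S R U := by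
  set Θ : ℝ := ∑ ℓ, ∑ a, ∑ b, |μ a ⬝ᵥ (R ℓ).mulVec (μ b)| with hΘ
  have hΘ0 : 0 ≤ Θ := by positivity
  have hθ : ∀ ℓ a b, |μ a ⬝ᵥ (R ℓ).mulVec (μ b)| ≤ Θ := fun ℓ a b => by
    have h1 := Finset.single_le_sum (f := fun ℓ => ∑ a, ∑ b, |μ a ⬝ᵥ (R ℓ).mulVec (μ b)|)
      (fun _ _ => by positivity) (Finset.mem_univ ℓ)
    have h2 := Finset.single_le_sum (f := fun a => ∑ b, |μ a ⬝ᵥ (R ℓ).mulVec (μ b)|)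
      (fun _ _ => by positivity) (Finset.mem_univ a)
    have h3 := Finset.single_le_sum (f := fun b => |μ a ⬝ᵥ (R ℓ).mulVec (μ b)|)
      (fun _ _ => abs_nonneg _) (Finset.mem_univ b)
    exact h3.trans (h2.trans h1)
  -- The two square roots bound the scores of a present and an absent edge; summing over networks
  -- gives one `ε` for all.
  set ε : ℕ → ℝ := fun n => ∑ ℓ, (√(1 / d ℓ n) + √(1 / (n - d ℓ n))) with hε
  have hε0 : ∀ n, 0 ≤ ε n := fun n => by positivity
  have hεt : Tendsto ε atTop (𝓝 0) := by
    have h : ∀ u : ℕ → ℝ, Tendsto u atTop atTop →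
        Tendsto (fun n => √(1 / u n)) atTop (𝓝 0) := fun u hu => by
      rw [← Real.sqrt_zero]
      exact (Real.continuous_sqrt.tendsto 0).comp (hu.const_div_atTop 1)
    have := tendsto_finsetSum (Finset.univ : Finset (Fin L)) fun ℓ _ =>
      (h _ (hd ℓ)).add (h _ (hnd ℓ))
    rwa [Finset.sum_congr rfl fun _ _ => add_zero _, Finset.sum_const_zero] at this
  set ψ : ℝ := ∑ b, Real.negMulLog (p b)
      - residualEntropy ν f μ (S + ∑ ℓ, R ℓ * (1 - U) * R ℓ) p
      + 1 / 4 * ∑ ℓ, ((R ℓ * U) ^ 2).trace with hψ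
  have hbound : ∀ᶠ n : ℕ in atTop,
      mutualInfo (modelLaw p μ Q S R n fun ℓ => d ℓ n) / (n : ℝ≥0∞)
        ≤ ENNReal.ofReal (ψ + L * Θ ^ 2 / 4 / n + L * (5 / 2 * Θ ^ 3 * ε n)) := by
    have hsmall : ∀ᶠ n in atTop, Θ * ε n ≤ 1 / 2 := by
      have := hεt.const_mul Θ
      exact this.eventually_le_const (by norm_num)
    filter_upwards [eventually_gt_atTop 0, hsmall, eventually_all.2 fun ℓ =>
      (hd ℓ).eventually_gt_atTop 0, eventually_all.2 fun ℓ => (hnd ℓ).eventually_gt_atTop 0]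
      with n hn hsm hd0 hnd0
    have hle : ∀ ℓ, √(1 / d ℓ n) + √(1 / (n - d ℓ n)) ≤ ε n := fun ℓ =>
      Finset.single_le_sum (f := fun ℓ => √(1 / d ℓ n) + √(1 / (n - d ℓ n)))
        (fun _ _ => by positivity) (Finset.mem_univ ℓ)
    have h := mutualInfo_modelLaw_le hμ hn hQ hS hR hU.2 (d := fun ℓ => d ℓ n) hd0
      (fun ℓ => sub_pos.1 (hnd0 ℓ)) (hε0 n)
      (fun ℓ => (Real.sqrt_le_left (hε0 n)).1
        ((le_add_of_nonneg_right (Real.sqrt_nonneg _)).trans (hle ℓ)))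
      (fun ℓ => (Real.sqrt_le_left (hε0 n)).1
        ((le_add_of_nonneg_left (Real.sqrt_nonneg _)).trans (hle ℓ))) hΘ0 hθ hsm
    rw [sub_sub_cancel, ENNReal.ofReal_mul (Nat.cast_nonneg n), ENNReal.ofReal_natCast] at h
    exact ENNReal.div_le_of_le_mul' h
  have hlim : Tendsto (fun n : ℕ => ENNReal.ofReal
      (ψ + L * Θ ^ 2 / 4 / n + L * (5 / 2 * Θ ^ 3 * ε n))) atTop (𝓝 (ENNReal.ofReal ψ)) := by
    refine (ENNReal.continuous_ofReal.tendsto ψ).comp ?_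
    have h1 : Tendsto (fun n : ℕ => L * Θ ^ 2 / 4 / (n : ℝ)) atTop (𝓝 0) :=
      tendsto_const_div_atTop_nhds_zero_nat _
    have h2 : Tendsto (fun n : ℕ => L * (5 / 2 * Θ ^ 3 * ε n)) atTop (𝓝 0) := by
      simpa using (hεt.const_mul (5 / 2 * Θ ^ 3)).const_mul (L : ℝ)
    simpa using (tendsto_const_nhds.add h1).add h2
  rw [potential_eq hμ hQ S hR hU.1, ← hlim.limsup_eq]
  exact limsup_le_limsup hbound

end CommunityDetection

end

open CommunityDetection in
/-- The potential is finite and attains its minimum on `𝒰`, and the limit superior of the per-node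
mutual information is at most that minimum. -/
theorem theorem1 {k L : ℕ} {𝒴 : Type*} [MeasurableSpace 𝒴]
    (p : Fin k → ℝ) (μ : Fin k → Fin (k - 1) → ℝ) (hμ : IsWhitened p μ)
    (Q : Fin k → Measure 𝒴) (hQ : ∀ a, IsProbabilityMeasure (Q a))
    (S : Matrix (Fin (k - 1)) (Fin (k - 1)) ℝ) (hS : S.PosSemidef)
    (R : Fin L → Matrix (Fin (k - 1)) (Fin (k - 1)) ℝ)
    (hR : ∀ ℓ, (R ℓ).PosDef ∨ (-(R ℓ)).PosDef)
    (d : Fin L → ℕ → ℝ)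
    (hd : ∀ ℓ, Tendsto (fun n => d ℓ n) atTop atTop)
    (hnd : ∀ ℓ, Tendsto (fun n : ℕ => (n : ℝ) - d ℓ n) atTop atTop) :
    (∀ U ∈ unitMatrices (k - 1), potential p μ Q S R U ≠ ∞) ∧
    ∃ U₀ ∈ unitMatrices (k - 1),
      IsMinOn (potential p μ Q S R) (unitMatrices (k - 1)) U₀ ∧
      limsup (fun n : ℕ =>
          mutualInfo (modelLaw p μ Q S R n fun ℓ => d ℓ n) / (n : ℝ≥0∞)) atTop
        ≤ potential p μ Q S R U₀ := by
  obtain ⟨ν, f, hν, hf⟩ := exists_hasDensities hμ.pos hμ.sum_eq_one Q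
  refine ⟨fun U hU => ?_, ?_⟩
  · rw [potential_eq hμ hf S hR hU.1]
    exact ENNReal.ofReal_ne_top
  · obtain ⟨U₀, hU₀, hmin⟩ := exists_isMinOn_potential hμ hf hS hR
    exact ⟨U₀, hU₀, hmin, limsup_mutualInfo_modelLaw_le hμ hf hS hR hd hnd hU₀⟩
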